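/- Let $\rho_0>0$, $\Omega\in\mathbb R$, let $\mathcal D=\{(\rho,\zeta):\rho>0\}\setminus\{(\rho,0):0<\rho\le\rho_0\}$ be the exterior of a disk, and write $z=\rho+i\zeta$, $\sigma_1=\begin{pmatrix}0&1\\1&0\end{pmatrix}$, $\sigma_3=\begin{pmatrix}1&0\\0&-1\end{pmatrix}$. Let $f=e^{2U}+ib$ be a $C^2$ solution in $\mathcal D$ of the Ernst equation $$\tfrac{f+\bar f}{2}\left(f_{\rho\rho}+f_{\zeta\zeta}+\tfrac1\rho f_\rho\right)=f_\rho^2+f_\zeta^2 ,$$ which together with $f_\rho,f_\zeta$ extends continuously, from each of the two sides $\zeta>0$ and $\zeta<0$, to the axis $\rho=0$ (including the points $\pm i0$) and to the faces $\zeta=\pm0$, $0<\rho<\rho_0$, of the disk, with $\mathrm{Re}\,f>0$ in $\mathcal D$, on the axis and on the faces (no ergospheres), $f_\rho(+0,\zeta)=0$ for $\zeta\ne0$, and $f\to1$ as $\rho^2+\zeta^2\to\infty$. Equatorial symmetry is not assumed. Let $a$ be the metric function, $a_\rho=\rho e^{-4U}b_\zeta$, $a_\zeta=-\rho e^{-4U}b_\rho$,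 with $a\to0$ on the axis and at infinity. Let $f'=e^{2U'}+ib'$ be the Ernst potential in coordinates corotating with angular velocity $\Omega$: $$e^{2U'}=e^{2U}\left[(1+\Omega a)^2-\Omega^2\rho^2e^{-4U}\right],\qquad e^{2U'}a'=e^{2U}a(1+\Omega a)-\Omega\rho^2e^{-2U},$$ $a'_\rho=\rho e^{-4U'}b'_\zeta$, $a'_\zeta=-\rho e^{-4U'}b'_\rho$ (where $\mathrm{Re}\,f'\neq0$; here $e^{2U'}$ denotes $\mathrm{Re}\,f'$, which may be negative far from the disk). Let $\lambda(z,k^\pm)=\pm\left(\frac{k-i\bar z}{k+iz}\right)^{1/2}$, with branch cut $[-iz,i\bar z]$ in the $k$-plane and $\lambda(z,k^+)\to1$ as $k\to\infty$, let $\Gamma=[-i\rho_0,i\rho_0]$, and for $k\in\mathbb C\setminus\Gamma$ let $\Phi(z,k^\pm)$ be the $2\times2$-matrix solution of $$\Phi_z=\begin{pmatrix}\beta&\lambda \beta\\ \lambda\alpha&\alpha\end{pmatrix}\Phi,\qquad \Phi_{\bar z}=\begin{pmatrix}\bar\alpha&\lambda^{-1}\bar\alpha\\ \lambda^{-1}\bar\beta&\bar\beta\end{pmatrix}\Phi,\qquad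 \alpha=\frac{f_z}{f+\bar f},\quad \beta=\frac{\bar f_z}{f+\bar f},$$ that is single-valued on the two-sheeted surface of $\lambda$ (the sheets are glued crosswise along the cut and coincide at the branch points), extends continuously to the axis, and satisfies $[\Phi(z,k^-)]_1\to(1,1)^T$, $[\Phi(z,k^+)]_2\to(1,-1)^T$ as $z\to i\infty$ along the axis. The spectral functions $F,G$ on $\mathbb C\setminus\Gamma$ are defined by $$\lim_{\zeta\to+\infty}\Phi(i\zeta,k^+)=\begin{pmatrix}1&1\\1&-1\end{pmatrix}\begin{pmatrix}F(k)&0\\G(k)&1\end{pmatrix}$$ (equivalently $\Phi(i\zeta,k^+)=\begin{pmatrix}\overline{f(i\zeta)}&1\\f(i\zeta)&-1\end{pmatrix}\begin{pmatrix}F(k)&0\\G(k)&1\end{pmatrix}$ for $\zeta>0$). For $k\in\Gamma$ let $$A_+(k)=\begin{pmatrix}F_+(k)&0\\G_+(k)&1\end{pmatrix},$$ where $F_+,G_+$ are the limits of $F,G$ at $k$ from the right half-plane $\mathrm{Re}\,k>0$. Let $$B=\begin{pmatrix}\overline{f(+i0)}&1\\f(+i0)&-1\end{pmatrix},\qquad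 \Lambda(k)=\Lambda(+i0,k^+)=\lim_{z\to0,\ \rho,\zeta>0}\Lambda(z,k^+),$$ $$\Lambda(z,k)=(1+\Omega a)I-\Omega\rho e^{-2U}\sigma_3+i(k+iz)\Omega e^{-2U}\left(-\sigma_3+\lambda(z,k)\sigma_1\sigma_3\right),$$ and let bars over matrices denote entrywise complex conjugation (so $\bar\Lambda=\overline{\Lambda(k)}$, $\bar A_+=\overline{A_+(k)}$). **Proposition.** Suppose that $f'_\rho=0$ on the disk, i.e. $f'_\rho(\rho,\pm0)=0$ for $0<\rho<\rho_0$. Then the limits $F_+(k),G_+(k)$ exist for $k\in\Gamma$, $k\ne\pm i\rho_0$, the limit $\Lambda(k)$ exists for all $k\in\Gamma$, and $$\left(B^{-1}\Lambda^{-1}\sigma_1\sigma_3\bar\Lambda\bar B\right)\left(\bar A_+\sigma_1\bar A_+^{-1}\right)=-\left(A_+\sigma_1A_+^{-1}\right)\left(B^{-1}\Lambda^{-1}\sigma_1\sigma_3\bar\Lambda\bar B\right)$$ at every $k\in\Gamma$ at which the limits $F_+,G_+$ exist and $A_+$ is invertible (at $k=\pm i\rho_0$ this includes the existence of the limits as a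 condition). If moreover $f$ is equatorially symmetric, $f(\rho,-\zeta)=\overline{f(\rho,\zeta)}$ in $\mathcal D$, then the same relation holds with $\bar B$ replaced by $\begin{pmatrix}\overline{f(-i0)}&1\\f(-i0)&-1\end{pmatrix}$. -/

import Mathlib

open Filter Topology

noncomputable section

namespace Ernst

/-! A point `p : ℝ × ℝ` is `(ρ, ζ)`, and `z = ρ + iζ`. -/

/-- The exterior of the disk `{ζ = 0, 0 ≤ ρ ≤ ρ₀}` in the open half-plane `ρ > 0`. -/
def exterior (ρ₀ : ℝ) : Set (ℝ × ℝ) := {p | 0 < p.1 ∧ (p.2 ≠ 0 ∨ ρ₀ < p.1)}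

/-- The exterior domain together with the two halves `ζ > 0` and `ζ < 0` of the axis `ρ = 0`. -/
def exteriorWithAxis (ρ₀ : ℝ) : Set (ℝ × ℝ) := {p | 0 ≤ p.1 ∧ (p.2 ≠ 0 ∨ ρ₀ < p.1)}

def upperQuadrant : Set (ℝ × ℝ) := {p | 0 < p.1 ∧ 0 < p.2}

def lowerQuadrant : Set (ℝ × ℝ) := {p | 0 < p.1 ∧ p.2 < 0}

/-- Closed upper quadrant without the rim `(ρ₀, 0)` of the disk. -/
def upperBoundaryRegion (ρ₀ : ℝ) : Set (ℝ × ℝ) := {p | 0 ≤ p.1 ∧ 0 ≤ p.2 ∧ p ≠ (ρ₀, 0)}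

/-- Closed lower quadrant without the rim `(ρ₀, 0)` of the disk. -/
def lowerBoundaryRegion (ρ₀ : ℝ) : Set (ℝ × ℝ) := {p | 0 ≤ p.1 ∧ p.2 ≤ 0 ∧ p ≠ (ρ₀, 0)}

/-- Partial derivative in `ρ`. -/
def dRho {E : Type*} [NormedAddCommGroup E] [NormedSpace ℝ E] (g : ℝ × ℝ → E) (p : ℝ × ℝ) : E :=
  deriv (fun r : ℝ => g (r, p.2)) p.1

/-- Partial derivative in `ζ`. -/
def dZeta {E : Type*} [NormedAddCommGroup E] [NormedSpace ℝ E] (g : ℝ × ℝ → E) (p : ℝ × ℝ) : E :=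
  deriv (fun t : ℝ => g (p.1, t)) p.2

/-- `g` extends continuously from each side to the axis and to the two faces of the disk
(the rim excluded; the two extensions need not agree across the disk). -/
def ExtendsToBoundary (ρ₀ : ℝ) (g : ℝ × ℝ → ℂ) : Prop :=
  (∀ p ∈ upperBoundaryRegion ρ₀, ∃ l : ℂ, Tendsto g (𝓝[upperQuadrant] p) (𝓝 l)) ∧
  (∀ p ∈ lowerBoundaryRegion ρ₀, ∃ l : ℂ, Tendsto g (𝓝[lowerQuadrant] p) (𝓝 l))

/-- `f` is a solution of the Ernst equation in the exterior of the disk of radius `ρ₀`, `C¹` up to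
the axis and the faces of the disk, with positive real part (no ergospheres), regular on the
rotation axis, and asymptotically flat. -/
structure IsErnstPotential (ρ₀ : ℝ) (f : ℝ × ℝ → ℂ) : Prop where
  contDiffOn : ContDiffOn ℝ 2 f (exterior ρ₀)
  ernst : ∀ p ∈ exterior ρ₀,
    (f p + starRingEnd ℂ (f p)) / 2 *
        (dRho (dRho f) p + dZeta (dZeta f) p + 1 / (p.1 : ℂ) * dRho f p) =
      dRho f p ^ 2 + dZeta f p ^ 2
  extends_self : ExtendsToBoundary ρ₀ f
  extends_dRho : ExtendsToBoundary ρ₀ (dRho f)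
  extends_dZeta : ExtendsToBoundary ρ₀ (dZeta f)
  re_pos : ∀ p ∈ exterior ρ₀, 0 < (f p).re
  re_pos_upper : ∀ p ∈ upperBoundaryRegion ρ₀, ∀ l : ℂ,
    Tendsto f (𝓝[upperQuadrant] p) (𝓝 l) → 0 < l.re
  re_pos_lower : ∀ p ∈ lowerBoundaryRegion ρ₀, ∀ l : ℂ,
    Tendsto f (𝓝[lowerQuadrant] p) (𝓝 l) → 0 < l.re
  axis : ∀ ζ : ℝ, ζ ≠ 0 → Tendsto (fun ρ : ℝ => dRho f (ρ, ζ)) (𝓝[>] 0) (𝓝 0)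
  flat : Tendsto f (cocompact (ℝ × ℝ) ⊓ 𝓟 (exterior ρ₀)) (𝓝 1)

/-- `a` is the metric function belonging to `f = e^{2U} + i b`:
`a_ρ = ρ e^{-4U} b_ζ`, `a_ζ = -ρ e^{-4U} b_ρ`, and `a → 0` on the axis and at infinity. -/
structure IsMetricFunction (ρ₀ : ℝ) (f : ℝ × ℝ → ℂ) (a : ℝ × ℝ → ℝ) : Prop where
  differentiableOn : DifferentiableOn ℝ a (exterior ρ₀)
  dRho_eq : ∀ p ∈ exterior ρ₀,
    dRho a p = p.1 / (f p).re ^ 2 * dZeta (fun q => (f q).im) p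
  dZeta_eq : ∀ p ∈ exterior ρ₀,
    dZeta a p = -(p.1 / (f p).re ^ 2 * dRho (fun q => (f q).im) p)
  axis : ∀ ζ : ℝ, ζ ≠ 0 → Tendsto (fun ρ : ℝ => a (ρ, ζ)) (𝓝[>] 0) (𝓝 0)
  flat : Tendsto a (cocompact (ℝ × ℝ) ⊓ 𝓟 (exterior ρ₀)) (𝓝 0)

/-- `e^{2U'} = e^{2U} ((1 + Ω a)² - Ω² ρ² e^{-4U})`, with `e^{2U} = Re f`. -/
def corotExp (Ω : ℝ) (f : ℝ × ℝ → ℂ) (a : ℝ × ℝ → ℝ) (p : ℝ × ℝ) : ℝ :=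
  (f p).re * ((1 + Ω * a p) ^ 2 - Ω ^ 2 * p.1 ^ 2 / (f p).re ^ 2)

/-- The corotating metric function `a'`, read off from the line element after `φ' = φ - Ω t`:
`e^{2U'} a' = e^{2U} a (1 + Ω a) - Ω ρ² e^{-2U}`. For `Ω = 0` this is `a` itself. -/
def corotA (Ω : ℝ) (f : ℝ × ℝ → ℂ) (a : ℝ × ℝ → ℝ) (p : ℝ × ℝ) : ℝ :=
  ((f p).re * a p * (1 + Ω * a p) - Ω * p.1 ^ 2 / (f p).re) / corotExp Ω f a p

/-- The relation `(1 - Ω a') e^{2U'} = (1 + Ω a) e^{2U}`. -/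
theorem corotA_relation (Ω : ℝ) (f : ℝ × ℝ → ℂ) (a : ℝ × ℝ → ℝ) (p : ℝ × ℝ)
    (h : (f p).re ≠ 0) (h' : corotExp Ω f a p ≠ 0) :
    (1 - Ω * corotA Ω f a p) * corotExp Ω f a p = (1 + Ω * a p) * (f p).re := by
  unfold corotA
  rw [sub_mul, mul_assoc, div_mul_cancel₀ _ h']
  unfold corotExp
  field_simp
  ring

/-- `f' = e^{2U'} + i b'` is an Ernst potential in coordinates corotating with angular velocity
`Ω`: `b'` is related to `a'` as `b` is to `a`. (It is unique up to an imaginary constant.) -/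
structure IsCorotatingPotential (ρ₀ Ω : ℝ) (f : ℝ × ℝ → ℂ) (a : ℝ × ℝ → ℝ)
    (f' : ℝ × ℝ → ℂ) : Prop where
  differentiableOn : DifferentiableOn ℝ f' (exterior ρ₀)
  re_eq : ∀ p ∈ exterior ρ₀, (f' p).re = corotExp Ω f a p
  dRho_eq : ∀ p ∈ exterior ρ₀, (f' p).re ≠ 0 →
    dRho (corotA Ω f a) p = p.1 / (f' p).re ^ 2 * dZeta (fun q => (f' q).im) p
  dZeta_eq : ∀ p ∈ exterior ρ₀, (f' p).re ≠ 0 →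
    dZeta (corotA Ω f a) p = -(p.1 / (f' p).re ^ 2 * dRho (fun q => (f' q).im) p)

/-! ### The Lax pair -/

inductive Sheet
  | upper
  | lower

def Sheet.sign : Sheet → ℂ
  | .upper => 1
  | .lower => -1

def Sheet.other : Sheet → Sheet
  | .upper => .lower
  | .lower => .upper

/-- `λ(z, k^±) = ± ((k - i z̄) / (k + i z))^{1/2}`. The principal root is continuous in `k` off the
branch cut `[-iz, i z̄]` and tends to `1` as `k → ∞`. -/
def lam (s : Sheet) (k : ℂ) (p : ℝ × ℝ) : ℂ :=
  s.sign * ((k - Complex.I * ((p.1 : ℂ) - Complex.I * (p.2 : ℂ))) /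
    (k + Complex.I * ((p.1 : ℂ) + Complex.I * (p.2 : ℂ)))) ^ (1 / 2 : ℂ)

/-- The coefficient `W₁` of `dρ` in `W = W₁ dρ + W₂ dζ`. -/
def laxRho (f : ℝ × ℝ → ℂ) (s : Sheet) (k : ℂ) (p : ℝ × ℝ) : Matrix (Fin 2) (Fin 2) ℂ :=
  let l := lam s k p
  let fr := dRho f p
  let fz := dZeta f p
  let gr := starRingEnd ℂ fr
  let gz := starRingEnd ℂ fz
  (1 / (f p + starRingEnd ℂ (f p))) •
    !![gr, 1 / 2 * ((1 / l + l) * gr + Complex.I * (1 / l - l) * gz);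
       1 / 2 * ((1 / l + l) * fr + Complex.I * (1 / l - l) * fz), fr]

/-- The coefficient `W₂` of `dζ` in `W = W₁ dρ + W₂ dζ`. -/
def laxZeta (f : ℝ × ℝ → ℂ) (s : Sheet) (k : ℂ) (p : ℝ × ℝ) : Matrix (Fin 2) (Fin 2) ℂ :=
  let l := lam s k p
  let fr := dRho f p
  let fz := dZeta f p
  let gr := starRingEnd ℂ fr
  let gz := starRingEnd ℂ fz
  (1 / (f p + starRingEnd ℂ (f p))) •
    !![gz, 1 / 2 * ((1 / l + l) * gz - Complex.I * (1 / l - l) * gr);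
       1 / 2 * ((1 / l + l) * fz - Complex.I * (1 / l - l) * fr), fz]

/-- The points `z` for which `k` lies on the closed branch cut `[-iz, i z̄]`; its end point
`(|Im k|, Re k)` is the one point at which `k` is a branch point. -/
def cut (k : ℂ) : Set (ℝ × ℝ) := {p | p.2 = k.re ∧ |k.im| ≤ p.1}

/-- `Γ = [-iρ₀, iρ₀]`. -/
def Gam (ρ₀ : ℝ) : Set ℂ := {k | k.re = 0 ∧ |k.im| ≤ ρ₀}

/-- `Φ s k p` is the eigenfunction `Φ(z, k^±)`, `k ∉ Γ`: the solution of `dΦ = W Φ` that, for fixed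
`k`, is single-valued on the two-sheeted Riemann surfaces (the two sheets are glued crosswise along
the cut and meet at the branch point), extends to the axis, and satisfies the initial conditions
at `i∞`. -/
structure IsEigenfunction (ρ₀ : ℝ) (f : ℝ × ℝ → ℂ)
    (Φ : Sheet → ℂ → ℝ × ℝ → Matrix (Fin 2) (Fin 2) ℂ) : Prop where
  continuousOn : ∀ s, ∀ k ∉ Gam ρ₀, ContinuousOn (Φ s k) (exteriorWithAxis ρ₀ \ cut k)
  lax_rho : ∀ s, ∀ k ∉ Gam ρ₀, ∀ p ∈ exterior ρ₀ \ cut k, ∀ i j,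
    HasDerivAt (fun r : ℝ => Φ s k (r, p.2) i j) ((laxRho f s k p * Φ s k p) i j) p.1
  lax_zeta : ∀ s, ∀ k ∉ Gam ρ₀, ∀ p ∈ exterior ρ₀ \ cut k, ∀ i j,
    HasDerivAt (fun t : ℝ => Φ s k (p.1, t) i j) ((laxZeta f s k p * Φ s k p) i j) p.2
  glue : ∀ s, ∀ k ∉ Gam ρ₀, ∀ ρ : ℝ, |k.im| < ρ →
    ∃ L, Tendsto (Φ s k) (𝓝[{q | k.re < q.2}] (ρ, k.re)) (𝓝 L) ∧
      Tendsto (Φ s.other k) (𝓝[{q | q.2 < k.re}] (ρ, k.re)) (𝓝 L)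
  branch : ∀ k ∉ Gam ρ₀, ∃ L, ∀ s,
    Tendsto (Φ s k) (𝓝[exteriorWithAxis ρ₀ \ cut k] (|k.im|, k.re)) (𝓝 L)
  initial_lower : ∀ k ∉ Gam ρ₀,
    Tendsto (fun ζ : ℝ => Φ .lower k (0, ζ) 0 0) atTop (𝓝 1) ∧
      Tendsto (fun ζ : ℝ => Φ .lower k (0, ζ) 1 0) atTop (𝓝 1)
  initial_upper : ∀ k ∉ Gam ρ₀,
    Tendsto (fun ζ : ℝ => Φ .upper k (0, ζ) 0 1) atTop (𝓝 1) ∧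
      Tendsto (fun ζ : ℝ => Φ .upper k (0, ζ) 1 1) atTop (𝓝 (-1))

/-- The matrix `A = [F, 0; G, 1]`. -/
def spectralMatrix (F G : ℂ) : Matrix (Fin 2) (Fin 2) ℂ := !![F, 0; G, 1]

/-- The matrix `[f̄, 1; f, -1]`. -/
def axisMatrix (f : ℂ) : Matrix (Fin 2) (Fin 2) ℂ := !![starRingEnd ℂ f, 1; f, -1]

/-- `F` and `G` are the spectral functions of `Φ`: for `k ∉ Γ`, the axis values
`Φ(iζ, k^+) = [f̄(iζ), 1; f(iζ), -1] [F, 0; G, 1]`, `ζ > 0`, determine them; here they are read off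
at `ζ → ∞`, where `f = 1`. -/
def IsSpectralPair (ρ₀ : ℝ) (Φ : Sheet → ℂ → ℝ × ℝ → Matrix (Fin 2) (Fin 2) ℂ)
    (F G : ℂ → ℂ) : Prop :=
  ∀ k ∉ Gam ρ₀, Tendsto (fun ζ : ℝ => Φ .upper k (0, ζ)) atTop
    (𝓝 (axisMatrix 1 * spectralMatrix (F k) (G k)))

/-! ### The gauge matrix and the relation -/

def sigma1 : Matrix (Fin 2) (Fin 2) ℂ := !![0, 1; 1, 0]

def sigma3 : Matrix (Fin 2) (Fin 2) ℂ := !![1, 0; 0, -1]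

/-- `Λ(z, k^+) = (1 + Ω a) I - Ω ρ e^{-2U} σ₃ + i (k + iz) Ω e^{-2U} (-σ₃ + λ(z, k^+) σ₁ σ₃)`. -/
def gaugeMatrix (Ω : ℝ) (f : ℝ × ℝ → ℂ) (a : ℝ × ℝ → ℝ) (k : ℂ) (p : ℝ × ℝ) :
    Matrix (Fin 2) (Fin 2) ℂ :=
  (1 + (Ω : ℂ) * (a p : ℂ)) • (1 : Matrix (Fin 2) (Fin 2) ℂ)
    - ((Ω : ℂ) * (p.1 : ℂ) / ((f p).re : ℂ)) • sigma3
    + (Complex.I * (k + Complex.I * ((p.1 : ℂ) + Complex.I * (p.2 : ℂ))) * (Ω : ℂ) /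
        ((f p).re : ℂ)) • (-sigma3 + lam .upper k p • (sigma1 * sigma3))

/-- Entrywise complex conjugate. -/
def conjM (M : Matrix (Fin 2) (Fin 2) ℂ) : Matrix (Fin 2) (Fin 2) ℂ := M.map (starRingEnd ℂ)

/-- `(B⁻¹ Λ⁻¹ σ₁ σ₃ Λ̄ B') (Ā σ₁ Ā⁻¹) = - (A σ₁ A⁻¹) (B⁻¹ Λ⁻¹ σ₁ σ₃ Λ̄ B')`. -/
def AlgebraicRelation (B B' Λ A : Matrix (Fin 2) (Fin 2) ℂ) : Prop :=
  (B⁻¹ * Λ⁻¹ * sigma1 * sigma3 * conjM Λ * B') * (conjM A * sigma1 * (conjM A)⁻¹) =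
    -((A * sigma1 * A⁻¹) * (B⁻¹ * Λ⁻¹ * sigma1 * sigma3 * conjM Λ * B'))

end Ernst

end

/-! The proof transports `Φ` along one segment and sandwiches a gauge term that becomes conserved on
the disk. Write `k = ε + iκ` with `ε > 0`, `|κ| < ρ₀`, and join the axis to the branch point `(|κ|,
ε)` of `k` by the horizontal segment at height `ε`. With `ρ = |κ| sin θ` the singularity of `λ` at
the branch point cancels against `dρ/dθ`, and the Lax pair becomes a linear equation `Y' = N Y` on
`[0, π/2]` whose coefficients stay continuous up to `ε = 0`, where the segment lies on the upper
face of the disk.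

Changing the sheet conjugates `N` by `σ₃`. On the axis the normalised columns of the two sheets are
constant, and at the branch point the sheets agree; uniqueness therefore gives `L σ₁ = σ₃ L` for the
end value `L = Y(π/2)` (`exists_segment_solution`). The boundary values of `F`, `G` follow: the
second column of `Y` is known on the axis and converges at the branch point as `k` tends to `Γ`, the
identity for `L` turns it into the first column, and that column is transported back to the axis
(`exists_spectral_limit`).

For the relation, let `m = 1 + Ωa`, `v = e^{-2U}`. On the segment `Λ = m I + κΩv (σ₃ - cos θ σ₁σ₃)`,
and `T = adj(Λ) σ₁σ₃ Λ̄` is the matrix `gaugeConj`. The derivative of `adj(Y) T Ȳ` is `adj(Y) E Ȳ`,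
where `E` is linear in the real and imaginary parts of `f'_ρ` (`segment_identity`). Since `f'_ρ = 0`
on the face, `E` tends to zero uniformly as `ε → 0`, so the values of `adj(Y) T Ȳ` at the two ends
have the same limit `Z`. At the branch point `T` is off-diagonal and `L σ₁ = σ₃ L`, whence `Z σ₁ =
-σ₁ Z` (`anticommute_of_tendsto`). At the axis `Y = B A₊` and `T = Λ⁻¹σ₁σ₃Λ̄`, so `Z` is a scalar
multiple of `A₊⁻¹ (B⁻¹Λ⁻¹σ₁σ₃Λ̄B̄) Ā₊` when `A₊` is invertible, and the anticommutation is the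
asserted relation (`relation_of_anticommute`).

The points `κ = 0` and `κ = ±ρ₀` are reached by continuity of the boundary values along `Γ`. -/

noncomputable section

namespace Ernst

/-! ### Linear differential equations on a compact interval -/

section LinearODE

/-- Gronwall's inequality with the differential inequality assumed only in the open interval: it is
applied on `[s, t]` inside, then `s → 0` and `t` moves to the end points by continuity. -/
theorem norm_le_of_deriv_le {E : Type*} [NormedAddCommGroup E] [NormedSpace ℝ E]
    {h h' : ℝ → E} {C η T : ℝ} (hC : 0 < C) (hη : 0 ≤ η)
    (hc : ContinuousOn h (Set.Icc 0 T))
    (hd : ∀ t ∈ Set.Ioo 0 T, HasDerivAt h (h' t) t)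
    (hb : ∀ t ∈ Set.Ioo 0 T, ‖h' t‖ ≤ C * ‖h t‖ + η) :
    ∀ t ∈ Set.Icc 0 T, ‖h t‖ ≤ (‖h 0‖ + η / C) * Real.exp (C * T) := by
  have hηC : 0 ≤ η / C := by positivity
  have key : ∀ s ∈ Set.Ioo 0 T, ∀ t ∈ Set.Ico s T,
      ‖h t‖ ≤ (‖h s‖ + η / C) * Real.exp (C * T) := by
    intro s hs t ht
    have h1 := norm_le_gronwallBound_of_norm_deriv_right_le (f := h) (f' := h') (δ := ‖h s‖)
      (K := C) (ε := η) (a := s) (b := t)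
      (hc.mono (Set.Icc_subset_Icc hs.1.le ht.2.le))
      (fun x hx => (hd x ⟨hs.1.trans_le hx.1, hx.2.trans ht.2⟩).hasDerivWithinAt) le_rfl
      (fun x hx => hb x ⟨hs.1.trans_le hx.1, hx.2.trans ht.2⟩) t ⟨ht.1, le_rfl⟩
    rw [gronwallBound_of_K_ne_0 hC.ne'] at h1
    have h2 : Real.exp (C * (t - s)) ≤ Real.exp (C * T) := by
      apply Real.exp_le_exp.2
      have := hs.1; have := ht.2
      nlinarith
    have h3 := norm_nonneg (h s)
    calc ‖h t‖ ≤ ‖h s‖ * Real.exp (C * (t - s)) + η / C * (Real.exp (C * (t - s)) - 1) := h1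
      _ ≤ (‖h s‖ + η / C) * Real.exp (C * (t - s)) := by linarith
      _ ≤ _ := by gcongr
  have key2 : ∀ t ∈ Set.Ioo 0 T, ‖h t‖ ≤ (‖h 0‖ + η / C) * Real.exp (C * T) := by
    intro t ht
    have hT : 0 < T := ht.1.trans ht.2
    have h0 : Tendsto h (𝓝[>] 0) (𝓝 (h 0)) :=
      ((hc 0 ⟨le_rfl, hT.le⟩).mono_left (nhdsWithin_le_of_mem (by
        filter_upwards [Ioo_mem_nhdsGT hT] with x hx using ⟨hx.1.le, hx.2.le⟩)))
    refine ge_of_tendsto ((h0.norm.add_const (η / C)).mul_const (Real.exp (C * T))) ?_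
    filter_upwards [Ioo_mem_nhdsGT ht.1] with s hs
    exact key s ⟨hs.1, hs.2.trans ht.2⟩ t ⟨hs.2.le, ht.2⟩
  intro t ht
  have hT : 0 ≤ T := ht.1.trans ht.2
  rcases hT.eq_or_lt with rfl | hT
  · have : t = 0 := le_antisymm ht.2 ht.1
    subst this
    simp only [mul_zero, Real.exp_zero, mul_one]; linarith
  have hcl : t ∈ closure (Set.Ioo 0 T) := by rw [closure_Ioo hT.ne]; exact ht
  have : (𝓝[Set.Ioo 0 T] t).NeBot := mem_closure_iff_nhdsWithin_neBot.1 hcl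
  exact le_of_tendsto ((hc t ht).mono Set.Ioo_subset_Icc_self).norm
    (eventually_nhdsWithin_of_forall key2)

variable {R : Type*} [NormedRing R] [NormedAlgebra ℝ R]

theorem norm_le_of_linear_ode {y N : ℝ → R} {C T : ℝ} (hC : 0 < C)
    (hc : ContinuousOn y (Set.Icc 0 T))
    (hd : ∀ t ∈ Set.Ioo 0 T, HasDerivAt y (N t * y t) t)
    (hN : ∀ t ∈ Set.Ioo 0 T, ‖N t‖ ≤ C) :
    ∀ t ∈ Set.Icc 0 T, ‖y t‖ ≤ ‖y 0‖ * Real.exp (C * T) := by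
  intro t ht
  have := norm_le_of_deriv_le (η := 0) hC le_rfl hc hd (fun t ht => by
    rw [add_zero]
    exact (norm_mul_le _ _).trans (mul_le_mul_of_nonneg_right (hN t ht) (norm_nonneg _))) t ht
  simpa using this

theorem eq_of_linear_ode {y₁ y₂ N : ℝ → R} {C T : ℝ}
    (hc₁ : ContinuousOn y₁ (Set.Icc 0 T)) (hc₂ : ContinuousOn y₂ (Set.Icc 0 T))
    (hd₁ : ∀ t ∈ Set.Ioo 0 T, HasDerivAt y₁ (N t * y₁ t) t)
    (hd₂ : ∀ t ∈ Set.Ioo 0 T, HasDerivAt y₂ (N t * y₂ t) t)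
    (hN : ∀ t ∈ Set.Ioo 0 T, ‖N t‖ ≤ C) (h0 : y₁ 0 = y₂ 0) :
    ∀ t ∈ Set.Icc 0 T, y₁ t = y₂ t := by
  intro t ht
  have := norm_le_of_linear_ode (y := fun t => y₁ t - y₂ t) (N := N) (C := max C 1)
    (lt_of_lt_of_le one_pos (le_max_right _ _)) (hc₁.sub hc₂)
    (fun t ht => by
      have := (hd₁ t ht).sub (hd₂ t ht)
      rw [← mul_sub] at this
      exact this)
    (fun t ht => (hN t ht).trans (le_max_left _ _)) t ht
  simp only [h0, sub_self, norm_zero, zero_mul] at this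
  exact sub_eq_zero.1 (norm_le_zero_iff.1 this)

variable {W : Type*} {l : Filter W} {y N : W → ℝ → R} {N₀ : ℝ → R} {C T : ℝ} {y₀ : R}

theorem eventually_norm_le_of_linear_ode
    (hc : ∀ᶠ w in l, ContinuousOn (y w) (Set.Icc 0 T))
    (hd : ∀ᶠ w in l, ∀ t ∈ Set.Ioo 0 T, HasDerivAt (y w) (N w t * y w t) t)
    (hN : TendstoUniformlyOn N N₀ l (Set.Ioo 0 T)) (hb : ∀ t ∈ Set.Ioo 0 T, ‖N₀ t‖ ≤ C)
    (h0 : Tendsto (fun w => y w 0) l (𝓝 y₀)) :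
    ∃ K, ∀ᶠ w in l, ∀ t ∈ Set.Icc 0 T, ‖y w t‖ ≤ K := by
  -- Eventually the coefficients are within `1` of `N₀` and the initial values within `1` of `y₀`.
  refine ⟨(‖y₀‖ + 1) * Real.exp ((|C| + 1) * T), ?_⟩
  filter_upwards [hc, hd, Metric.tendstoUniformlyOn_iff.1 hN 1 one_pos,
    h0.norm.eventually (ge_mem_nhds (lt_add_one _))] with w h1 h2 h3 h4 t ht
  refine (norm_le_of_linear_ode (C := |C| + 1) (by positivity) h1 h2 ?_ t ht).trans (by gcongr)
  intro s hs
  have h5 := h3 s hs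
  rw [dist_eq_norm] at h5
  have h6 : ‖N w s‖ ≤ ‖N₀ s‖ + ‖N₀ s - N w s‖ := by
    have := norm_sub_le (N₀ s) (N₀ s - N w s)
    rwa [sub_sub_cancel] at this
  have := hb s hs
  have := le_abs_self C
  linarith

/-- Two solutions with nearby coefficients and nearby initial values stay close, so the end values
form a Cauchy filter. No solution of the limiting equation has to be produced. -/
theorem exists_tendsto_of_linear_ode [CompleteSpace R]
    (hc : ∀ᶠ w in l, ContinuousOn (y w) (Set.Icc 0 T))
    (hd : ∀ᶠ w in l, ∀ t ∈ Set.Ioo 0 T, HasDerivAt (y w) (N w t * y w t) t)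
    (hN : TendstoUniformlyOn N N₀ l (Set.Ioo 0 T)) (hb : ∀ t ∈ Set.Ioo 0 T, ‖N₀ t‖ ≤ C)
    (h0 : Tendsto (fun w => y w 0) l (𝓝 y₀)) (hT : 0 ≤ T) :
    ∃ y₁, Tendsto (fun w => y w T) l (𝓝 y₁) := by
  rcases l.eq_or_neBot with rfl | hl
  · exact ⟨0, tendsto_bot⟩
  obtain ⟨K, hK⟩ := eventually_norm_le_of_linear_ode hc hd hN hb h0
  have hK' : ∀ᶠ w in l, ∀ t ∈ Set.Icc 0 T, ‖y w t‖ ≤ |K| := by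
    filter_upwards [hK] with w hw t ht using (hw t ht).trans (le_abs_self K)
  rw [← cauchy_map_iff_exists_tendsto, cauchy_map_iff]
  refine ⟨hl, Metric.uniformity_basis_dist.tendsto_right_iff.2 ?_⟩
  intro ε hε
  -- `D` bounds the coefficients, and `η` is chosen so that the Gronwall bound `(η + η|K|/D) e^{DT}
  -- = ηB` equals `ε/2`.
  set D := |C| + 1 with hD
  have hDpos : 0 < D := by positivity
  set B := (1 + |K| / D) * Real.exp (D * T) with hB
  have hBpos : 0 < B := by positivity
  set η := ε / (2 * B) with hη
  have hηpos : 0 < η := by positivity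
  have e0 : ∀ᶠ w in l, ‖y w 0 - y₀‖ < η / 2 := by
    have := (Metric.tendsto_nhds.1 h0) (η / 2) (by positivity)
    simpa [dist_eq_norm] using this
  have hall := ((hc.and hd).and (hK'.and e0)).and
    ((Metric.tendstoUniformlyOn_iff.1 hN 1 one_pos).and
      (Metric.tendstoUniformlyOn_iff.1 hN (η / 2) (by positivity)))
  filter_upwards [hall.prod_mk hall] with p hp
  obtain ⟨⟨⟨⟨c1, d1⟩, ⟨k1, i1⟩⟩, ⟨o1, n1⟩⟩, ⟨⟨⟨c2, d2⟩, ⟨k2, i2⟩⟩, ⟨o2, n2⟩⟩⟩ := hp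
  have hmain := norm_le_of_deriv_le (h := fun t => y p.1 t - y p.2 t)
    (h' := fun t => N p.1 t * y p.1 t - N p.2 t * y p.2 t) (C := D) (η := η * |K|) (T := T)
    hDpos (by positivity) (c1.sub c2) (fun t ht => (d1 t ht).sub (d2 t ht)) (fun t ht => by
      have e : N p.1 t * y p.1 t - N p.2 t * y p.2 t =
          N p.1 t * (y p.1 t - y p.2 t) + (N p.1 t - N p.2 t) * y p.2 t := by noncomm_ring
      have q1 : ‖N p.1 t‖ ≤ D := by
        have h5 := o1 t ht
        rw [dist_eq_norm] at h5
        have h6 : ‖N p.1 t‖ ≤ ‖N₀ t‖ + ‖N₀ t - N p.1 t‖ := by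
          have := norm_sub_le (N₀ t) (N₀ t - N p.1 t)
          rwa [sub_sub_cancel] at this
        have := hb t ht
        have := le_abs_self C
        linarith
      have q2 : ‖N p.1 t - N p.2 t‖ ≤ η := by
        have h5 := n1 t ht
        have h6 := n2 t ht
        rw [← dist_eq_norm]
        have := dist_triangle_left (N p.1 t) (N p.2 t) (N₀ t)
        linarith
      have q3 := k2 t ⟨ht.1.le, ht.2.le⟩
      rw [e]
      refine (norm_add_le _ _).trans (add_le_add ?_ ?_)
      · exact (norm_mul_le _ _).trans (by gcongr)
      · exact (norm_mul_le _ _).trans (by gcongr)) T ⟨hT, le_rfl⟩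
  have hi : ‖y p.1 0 - y p.2 0‖ ≤ η := by
    have := norm_sub_le (y p.1 0 - y₀) (y p.2 0 - y₀)
    rw [sub_sub_sub_cancel_right] at this
    linarith
  rw [dist_eq_norm]
  calc ‖y p.1 T - y p.2 T‖ ≤ (‖y p.1 0 - y p.2 0‖ + η * |K| / D) * Real.exp (D * T) := hmain
    _ ≤ (η + η * |K| / D) * Real.exp (D * T) := by gcongr
    _ = η * B := by rw [hB]; ring
    _ = ε / 2 := by rw [hη]; field_simp
    _ < ε := by linarith

/-- The same with the roles of the two end points exchanged. -/
theorem exists_tendsto_of_linear_ode_reverse [CompleteSpace R]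
    (hc : ∀ᶠ w in l, ContinuousOn (y w) (Set.Icc 0 T))
    (hd : ∀ᶠ w in l, ∀ t ∈ Set.Ioo 0 T, HasDerivAt (y w) (N w t * y w t) t)
    (hN : TendstoUniformlyOn N N₀ l (Set.Ioo 0 T)) (hb : ∀ t ∈ Set.Ioo 0 T, ‖N₀ t‖ ≤ C)
    (h0 : Tendsto (fun w => y w T) l (𝓝 y₀)) (hT : 0 ≤ T) :
    ∃ y₁, Tendsto (fun w => y w 0) l (𝓝 y₁) := by
  have hmap : ∀ t ∈ Set.Ioo 0 T, T - t ∈ Set.Ioo 0 T := fun t ht =>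
    ⟨by linarith [ht.2], by linarith [ht.1]⟩
  have := exists_tendsto_of_linear_ode (l := l) (y := fun w t => y w (T - t))
    (N := fun w t => -N w (T - t)) (N₀ := fun t => -N₀ (T - t)) (C := C) (T := T) (y₀ := y₀)
    (by
      filter_upwards [hc] with w hw
      refine hw.comp (by fun_prop) fun t ht => ⟨by linarith [ht.2], by linarith [ht.1]⟩)
    (by
      filter_upwards [hd] with w hw t ht
      have h1 := hw _ (hmap t ht)
      have h2 : HasDerivAt (fun t : ℝ => T - t) (-1) t := by
        simpa using (hasDerivAt_id t).const_sub T
      have h3 := HasDerivAt.scomp t h1 h2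
      simpa [Function.comp_def] using h3)
    (by
      rw [Metric.tendstoUniformlyOn_iff] at hN ⊢
      intro ε hε
      filter_upwards [hN ε hε] with w hw t ht
      rw [dist_neg_neg]
      exact hw _ (hmap t ht))
    (fun t ht => by rw [norm_neg]; exact hb _ (hmap t ht))
    (by simpa using h0) hT
  simpa using this

end LinearODE

/-! ### Boundary values from the upper side -/

/-- The continuous extension of `g` from the open upper quadrant. -/
def upperExt (g : ℝ × ℝ → ℂ) : ℝ × ℝ → ℂ := extendFrom upperQuadrant g

theorem upperQuadrant_eq_prod : upperQuadrant = Set.Ioi (0 : ℝ) ×ˢ Set.Ioi (0 : ℝ) := rfl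

theorem upperBoundaryRegion_subset_closure (ρ₀ : ℝ) :
    upperBoundaryRegion ρ₀ ⊆ closure upperQuadrant := by
  rw [upperQuadrant_eq_prod, closure_prod_eq, closure_Ioi]
  exact fun p hp => ⟨hp.1, hp.2.1⟩

theorem upperQuadrant_subset_upperBoundaryRegion (ρ₀ : ℝ) :
    upperQuadrant ⊆ upperBoundaryRegion ρ₀ := fun p hp =>
  ⟨hp.1.le, hp.2.le, fun h => hp.2.ne' (by rw [h])⟩

theorem upperQuadrant_subset_exterior (ρ₀ : ℝ) : upperQuadrant ⊆ exterior ρ₀ :=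
  fun _ hp => ⟨hp.1, Or.inl hp.2.ne'⟩

theorem isOpen_exterior (ρ₀ : ℝ) : IsOpen (exterior ρ₀) := by
  have : exterior ρ₀ = {p : ℝ × ℝ | 0 < p.1} ∩ ({p | p.2 ≠ 0} ∪ {p | ρ₀ < p.1}) := rfl
  rw [this]
  refine (isOpen_lt continuous_const continuous_fst).inter (IsOpen.union ?_ ?_)
  · exact isOpen_ne_fun continuous_snd continuous_const
  · exact isOpen_lt continuous_const continuous_fst

theorem neBot_upperQuadrant {ρ₀ : ℝ} {p : ℝ × ℝ} (hp : p ∈ upperBoundaryRegion ρ₀) :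
    (𝓝[upperQuadrant] p).NeBot :=
  mem_closure_iff_nhdsWithin_neBot.1 (upperBoundaryRegion_subset_closure ρ₀ hp)

section

variable {ρ₀ : ℝ} {g : ℝ × ℝ → ℂ}

theorem ExtendsToBoundary.continuousOn (h : ExtendsToBoundary ρ₀ g) :
    ContinuousOn (upperExt g) (upperBoundaryRegion ρ₀) :=
  continuousOn_extendFrom (upperBoundaryRegion_subset_closure ρ₀) h.1

theorem ExtendsToBoundary.tendsto (h : ExtendsToBoundary ρ₀ g) {p : ℝ × ℝ}
    (hp : p ∈ upperBoundaryRegion ρ₀) :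
    Tendsto g (𝓝[upperQuadrant] p) (𝓝 (upperExt g p)) :=
  tendsto_extendFrom (h.1 p hp)

theorem ExtendsToBoundary.eq (h : ExtendsToBoundary ρ₀ g) {p : ℝ × ℝ}
    (hp : p ∈ upperQuadrant) : upperExt g p = g p := by
  have h1 := h.tendsto (upperQuadrant_subset_upperBoundaryRegion ρ₀ hp)
  -- The punctual filter at `p` lies below `𝓝[upperQuadrant] p`, so the limit must be the value `g
  -- p`.
  have h2 : Tendsto g (pure p) (𝓝 (upperExt g p)) := h1.mono_left (pure_le_nhdsWithin hp)
  exact tendsto_nhds_unique h2 (tendsto_pure_nhds g p)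

end

/-- A compact rectangle touching the axis and the upper face of the disk. -/
def box (R : ℝ) : Set (ℝ × ℝ) := Set.Icc 0 R ×ˢ Set.Icc 0 1

theorem isCompact_box (R : ℝ) : IsCompact (box R) := isCompact_Icc.prod isCompact_Icc

theorem box_subset {ρ₀ R : ℝ} (hR : R < ρ₀) : box R ⊆ upperBoundaryRegion ρ₀ := fun p hp =>
  ⟨hp.1.1, hp.2.1, fun h => by have := hp.1.2; rw [h] at this; simp at this; linarith⟩

theorem mem_upperBoundaryRegion_axis {ρ₀ : ℝ} (hρ₀ : 0 < ρ₀) {ζ : ℝ} (h : 0 ≤ ζ) :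
    ((0 : ℝ), ζ) ∈ upperBoundaryRegion ρ₀ :=
  ⟨le_rfl, h, fun e => hρ₀.ne (by simpa using congrArg Prod.fst e)⟩

namespace IsErnstPotential

variable {ρ₀ : ℝ} {f : ℝ × ℝ → ℂ}

theorem ext_re_pos (hf : IsErnstPotential ρ₀ f) {p : ℝ × ℝ} (hp : p ∈ upperBoundaryRegion ρ₀) :
    0 < (upperExt f p).re :=
  hf.re_pos_upper p hp _ (hf.extends_self.tendsto hp)

theorem hasFDerivAt (hf : IsErnstPotential ρ₀ f) {p : ℝ × ℝ} (hp : p ∈ exterior ρ₀) :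
    HasFDerivAt f (fderiv ℝ f p) p :=
  ((hf.contDiffOn.differentiableOn (by norm_num)).differentiableAt
    ((isOpen_exterior ρ₀).mem_nhds hp)).hasFDerivAt

end IsErnstPotential

/-! ### Partial derivatives and the boundary behaviour of the metric function -/

section Partial

variable {E : Type*} [NormedAddCommGroup E] [NormedSpace ℝ E] {g : ℝ × ℝ → E} {p : ℝ × ℝ}

theorem hasDerivAt_fst (h : DifferentiableAt ℝ g p) :
    HasDerivAt (fun r : ℝ => g (r, p.2)) (dRho g p) p.1 := by
  have : DifferentiableAt ℝ (fun r : ℝ => g (r, p.2)) p.1 :=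
    DifferentiableAt.comp (g := g) (f := fun r : ℝ => (r, p.2)) p.1 h (by fun_prop)
  exact this.hasDerivAt

theorem hasDerivAt_snd (h : DifferentiableAt ℝ g p) :
    HasDerivAt (fun t : ℝ => g (p.1, t)) (dZeta g p) p.2 := by
  have : DifferentiableAt ℝ (fun t : ℝ => g (p.1, t)) p.2 :=
    DifferentiableAt.comp (g := g) (f := fun t : ℝ => (p.1, t)) p.2 h (by fun_prop)
  exact this.hasDerivAt

end Partial

theorem _root_.HasDerivAt.complex_re {g : ℝ → ℂ} {g' : ℂ} {t : ℝ} (h : HasDerivAt g g' t) :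
    HasDerivAt (fun s => (g s).re) g'.re t :=
  (Complex.reCLM.hasFDerivAt.comp_hasDerivAt t h)

theorem _root_.HasDerivAt.complex_im {g : ℝ → ℂ} {g' : ℂ} {t : ℝ} (h : HasDerivAt g g' t) :
    HasDerivAt (fun s => (g s).im) g'.im t :=
  (Complex.imCLM.hasFDerivAt.comp_hasDerivAt t h)

section Partial

variable {g : ℝ × ℝ → ℂ} {p : ℝ × ℝ}

theorem dRho_im (h : DifferentiableAt ℝ g p) :
    dRho (fun q => (g q).im) p = (dRho g p).im := (hasDerivAt_fst h).complex_im.deriv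

theorem dZeta_im (h : DifferentiableAt ℝ g p) :
    dZeta (fun q => (g q).im) p = (dZeta g p).im := (hasDerivAt_snd h).complex_im.deriv

end Partial

namespace IsErnstPotential

variable {ρ₀ : ℝ} {f : ℝ × ℝ → ℂ}

theorem differentiableAt (hf : IsErnstPotential ρ₀ f) {p : ℝ × ℝ} (hp : p ∈ exterior ρ₀) :
    DifferentiableAt ℝ f p := (hf.hasFDerivAt hp).differentiableAt

end IsErnstPotential

namespace IsMetricFunction

variable {ρ₀ : ℝ} {f : ℝ × ℝ → ℂ} {a : ℝ × ℝ → ℝ}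

theorem hasDerivAt_rho (ha : IsMetricFunction ρ₀ f a) (hf : IsErnstPotential ρ₀ f)
    {p : ℝ × ℝ} (hp : p ∈ exterior ρ₀) :
    HasDerivAt (fun r : ℝ => a (r, p.2)) (p.1 / (f p).re ^ 2 * (dZeta f p).im) p.1 := by
  have h := hasDerivAt_fst (ha.differentiableOn.differentiableAt
    ((isOpen_exterior ρ₀).mem_nhds hp))
  rwa [ha.dRho_eq p hp, dZeta_im (hf.differentiableAt hp)] at h

theorem hasDerivAt_zeta (ha : IsMetricFunction ρ₀ f a) (hf : IsErnstPotential ρ₀ f)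
    {p : ℝ × ℝ} (hp : p ∈ exterior ρ₀) :
    HasDerivAt (fun t : ℝ => a (p.1, t)) (-(p.1 / (f p).re ^ 2 * (dRho f p).im)) p.2 := by
  have h := hasDerivAt_snd (ha.differentiableOn.differentiableAt
    ((isOpen_exterior ρ₀).mem_nhds hp))
  rwa [ha.dZeta_eq p hp, dRho_im (hf.differentiableAt hp)] at h

/-- Near the upper face of the disk, the metric function extends to a continuous function, which
vanishes at the axis. -/
theorem exists_continuous_ext (ha : IsMetricFunction ρ₀ f a) (hf : IsErnstPotential ρ₀ f)
    {R : ℝ} (hR₀ : 0 < R) (hR : R < ρ₀) :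
    ∃ α : ℝ × ℝ → ℝ, Continuous α ∧ (∀ p ∈ Set.Ioo 0 R ×ˢ Set.Ioo (0 : ℝ) 1, α p = a p) ∧
      ∀ ζ ∈ Set.Icc (0 : ℝ) 1, α (0, ζ) = 0 := by
  have hbox := box_subset (R := R) hR
  have hcont : ∀ g, ExtendsToBoundary ρ₀ g → ContinuousOn (fun p : ℝ × ℝ =>
      p.1 / (upperExt f p).re ^ 2 * (upperExt g p).im) (box R) := by
    intro g hg
    refine ContinuousOn.mul (ContinuousOn.div continuousOn_fst ?_ ?_) ?_
    · exact (Complex.continuous_re.comp_continuousOn (hf.extends_self.continuousOn.mono hbox)).pow 2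
    · exact fun p hp => (pow_pos (hf.ext_re_pos (hbox hp)) 2).ne'
    · exact Complex.continuous_im.comp_continuousOn (hg.continuousOn.mono hbox)
  obtain ⟨C₁, hC₁⟩ := (isCompact_box R).exists_bound_of_continuousOn (hcont _ hf.extends_dZeta)
  obtain ⟨C₂, hC₂⟩ := (isCompact_box R).exists_bound_of_continuousOn (hcont _ hf.extends_dRho)
  set S : Set (ℝ × ℝ) := Set.Ioo 0 R ×ˢ Set.Ioo (0 : ℝ) 1 with hS
  have hSq : S ⊆ upperQuadrant := fun p hp => ⟨hp.1.1, hp.2.1⟩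
  have hSb : S ⊆ box R := fun p hp => ⟨⟨hp.1.1.le, hp.1.2.le⟩, ⟨hp.2.1.le, hp.2.2.le⟩⟩
  have b₁ : ∀ p ∈ S, ‖p.1 / (f p).re ^ 2 * (dZeta f p).im‖ ≤ |C₁| := fun p hp => by
    have := hC₁ p (hSb hp)
    rw [hf.extends_self.eq (hSq hp), hf.extends_dZeta.eq (hSq hp)] at this
    exact this.trans (le_abs_self _)
  have b₂ : ∀ p ∈ S, ‖-(p.1 / (f p).re ^ 2 * (dRho f p).im)‖ ≤ |C₂| := fun p hp => by
    have := hC₂ p (hSb hp)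
    rw [hf.extends_self.eq (hSq hp), hf.extends_dRho.eq (hSq hp)] at this
    rw [norm_neg]
    exact this.trans (le_abs_self _)
  -- The gradient of `a` is given by `f` and its first derivatives, which are bounded on the compact
  -- box. Hence `a` is Lipschitz on the open rectangle, and a Lipschitz function extends.
  have hlip : LipschitzOnWith (Real.toNNReal (|C₁| + |C₂|)) a S := by
    apply LipschitzOnWith.of_dist_le_mul
    intro p hp q hq
    rw [Real.coe_toNNReal _ (by positivity)]
    have e1 : ‖a (p.1, p.2) - a (q.1, p.2)‖ ≤ |C₁| * ‖p.1 - q.1‖ :=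
      Convex.norm_image_sub_le_of_norm_hasDerivWithin_le (s := Set.Ioo 0 R)
        (f := fun r => a (r, p.2))
        (fun x hx => (ha.hasDerivAt_rho hf (p := (x, p.2))
          (upperQuadrant_subset_exterior ρ₀ ⟨hx.1, hp.2.1⟩)).hasDerivWithinAt)
        (fun x hx => b₁ (x, p.2) ⟨hx, hp.2⟩) (convex_Ioo _ _) hq.1 hp.1
    have e2 : ‖a (q.1, p.2) - a (q.1, q.2)‖ ≤ |C₂| * ‖p.2 - q.2‖ :=
      Convex.norm_image_sub_le_of_norm_hasDerivWithin_le (s := Set.Ioo 0 1)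
        (f := fun t => a (q.1, t))
        (fun x hx => (ha.hasDerivAt_zeta hf (p := (q.1, x))
          (upperQuadrant_subset_exterior ρ₀ ⟨hq.1.1, hx.1⟩)).hasDerivWithinAt)
        (fun x hx => b₂ (q.1, x) ⟨hq.1, hx⟩) (convex_Ioo _ _) hq.2 hp.2
    have d1 : ‖p.1 - q.1‖ ≤ dist p q := by rw [← dist_eq_norm]; exact le_max_left _ _
    have d2 : ‖p.2 - q.2‖ ≤ dist p q := by rw [← dist_eq_norm]; exact le_max_right _ _
    calc dist (a p) (a q) ≤ ‖a (p.1, p.2) - a (q.1, p.2)‖ + ‖a (q.1, p.2) - a (q.1, q.2)‖ := by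
          rw [← dist_eq_norm, ← dist_eq_norm]; exact dist_triangle _ _ _
      _ ≤ |C₁| * dist p q + |C₂| * dist p q := by
          gcongr
          · exact e1.trans (by gcongr)
          · exact e2.trans (by gcongr)
      _ = _ := by ring
  obtain ⟨α, hα, hαa⟩ := hlip.extend_real
  have hz : ∀ ζ ∈ Set.Ioo (0 : ℝ) 1, α (0, ζ) = 0 := by
    intro ζ hζ
    have t1 : Tendsto (fun ρ : ℝ => α (ρ, ζ)) (𝓝[>] 0) (𝓝 (α (0, ζ))) :=
      ((hα.continuous.comp (by fun_prop : Continuous fun ρ : ℝ => (ρ, ζ))).tendsto 0).mono_left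
        nhdsWithin_le_nhds
    refine tendsto_nhds_unique (t1.congr' ?_) (ha.axis ζ hζ.1.ne')
    filter_upwards [Ioo_mem_nhdsGT hR₀] with ρ hρ
    exact (hαa (x := (ρ, ζ)) ⟨hρ, hζ⟩).symm
  refine ⟨α, hα.continuous, fun p hp => (hαa hp).symm, fun ζ hζ => ?_⟩
  -- The axis condition on `a` says nothing at `ζ = 0`; the corner is reached because the zero set
  -- of the extension is closed.
  have hcl : Set.Icc (0 : ℝ) 1 ⊆ closure (Set.Ioo 0 1) := by rw [closure_Ioo zero_ne_one]
  have hclosed : IsClosed {ζ : ℝ | α (0, ζ) = 0} :=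
    isClosed_eq (hα.continuous.comp (by fun_prop)) continuous_const
  exact closure_minimal hz hclosed (hcl hζ)

theorem tendsto_zero (ha : IsMetricFunction ρ₀ f a) (hf : IsErnstPotential ρ₀ f) (hρ₀ : 0 < ρ₀) :
    Tendsto a (𝓝[upperQuadrant] (0, 0)) (𝓝 0) := by
  obtain ⟨α, h1, h2, h3⟩ := ha.exists_continuous_ext hf (R := ρ₀ / 2) (by linarith) (by linarith)
  have t : Tendsto α (𝓝[upperQuadrant] (0, 0)) (𝓝 0) := by
    have := h1.tendsto (0, 0)
    rw [h3 0 (by simp)] at this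
    exact this.mono_left nhdsWithin_le_nhds
  refine t.congr' ?_
  have : Set.Iio (ρ₀ / 2) ×ˢ Set.Iio (1 : ℝ) ∈ 𝓝 ((0 : ℝ), (0 : ℝ)) :=
    prod_mem_nhds (Iio_mem_nhds (by linarith)) (Iio_mem_nhds one_pos)
  filter_upwards [self_mem_nhdsWithin, mem_nhdsWithin_of_mem_nhds this] with p hp hq
  exact h2 p ⟨⟨hp.1, hq.1⟩, ⟨hp.2, hq.2⟩⟩

end IsMetricFunction

-- A submultiplicative norm, as the estimates for linear equations require; its topology is the
-- entrywise one.
attribute [local instance] Matrix.linftyOpNormedRing Matrix.linftyOpNormedAlgebra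

/-! ### The Lax pair on the horizontal segment from the axis to the branch point -/

/-- The coefficient of the equation for `Φ` in the variable `θ`, `ρ = |κ| sin θ`, on the segment
at height `ζ = Re k`, where `κ = Im k`. -/
def segmentCoeff (f fr fz : ℂ) (κ θ : ℝ) : Matrix (Fin 2) (Fin 2) ℂ :=
  (1 / (f + starRingEnd ℂ f)) •
    !![(|κ| : ℝ) * Real.cos θ * starRingEnd ℂ fr,
        (|κ| : ℝ) * starRingEnd ℂ fr + Complex.I * κ * Real.sin θ * starRingEnd ℂ fz;
      (|κ| : ℝ) * fr + Complex.I * κ * Real.sin θ * fz, (|κ| : ℝ) * Real.cos θ * fr]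

/-- The point with parameter `θ` on the segment at height `Re k` from the axis to the branch
point of `k`. -/
def segmentPoint (k : ℂ) (θ : ℝ) : ℝ × ℝ := (|k.im| * Real.sin θ, k.re)

/-- The coefficient along the segment belonging to `k`, `Re k ≥ 0`. -/
def segmentLax (f : ℝ × ℝ → ℂ) (k : ℂ) (θ : ℝ) : Matrix (Fin 2) (Fin 2) ℂ :=
  segmentCoeff (upperExt f (segmentPoint k θ)) (upperExt (dRho f) (segmentPoint k θ))
    (upperExt (dZeta f) (segmentPoint k θ)) k.im θ

/-- `diag(1, ±1)`. -/
def Sheet.signMatrix (s : Sheet) : Matrix (Fin 2) (Fin 2) ℂ := !![1, 0; 0, s.sign]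

theorem Sheet.sign_mul_self (s : Sheet) : s.sign * s.sign = 1 := by
  cases s <;> simp [Sheet.sign]

theorem lam_eq_sign_mul (s : Sheet) (k : ℂ) (p : ℝ × ℝ) : lam s k p = s.sign * lam .upper k p := by
  simp [lam, Sheet.sign]

theorem ofReal_sq_cpow_half {μ : ℝ} (hμ : 0 < μ) : (((μ ^ 2 : ℝ) : ℂ)) ^ (1 / 2 : ℂ) = μ := by
  have : (1 / 2 : ℂ) = ((1 / 2 : ℝ) : ℂ) := by push_cast; rfl
  rw [this, ← Complex.ofReal_cpow (by positivity), ← Real.sqrt_eq_rpow, Real.sqrt_sq hμ.le]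

/-- At height `Re k` one has `λ² = (κ - ρ)/(κ + ρ)` with `κ = Im k`, which is positive for `ρ <
|κ|`. With `ρ = |κ| sin θ` the root is `cos θ / (1 + sin θ)` for `κ > 0` and its inverse for `κ <
0`. The last two identities are what makes `dρ/dθ = |κ| cos θ` cancel the singularity of `λ⁻¹ ± λ`.
-/
theorem lam_segment {k : ℂ} (hk : k.im ≠ 0) {θ : ℝ} (hθ : θ ∈ Set.Ioo 0 (Real.pi / 2)) :
    ∃ μ : ℝ, 0 < μ ∧ lam .upper k (segmentPoint k θ) = μ ∧
      (1 / μ + μ) * Real.cos θ = 2 ∧ |k.im| * ((1 / μ - μ) * Real.cos θ) = 2 * k.im * Real.sin θ := by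
  have hs : 0 < Real.sin θ := Real.sin_pos_of_pos_of_lt_pi hθ.1 (by linarith [hθ.2, Real.pi_pos])
  have hc : 0 < Real.cos θ := Real.cos_pos_of_mem_Ioo ⟨by linarith [hθ.1, Real.pi_pos], hθ.2⟩
  have hsc := Real.sin_sq_add_cos_sq θ
  have hs1 : Real.sin θ < 1 := by nlinarith
  have main : ∀ μ : ℝ, 0 < μ →
      (k.im + |k.im| * Real.sin θ) * μ ^ 2 = k.im - |k.im| * Real.sin θ →
      lam .upper k (segmentPoint k θ) = μ := by
    intro μ hμ h
    rw [lam, ← ofReal_sq_cpow_half hμ]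
    simp only [Sheet.sign, one_mul]
    congr 1
    have hne : k.im + |k.im| * Real.sin θ ≠ 0 := by
      rcases hk.lt_or_gt with h' | h'
      · rw [abs_of_neg h']; nlinarith
      · rw [abs_of_pos h']; nlinarith
    have h1 : k + Complex.I * (((segmentPoint k θ).1 : ℂ) + Complex.I * ((segmentPoint k θ).2 : ℂ)) =
        Complex.I * ((k.im + |k.im| * Real.sin θ : ℝ) : ℂ) := by
      apply Complex.ext <;> simp [segmentPoint]
    have h2 : k - Complex.I * (((segmentPoint k θ).1 : ℂ) - Complex.I * ((segmentPoint k θ).2 : ℂ)) =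
        Complex.I * ((k.im - |k.im| * Real.sin θ : ℝ) : ℂ) := by
      apply Complex.ext <;> simp [segmentPoint]
    rw [h1, h2, ← h, mul_div_mul_left _ _ Complex.I_ne_zero, ← Complex.ofReal_div,
      mul_div_cancel_left₀ _ hne]
  have e1 : 1 + Real.sin θ ≠ 0 := by positivity
  rcases hk.lt_or_gt with h' | h'
  · refine ⟨(1 + Real.sin θ) / Real.cos θ, by positivity, main _ (by positivity) ?_, ?_, ?_⟩
    · rw [abs_of_neg h']; field_simp
      linear_combination (-(1 + Real.sin θ)) * hsc
    · field_simp
      linear_combination hsc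
    · rw [abs_of_neg h']; field_simp
      linear_combination (-1 : ℝ) * hsc
  · refine ⟨Real.cos θ / (1 + Real.sin θ), by positivity, main _ (by positivity) ?_, ?_, ?_⟩
    · rw [abs_of_pos h']; field_simp
      linear_combination hsc
    · field_simp
      linear_combination hsc
    · rw [abs_of_pos h']; field_simp
      linear_combination (-1 : ℝ) * hsc

/-- The off-diagonal entries of the Lax matrix are odd in `λ` and the diagonal ones free of it, so
conjugation by `diag(1, ±1)` brings both sheets to the same equation, with coefficients regular at
the branch point. -/
theorem signMatrix_mul_laxRho {f : ℝ × ℝ → ℂ} {k : ℂ} (hk : k.im ≠ 0) {θ : ℝ}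
    (hθ : θ ∈ Set.Ioo 0 (Real.pi / 2)) (s : Sheet) :
    s.signMatrix * (((|k.im| * Real.cos θ : ℝ) : ℂ) • laxRho f s k (segmentPoint k θ)) =
      segmentCoeff (f (segmentPoint k θ)) (dRho f (segmentPoint k θ))
        (dZeta f (segmentPoint k θ)) k.im θ * s.signMatrix := by
  obtain ⟨μ, hμ, hl, h1, h2⟩ := lam_segment hk hθ
  have hs2 := s.sign_mul_self
  have hsi : 1 / (s.sign * (μ : ℂ)) = s.sign * (1 / (μ : ℂ)) := by
    cases s <;> simp [Sheet.sign]
  have h1' : (1 / (μ : ℂ) + μ) * Real.cos θ = 2 := by exact_mod_cast h1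
  have h2' : ((|k.im| : ℝ) : ℂ) * ((1 / (μ : ℂ) - μ) * Real.cos θ) = 2 * k.im * Real.sin θ := by
    exact_mod_cast h2
  set p := segmentPoint k θ
  ext i j
  fin_cases i <;> fin_cases j
  · simp [laxRho, segmentCoeff, Sheet.signMatrix, Matrix.mul_apply, Fin.sum_univ_two]
    ring
  · simp only [laxRho, segmentCoeff, Sheet.signMatrix, Matrix.mul_apply, Fin.sum_univ_two,
      lam_eq_sign_mul s, hl, hsi]
    simp
    simp only [one_div] at h1' h2'
    push_cast at h1' h2'
    linear_combination (s.sign * (f p + starRingEnd ℂ (f p))⁻¹ * (1 / 2)) *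
      ((|k.im| : ℝ) * starRingEnd ℂ (dRho f p) * h1' +
        Complex.I * starRingEnd ℂ (dZeta f p) * h2')
  · simp only [laxRho, segmentCoeff, Sheet.signMatrix, Matrix.mul_apply, Fin.sum_univ_two,
      lam_eq_sign_mul s, hl, hsi]
    simp
    simp only [one_div] at h1' h2'
    push_cast at h1' h2'
    linear_combination (s.sign * s.sign * (f p + starRingEnd ℂ (f p))⁻¹ * (1 / 2)) *
      ((|k.im| : ℝ) * (dRho f p) * h1' +
        Complex.I * (dZeta f p) * h2') + (f p + starRingEnd ℂ (f p))⁻¹ *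
        ((|k.im| : ℝ) * (dRho f p) + Complex.I * k.im * Complex.sin θ * dZeta f p) * hs2
  · simp [laxRho, segmentCoeff, Sheet.signMatrix, Matrix.mul_apply, Fin.sum_univ_two]
    ring

theorem segmentPoint_mem {k : ℂ} (hre : 0 < k.re) (hk : k.im ≠ 0) {θ : ℝ}
    (hθ : θ ∈ Set.Ioo 0 (Real.pi / 2)) :
    segmentPoint k θ ∈ upperQuadrant ∧ segmentPoint k θ ∉ cut k := by
  have hs : 0 < Real.sin θ := Real.sin_pos_of_pos_of_lt_pi hθ.1 (by linarith [hθ.2, Real.pi_pos])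
  have hc : 0 < Real.cos θ := Real.cos_pos_of_mem_Ioo ⟨by linarith [hθ.1, Real.pi_pos], hθ.2⟩
  have hsc := Real.sin_sq_add_cos_sq θ
  have hs1 : Real.sin θ < 1 := by nlinarith
  have ha := abs_pos.2 hk
  refine ⟨⟨mul_pos ha hs, hre⟩, fun h => ?_⟩
  have h2 : |k.im| ≤ |k.im| * Real.sin θ := h.2
  nlinarith

theorem notMem_Gam {ρ₀ : ℝ} {k : ℂ} (hre : 0 < k.re) : k ∉ Gam ρ₀ := fun h => hre.ne' h.1

namespace IsEigenfunction

variable {ρ₀ : ℝ} {f : ℝ × ℝ → ℂ} {Φ : Sheet → ℂ → ℝ × ℝ → Matrix (Fin 2) (Fin 2) ℂ}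

theorem hasDerivAt_segment (hΦ : IsEigenfunction ρ₀ f Φ) (hf : IsErnstPotential ρ₀ f)
    (s : Sheet) {k : ℂ} (hre : 0 < k.re) (hk : k.im ≠ 0) {θ : ℝ}
    (hθ : θ ∈ Set.Ioo 0 (Real.pi / 2)) :
    HasDerivAt (fun t => s.signMatrix * Φ s k (segmentPoint k t))
      (segmentLax f k θ * (s.signMatrix * Φ s k (segmentPoint k θ))) θ := by
  obtain ⟨hq, hcut⟩ := segmentPoint_mem hre hk hθ
  have hd : HasDerivAt (fun t => Φ s k (segmentPoint k t))
      ((((|k.im| * Real.cos θ : ℝ) : ℂ) • laxRho f s k (segmentPoint k θ)) *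
        Φ s k (segmentPoint k θ)) θ := by
    refine hasDerivAt_pi.2 fun i => hasDerivAt_pi.2 fun j => ?_
    have h1 := hΦ.lax_rho s k (notMem_Gam hre) (segmentPoint k θ)
      ⟨upperQuadrant_subset_exterior ρ₀ hq, hcut⟩ i j
    have h2 : HasDerivAt (fun t => |k.im| * Real.sin t) (|k.im| * Real.cos θ) θ :=
      (Real.hasDerivAt_sin θ).const_mul _
    have h3 := HasDerivAt.scomp θ h1 h2
    rw [Matrix.smul_mul, Matrix.smul_apply, smul_eq_mul, ← Complex.real_smul]
    exact h3
  have h4 := hd.const_mul s.signMatrix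
  rw [← mul_assoc, signMatrix_mul_laxRho hk hθ s, mul_assoc] at h4
  rw [segmentLax, hf.extends_self.eq hq, hf.extends_dRho.eq hq, hf.extends_dZeta.eq hq]
  exact h4

/-- On either sheet, `Φ` solves a linear equation along the segment from the axis to the branch
point, with the same value at the branch point on both sheets. -/
theorem exists_segment_solution_sheet (hΦ : IsEigenfunction ρ₀ f Φ)
    (hf : IsErnstPotential ρ₀ f) {k : ℂ} (hre : 0 < k.re) :
    ∃ L, ∀ s, ∃ P₀, ∃ Y : ℝ → Matrix (Fin 2) (Fin 2) ℂ,
      Tendsto (fun ζ : ℝ => Φ s k (0, ζ)) (𝓝[>] k.re) (𝓝 P₀) ∧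
        ContinuousOn Y (Set.Icc 0 (Real.pi / 2)) ∧
        (∀ θ ∈ Set.Ioo 0 (Real.pi / 2), HasDerivAt Y (segmentLax f k θ * Y θ) θ) ∧
        Y 0 = s.signMatrix * P₀ ∧ Y (Real.pi / 2) = s.signMatrix * L := by
  have hG := notMem_Gam (ρ₀ := ρ₀) hre
  have hpi : 0 < Real.pi / 2 := by positivity
  obtain ⟨L, hL⟩ := hΦ.branch k hG
  refine ⟨L, fun s => ?_⟩
  -- For real `k` the branch point lies on the axis: the segment is a single point, its coefficient
  -- vanishes, and the axis value is the branch value.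
  rcases eq_or_ne k.im 0 with hk | hk
  · have hP : Tendsto (fun ζ : ℝ => Φ s k (0, ζ)) (𝓝[>] k.re) (𝓝 L) := by
      refine (hL s).comp ?_
      refine tendsto_nhdsWithin_iff.2 ⟨?_, ?_⟩
      · rw [hk, abs_zero]
        exact ((by fun_prop : Continuous fun ζ : ℝ => ((0 : ℝ), ζ)).tendsto k.re).mono_left
          nhdsWithin_le_nhds
      · filter_upwards [self_mem_nhdsWithin] with ζ hζ
        have hζ' : k.re < ζ := hζ
        exact ⟨⟨le_rfl, Or.inl (hre.trans hζ').ne'⟩, fun h => hζ'.ne' h.1⟩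
    refine ⟨L, fun _ => s.signMatrix * L, hP, continuousOn_const, fun θ _ => ?_, rfl, rfl⟩
    have : segmentLax f k θ = 0 := by
      ext i j
      fin_cases i <;> fin_cases j <;> simp [segmentLax, segmentCoeff, hk]
    rw [this, zero_mul]
    exact hasDerivAt_const _ _
  · set g : ℝ → Matrix (Fin 2) (Fin 2) ℂ := fun t => s.signMatrix * Φ s k (segmentPoint k t)
    have hder := fun θ hθ => hΦ.hasDerivAt_segment hf s hre hk (θ := θ) hθ
    have hgc : ContinuousOn g (Set.Ioo 0 (Real.pi / 2)) :=
      fun θ hθ => (hder θ hθ).continuousAt.continuousWithinAt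
    have hsp : Continuous (segmentPoint k) := by unfold segmentPoint; fun_prop
    have hmem : ∀ θ ∈ Set.Ioo 0 (Real.pi / 2), segmentPoint k θ ∈ exteriorWithAxis ρ₀ \ cut k :=
      fun θ hθ => ⟨⟨(segmentPoint_mem hre hk hθ).1.1.le, Or.inl hre.ne'⟩,
        (segmentPoint_mem hre hk hθ).2⟩
    have h0mem : ((0 : ℝ), k.re) ∈ exteriorWithAxis ρ₀ \ cut k :=
      ⟨⟨le_rfl, Or.inl hre.ne'⟩, fun h => (abs_pos.2 hk).not_ge h.2⟩
    have hΦ0 := hΦ.continuousOn s k hG _ h0mem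
    have hP : Tendsto (fun ζ : ℝ => Φ s k (0, ζ)) (𝓝[>] k.re) (𝓝 (Φ s k (0, k.re))) := by
      refine Tendsto.comp hΦ0 ?_
      refine tendsto_nhdsWithin_iff.2 ⟨?_, ?_⟩
      · exact ((by fun_prop : Continuous fun ζ : ℝ => ((0 : ℝ), ζ)).tendsto k.re).mono_left
          nhdsWithin_le_nhds
      · filter_upwards [self_mem_nhdsWithin] with ζ hζ
        have hζ' : k.re < ζ := hζ
        exact ⟨⟨le_rfl, Or.inl (hre.trans hζ').ne'⟩, fun h => hζ'.ne' h.1⟩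
    have ha : Tendsto g (𝓝[>] 0) (𝓝 (s.signMatrix * Φ s k (0, k.re))) := by
      refine Tendsto.const_mul _ (Tendsto.comp hΦ0 (tendsto_nhdsWithin_iff.2 ⟨?_, ?_⟩))
      · have := hsp.tendsto 0
        simp only [segmentPoint, Real.sin_zero, mul_zero] at this
        exact this.mono_left nhdsWithin_le_nhds
      · filter_upwards [Ioo_mem_nhdsGT hpi] with θ hθ using hmem θ hθ
    have hb : Tendsto g (𝓝[<] (Real.pi / 2)) (𝓝 (s.signMatrix * L)) := by
      refine Tendsto.const_mul _ (Tendsto.comp (hL s) (tendsto_nhdsWithin_iff.2 ⟨?_, ?_⟩))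
      · have := hsp.tendsto (Real.pi / 2)
        simp only [segmentPoint, Real.sin_pi_div_two, mul_one] at this
        exact this.mono_left nhdsWithin_le_nhds
      · filter_upwards [Ioo_mem_nhdsLT hpi] with θ hθ using hmem θ hθ
    have hext : ∀ θ ∈ Set.Ioo 0 (Real.pi / 2), extendFrom (Set.Ioo 0 (Real.pi / 2)) g θ = g θ :=
      fun θ hθ => extendFrom_extends hgc θ hθ
    -- The branch point itself belongs to the cut, where the value of `Φ` carries no information;
    -- the end value must be the limit.
    refine ⟨Φ s k (0, k.re), extendFrom (Set.Ioo 0 (Real.pi / 2)) g, hP,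
      continuousOn_Icc_extendFrom_Ioo hgc ha hb, fun θ hθ => ?_, eq_lim_at_left_extendFrom_Ioo hpi ha, eq_lim_at_right_extendFrom_Ioo hpi hb⟩
    rw [hext θ hθ]
    refine (hder θ hθ).congr_of_eventuallyEq ?_
    filter_upwards [isOpen_Ioo.mem_nhds hθ] with t ht using hext t ht

end IsEigenfunction

/-! ### The values on the axis -/

/-- The Lax equation is available only for `ρ > 0`. Joint convergence of the `ζ`-derivative at each
axis point gives locally uniform convergence on the vertical lines as `ρ → 0`, so the limit function
is differentiable with derivative zero. -/
theorem eq_on_axis_of_deriv_tendsto_zero {q q' : ℝ × ℝ → ℂ} {q₀ : ℝ → ℂ} {ε : ℝ} (hε : 0 ≤ ε)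
    (hd : ∀ p ∈ upperQuadrant, ε < p.2 → HasDerivAt (fun t => q (p.1, t)) (q' p) p.2)
    (h0 : ∀ ζ, ε < ζ → Tendsto q (𝓝[upperQuadrant] (0, ζ)) (𝓝 (q₀ ζ)))
    (h1 : ∀ ζ, ε < ζ → Tendsto q' (𝓝[upperQuadrant] (0, ζ)) (𝓝 0)) {ζ₁ ζ₂ : ℝ}
    (hζ₁ : ε < ζ₁) (hζ₂ : ε < ζ₂) : q₀ ζ₁ = q₀ ζ₂ := by
  have hle : ∀ ζ, 𝓝[>] (0 : ℝ) ×ˢ 𝓝[Set.Ioi ε] ζ ≤ 𝓝[upperQuadrant] ((0 : ℝ), ζ) := by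
    intro ζ
    rw [← nhdsWithin_prod_eq]
    exact nhdsWithin_mono _ fun p hp => ⟨hp.1, hε.trans_lt hp.2⟩
  have hder : ∀ ζ ∈ Set.Ioi ε, HasDerivAt q₀ 0 ζ := by
    intro ζ hζ
    refine hasDerivAt_of_tendstoLocallyUniformlyOn (l := 𝓝[>] (0 : ℝ)) (s := Set.Ioi ε)
      (f := fun ρ t => q (ρ, t)) (f' := fun ρ t => q' (ρ, t)) (g' := fun _ => 0) isOpen_Ioi
      ?_ ?_ ?_ hζ
    · rw [tendstoLocallyUniformlyOn_iff_forall_tendsto]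
      intro x hx
      rw [tendsto_uniformity_iff_dist_tendsto_zero]
      have := ((h1 x hx).mono_left (hle x)).norm
      simpa [dist_eq_norm] using this
    · filter_upwards [self_mem_nhdsWithin] with ρ hρ t ht
      exact hd (ρ, t) ⟨hρ, hε.trans_lt ht⟩ ht
    · intro x hx
      refine (h0 x hx).comp (tendsto_nhdsWithin_iff.2 ⟨?_, ?_⟩)
      · exact ((by fun_prop : Continuous fun ρ : ℝ => (ρ, x)).tendsto 0).mono_left
          nhdsWithin_le_nhds
      · filter_upwards [self_mem_nhdsWithin] with ρ hρ using ⟨hρ, hε.trans_lt hx⟩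
  have := Convex.norm_image_sub_le_of_norm_hasDerivWithin_le (C := 0)
    (fun x hx => (hder x hx).hasDerivWithinAt) (fun x _ => by simp) (convex_Ioi ε) hζ₂ hζ₁
  rw [zero_mul] at this
  exact sub_eq_zero.1 (norm_le_zero_iff.1 this)

theorem tendsto_axis_cocompact :
    Tendsto (fun ζ : ℝ => ((0 : ℝ), ζ)) atTop (cocompact (ℝ × ℝ)) := by
  rw [← Metric.cobounded_eq_cocompact, ← tendsto_norm_atTop_iff_cobounded]
  refine tendsto_atTop_mono (fun ζ => ?_) tendsto_id
  exact (le_abs_self ζ).trans (le_max_right _ _)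

theorem IsErnstPotential.tendsto_axis {ρ₀ : ℝ} {f : ℝ × ℝ → ℂ} (hf : IsErnstPotential ρ₀ f)
    (hρ₀ : 0 < ρ₀) : Tendsto (fun ζ : ℝ => upperExt f (0, ζ)) atTop (𝓝 1) := by
  -- Closed neighbourhoods of `1` retain the axis values, which are limits of values of `f` in the
  -- exterior.
  refine (closed_nhds_basis (1 : ℂ)).tendsto_right_iff.2 ?_
  rintro V ⟨hV, hVc⟩
  have h1 : ∀ᶠ p in cocompact (ℝ × ℝ), p ∈ exterior ρ₀ → f p ∈ V :=
    eventually_inf_principal.1 (hf.flat.eventually hV)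
  obtain ⟨K, hK, hKV⟩ := mem_cocompact.1 h1
  filter_upwards [tendsto_axis_cocompact hK.compl_mem_cocompact, eventually_gt_atTop 0]
    with ζ hζ hζ0
  have hmem := mem_upperBoundaryRegion_axis hρ₀ hζ0.le
  have := neBot_upperQuadrant hmem
  refine hVc.mem_of_tendsto (hf.extends_self.tendsto hmem) ?_
  filter_upwards [self_mem_nhdsWithin,
    mem_nhdsWithin_of_mem_nhds (hK.isClosed.isOpen_compl.mem_nhds hζ)] with p hp hpK
  exact hKV hpK (upperQuadrant_subset_exterior ρ₀ hp)

/-- On the axis the numerator and denominator of the radicand coincide, and at `1` the principal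
root is continuous. -/
theorem tendsto_lam_axis (s : Sheet) {k : ℂ} {ζ : ℝ} (h : k.re < ζ) :
    Tendsto (lam s k) (𝓝 (0, ζ)) (𝓝 s.sign) := by
  have hne : k - ζ ≠ 0 := fun e => by
    have := congrArg Complex.re e
    simp at this; linarith
  have hnum : k - Complex.I * (((0 : ℝ) : ℂ) - Complex.I * (ζ : ℂ)) = k - ζ := by
    rw [Complex.ofReal_zero]; linear_combination (ζ : ℂ) * Complex.I_mul_I
  have hden' : k + Complex.I * (((0 : ℝ) : ℂ) + Complex.I * (ζ : ℂ)) = k - ζ := by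
    rw [Complex.ofReal_zero]; linear_combination (ζ : ℂ) * Complex.I_mul_I
  have hb : (k - Complex.I * (((0 : ℝ) : ℂ) - Complex.I * (ζ : ℂ))) /
      (k + Complex.I * (((0 : ℝ) : ℂ) + Complex.I * (ζ : ℂ))) = 1 := by
    rw [hnum, hden', div_self hne]
  have hden : k + Complex.I * (((0 : ℝ) : ℂ) + Complex.I * (ζ : ℂ)) ≠ 0 := by
    rw [hden']; exact hne
  have hc : ContinuousAt (lam s k) (0, ζ) := by
    unfold lam
    refine continuousAt_const.mul (ContinuousAt.cpow ?_ continuousAt_const ?_)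
    · exact ContinuousAt.div (by fun_prop) (by fun_prop) hden
    · rw [hb]; exact Complex.one_mem_slitPlane
  have he : lam s k (0, ζ) = s.sign := by
    unfold lam
    rw [hb, Complex.one_cpow, mul_one]
  have := hc.tendsto
  rwa [he] at this

namespace IsEigenfunction

variable {ρ₀ : ℝ} {f : ℝ × ℝ → ℂ} {Φ : Sheet → ℂ → ℝ × ℝ → Matrix (Fin 2) (Fin 2) ℂ}

/-- Above `Re k`, each column of `Φ` on the axis is determined by its value at infinity. -/
theorem axis_values (hΦ : IsEigenfunction ρ₀ f Φ) (hf : IsErnstPotential ρ₀ f) (hρ₀ : 0 < ρ₀)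
    (s : Sheet) {k : ℂ} (hre : 0 < k.re) (j : Fin 2) {v₁ v₂ : ℂ}
    (h₁ : Tendsto (fun ζ : ℝ => Φ s k (0, ζ) 0 j) atTop (𝓝 v₁))
    (h₂ : Tendsto (fun ζ : ℝ => Φ s k (0, ζ) 1 j) atTop (𝓝 v₂)) {ζ : ℝ} (hζ : k.re < ζ) :
    Φ s k (0, ζ) 0 j = starRingEnd ℂ (upperExt f (0, ζ)) * ((v₁ + s.sign * v₂) / 2) +
        (v₁ - s.sign * v₂) / 2 ∧
      s.sign * Φ s k (0, ζ) 1 j = upperExt f (0, ζ) * ((v₁ + s.sign * v₂) / 2) -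
        (v₁ - s.sign * v₂) / 2 := by
  have hG := notMem_Gam (ρ₀ := ρ₀) hre
  set F := upperExt f with hF
  set Fr := upperExt (dRho f) with hFr
  set Fz := upperExt (dZeta f) with hFz
  set S := s.sign with hS
  have hSS : S * S = 1 := s.sign_mul_self
  have hS0 : S ≠ 0 := fun h => by rw [h] at hSS; simp at hSS
  have hS1 : S⁻¹ = S := by field_simp; rw [pow_two]; exact hSS.symm
  have hconj : ∀ z : ℂ, 0 < z.re → z + starRingEnd ℂ z ≠ 0 := fun z hz e => by
    have := congrArg Complex.re e
    simp at this; linarith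
  have mF : ∀ ζ, k.re < ζ → ((0 : ℝ), ζ) ∈ upperBoundaryRegion ρ₀ := fun ζ hζ =>
    mem_upperBoundaryRegion_axis hρ₀ (hre.trans hζ).le
  have hd0 : ∀ ζ, k.re < ζ → F (0, ζ) + starRingEnd ℂ (F (0, ζ)) ≠ 0 := fun ζ hζ =>
    hconj _ (hf.ext_re_pos (mF ζ hζ))
  have tΦ : ∀ ζ, k.re < ζ → ∀ i, Tendsto (fun p => Φ s k p i j) (𝓝[upperQuadrant] (0, ζ))
      (𝓝 (Φ s k (0, ζ) i j)) := by
    intro ζ hζ i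
    have h := hΦ.continuousOn s k hG (0, ζ)
      ⟨⟨le_rfl, Or.inl (hre.trans hζ).ne'⟩, fun e => hζ.ne' e.1⟩
    have h' := tendsto_pi_nhds.1 (tendsto_pi_nhds.1 h i) j
    refine h'.mono_left ?_
    have ho : {p : ℝ × ℝ | k.re < p.2} ∈ 𝓝 ((0 : ℝ), ζ) :=
      (isOpen_lt continuous_const continuous_snd).mem_nhds hζ
    refine nhdsWithin_le_iff.2 ?_
    filter_upwards [self_mem_nhdsWithin, mem_nhdsWithin_of_mem_nhds ho] with p hp hp'
    have hp'' : k.re < p.2 := hp'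
    exact ⟨⟨hp.1.le, Or.inl hp.2.ne'⟩, fun e => hp''.ne' e.1⟩
  have tl : ∀ ζ, k.re < ζ → Tendsto (lam s k) (𝓝[upperQuadrant] (0, ζ)) (𝓝 S) := fun ζ hζ =>
    (tendsto_lam_axis s hζ).mono_left nhdsWithin_le_nhds
  have tf : ∀ ζ, k.re < ζ → Tendsto f (𝓝[upperQuadrant] (0, ζ)) (𝓝 (F (0, ζ))) := fun ζ hζ =>
    hf.extends_self.tendsto (mF ζ hζ)
  have tr : ∀ ζ, k.re < ζ → Tendsto (dRho f) (𝓝[upperQuadrant] (0, ζ)) (𝓝 (Fr (0, ζ))) :=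
    fun ζ hζ => hf.extends_dRho.tendsto (mF ζ hζ)
  have tz : ∀ ζ, k.re < ζ → Tendsto (dZeta f) (𝓝[upperQuadrant] (0, ζ)) (𝓝 (Fz (0, ζ))) :=
    fun ζ hζ => hf.extends_dZeta.tendsto (mF ζ hζ)
  have cj : Continuous (starRingEnd ℂ) := Complex.continuous_conj
  have tc : ∀ {g : ℝ × ℝ → ℂ} {p : ℝ × ℝ} {v : ℂ}, Tendsto g (𝓝[upperQuadrant] p) (𝓝 v) →
      Tendsto (fun q => starRingEnd ℂ (g q)) (𝓝[upperQuadrant] p) (𝓝 (starRingEnd ℂ v)) :=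
    fun h => (cj.tendsto _).comp h
  set D : Fin 2 → ℝ × ℝ → ℂ := fun i p => (laxZeta f s k p * Φ s k p) i j with hD
  -- Since `λ → ±1`, the factor `λ⁻¹ - λ` kills the `ρ`-derivatives of `f` in the limit.
  have tD : ∀ ζ, k.re < ζ →
      Tendsto (D 0) (𝓝[upperQuadrant] (0, ζ)) (𝓝 (starRingEnd ℂ (Fz (0, ζ)) *
        (Φ s k (0, ζ) 0 j + S * Φ s k (0, ζ) 1 j) / (F (0, ζ) + starRingEnd ℂ (F (0, ζ))))) ∧
      Tendsto (D 1) (𝓝[upperQuadrant] (0, ζ)) (𝓝 (Fz (0, ζ) *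
        (S * Φ s k (0, ζ) 0 j + Φ s k (0, ζ) 1 j) / (F (0, ζ) + starRingEnd ℂ (F (0, ζ))))) := by
    intro ζ hζ
    have e1 := (tl ζ hζ).inv₀ hS0
    have e2 := e1.add (tl ζ hζ)
    have e3 := (e1.sub (tl ζ hζ)).const_mul Complex.I
    have e4 := ((tf ζ hζ).add (tc (tf ζ hζ))).inv₀ (hd0 ζ hζ)
    constructor
    · have := e4.mul (((tc (tz ζ hζ)).mul (tΦ ζ hζ 0)).add (((((e2.mul (tc (tz ζ hζ))).sub
        (e3.mul (tc (tr ζ hζ)))).const_mul (1 / 2 : ℂ)).mul (tΦ ζ hζ 1))))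
      refine (this.congr fun p => ?_).trans (le_of_eq (congrArg 𝓝 ?_))
      · simp only [hD, laxZeta, Matrix.mul_apply, Fin.sum_univ_two]
        simp
        ring
      · rw [hS1]; ring
    · have := e4.mul ((((((e2.mul (tz ζ hζ)).sub
        (e3.mul (tr ζ hζ))).const_mul (1 / 2 : ℂ)).mul (tΦ ζ hζ 0))).add
          ((tz ζ hζ).mul (tΦ ζ hζ 1)))
      refine (this.congr fun p => ?_).trans (le_of_eq (congrArg 𝓝 ?_))
      · simp only [hD, laxZeta, Matrix.mul_apply, Fin.sum_univ_two]
        simp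
        ring
      · rw [hS1]; ring
  have dΦ : ∀ p ∈ upperQuadrant, k.re < p.2 → ∀ i,
      HasDerivAt (fun t => Φ s k (p.1, t) i j) (D i p) p.2 := fun p hp hp' i =>
    hΦ.lax_zeta s k hG p ⟨upperQuadrant_subset_exterior ρ₀ hp, fun e => hp'.ne' e.1⟩ i j
  have df : ∀ p ∈ upperQuadrant, HasDerivAt (fun t => f (p.1, t)) (dZeta f p) p.2 := fun p hp =>
    hasDerivAt_snd (hf.differentiableAt (upperQuadrant_subset_exterior ρ₀ hp))
  have dfc : ∀ p ∈ upperQuadrant, HasDerivAt (fun t => starRingEnd ℂ (f (p.1, t)))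
      (starRingEnd ℂ (dZeta f p)) p.2 := fun p hp =>
    Complex.conjCLE.toContinuousLinearMap.hasFDerivAt.comp_hasDerivAt p.2 (df p hp)
  have hdp : ∀ p ∈ upperQuadrant, f p + starRingEnd ℂ (f p) ≠ 0 := fun p hp =>
    hconj _ (hf.re_pos p (upperQuadrant_subset_exterior ρ₀ hp))
  -- the two coefficients of the column with respect to the axis solutions
  set Q₁ : ℝ → ℂ := fun ζ => (Φ s k (0, ζ) 0 j + S * Φ s k (0, ζ) 1 j) /
    (F (0, ζ) + starRingEnd ℂ (F (0, ζ))) with hQ₁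
  set Q₂ : ℝ → ℂ := fun ζ => (F (0, ζ) * Φ s k (0, ζ) 0 j -
    starRingEnd ℂ (F (0, ζ)) * (S * Φ s k (0, ζ) 1 j)) /
    (F (0, ζ) + starRingEnd ℂ (F (0, ζ))) with hQ₂
  -- The columns `(f̄, S f)` and `(1, -S)` solve the limiting axis equation; the coefficients of any
  -- other solution in this basis are constant. In the quotient rule the numerator vanishes because
  -- `S² = 1`.
  have c₁ : ∀ ζ' , k.re < ζ' → Q₁ ζ' = Q₁ ζ := fun ζ' hζ' => by
    refine eq_on_axis_of_deriv_tendsto_zero hre.le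
      (q := fun p => (Φ s k p 0 j + S * Φ s k p 1 j) / (f p + starRingEnd ℂ (f p)))
      (fun p hp hp' => ((dΦ p hp hp' 0).add ((dΦ p hp hp' 1).const_mul S)).div
        ((df p hp).add (dfc p hp)) (hdp p hp))
      (fun x hx => ((tΦ x hx 0).add ((tΦ x hx 1).const_mul S)).div
        ((tf x hx).add (tc (tf x hx))) (hd0 x hx)) (fun x hx => ?_) hζ' hζ
    have e0 := hd0 x hx
    have := ((((tD x hx).1.add ((tD x hx).2.const_mul S)).mul
      ((tf x hx).add (tc (tf x hx)))).sub (((tΦ x hx 0).add ((tΦ x hx 1).const_mul S)).mul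
        ((tz x hx).add (tc (tz x hx))))).div (((tf x hx).add (tc (tf x hx))).pow 2)
          (pow_ne_zero 2 e0)
    refine this.trans (le_of_eq (congrArg 𝓝 ?_))
    field_simp
    linear_combination (Fz (0, x) * Φ s k (0, x) 0 j) * hSS
  have c₂ : ∀ ζ' , k.re < ζ' → Q₂ ζ' = Q₂ ζ := fun ζ' hζ' => by
    refine eq_on_axis_of_deriv_tendsto_zero hre.le
      (q := fun p => (f p * Φ s k p 0 j - starRingEnd ℂ (f p) * (S * Φ s k p 1 j)) /
        (f p + starRingEnd ℂ (f p)))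
      (fun p hp hp' => (((df p hp).mul (dΦ p hp hp' 0)).sub
        ((dfc p hp).mul ((dΦ p hp hp' 1).const_mul S))).div
        ((df p hp).add (dfc p hp)) (hdp p hp))
      (fun x hx => (((tf x hx).mul (tΦ x hx 0)).sub
        ((tc (tf x hx)).mul ((tΦ x hx 1).const_mul S))).div
        ((tf x hx).add (tc (tf x hx))) (hd0 x hx)) (fun x hx => ?_) hζ' hζ
    have e0 := hd0 x hx
    have := ((((((tz x hx).mul (tΦ x hx 0)).add ((tf x hx).mul (tD x hx).1)).sub
      (((tc (tz x hx)).mul ((tΦ x hx 1).const_mul S)).add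
        ((tc (tf x hx)).mul ((tD x hx).2.const_mul S)))).mul
      ((tf x hx).add (tc (tf x hx)))).sub ((((tf x hx).mul (tΦ x hx 0)).sub
        ((tc (tf x hx)).mul ((tΦ x hx 1).const_mul S))).mul
        ((tz x hx).add (tc (tz x hx))))).div (((tf x hx).add (tc (tf x hx))).pow 2)
          (pow_ne_zero 2 e0)
    refine this.trans (le_of_eq (congrArg 𝓝 ?_))
    field_simp
    linear_combination (-Fz (0, x) * starRingEnd ℂ (F (0, x)) * Φ s k (0, x) 0 j) * hSS
  have tF := hf.tendsto_axis hρ₀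
  have tFc : Tendsto (fun ζ => starRingEnd ℂ (F (0, ζ))) atTop (𝓝 1) := by
    have := (cj.tendsto 1).comp tF
    rwa [map_one] at this
  have tinv := (tF.add tFc)
  -- The constants are read off at `ζ → ∞`, where `f = 1`.
  have r₁ : Q₁ ζ = (v₁ + S * v₂) / 2 := by
    have t := (h₁.add (h₂.const_mul S)).div tinv (by norm_num)
    have : Tendsto Q₁ atTop (𝓝 (Q₁ ζ)) := tendsto_const_nhds.congr' (by
      filter_upwards [eventually_gt_atTop k.re] with x hx using (c₁ x hx).symm)
    rw [tendsto_nhds_unique this t]; norm_num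
  have r₂ : Q₂ ζ = (v₁ - S * v₂) / 2 := by
    have t := ((tF.mul h₁).sub (tFc.mul (h₂.const_mul S))).div tinv (by norm_num)
    have : Tendsto Q₂ atTop (𝓝 (Q₂ ζ)) := tendsto_const_nhds.congr' (by
      filter_upwards [eventually_gt_atTop k.re] with x hx using (c₂ x hx).symm)
    rw [tendsto_nhds_unique this t]; norm_num
  rw [← r₁, ← r₂, hQ₁, hQ₂]
  have e0 := hd0 ζ hζ
  constructor
  · field_simp; ring
  · field_simp; ring

end IsEigenfunction

/-! ### Dependence on the spectral parameter -/

theorem add_conj_ne_zero {z : ℂ} (hz : 0 < z.re) : z + starRingEnd ℂ z ≠ 0 := fun e => by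
  have := congrArg Complex.re e
  simp at this; linarith

theorem segmentPoint_mem_upperBoundaryRegion {ρ₀ : ℝ} {k : ℂ} (hre : 0 ≤ k.re)
    (him : |k.im| < ρ₀) {θ : ℝ} (hθ : θ ∈ Set.Icc 0 (Real.pi / 2)) :
    segmentPoint k θ ∈ upperBoundaryRegion ρ₀ := by
  have hs : 0 ≤ Real.sin θ := Real.sin_nonneg_of_nonneg_of_le_pi hθ.1
    (by linarith [hθ.2, Real.pi_pos])
  have ha := abs_nonneg k.im
  refine ⟨mul_nonneg ha hs, hre, fun e => ?_⟩
  have e1 : |k.im| * Real.sin θ = ρ₀ := congrArg Prod.fst e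
  nlinarith [Real.sin_le_one θ]

/-- The parameters `k` in the closed right half-plane whose segments do not meet the rim. -/
def rightStrip (ρ₀ : ℝ) : Set ℂ := {k | 0 ≤ k.re ∧ |k.im| < ρ₀}

theorem continuousOn_segmentLax {ρ₀ : ℝ} {f : ℝ × ℝ → ℂ} (hf : IsErnstPotential ρ₀ f) :
    ContinuousOn (Function.uncurry (segmentLax f)) (rightStrip ρ₀ ×ˢ Set.Icc 0 (Real.pi / 2)) := by
  have hp : Continuous fun q : ℂ × ℝ => segmentPoint q.1 q.2 := by
    unfold segmentPoint
    have := Complex.continuous_im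
    have := Complex.continuous_re
    fun_prop
  have hm : Set.MapsTo (fun q : ℂ × ℝ => segmentPoint q.1 q.2)
      (rightStrip ρ₀ ×ˢ Set.Icc 0 (Real.pi / 2)) (upperBoundaryRegion ρ₀) := fun q hq =>
    segmentPoint_mem_upperBoundaryRegion hq.1.1 hq.1.2 hq.2
  have c1 := hf.extends_self.continuousOn.comp hp.continuousOn hm
  have c2 := hf.extends_dRho.continuousOn.comp hp.continuousOn hm
  have c3 := hf.extends_dZeta.continuousOn.comp hp.continuousOn hm
  have cj : Continuous (starRingEnd ℂ) := Complex.continuous_conj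
  have c1' := cj.comp_continuousOn c1
  have c2' := cj.comp_continuousOn c2
  have c3' := cj.comp_continuousOn c3
  have ci : Continuous fun q : ℂ × ℝ => (q.1.im : ℂ) := by
    have := Complex.continuous_im
    fun_prop
  have ca : Continuous fun q : ℂ × ℝ => ((|q.1.im| : ℝ) : ℂ) := by
    have := Complex.continuous_im
    fun_prop
  have cs : Continuous fun q : ℂ × ℝ => ((Real.sin q.2 : ℝ) : ℂ) := by fun_prop
  have cc : Continuous fun q : ℂ × ℝ => ((Real.cos q.2 : ℝ) : ℂ) := by fun_prop
  have cd : ContinuousOn (fun q : ℂ × ℝ => 1 / (upperExt f (segmentPoint q.1 q.2) +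
      starRingEnd ℂ (upperExt f (segmentPoint q.1 q.2))))
      (rightStrip ρ₀ ×ˢ Set.Icc 0 (Real.pi / 2)) :=
    continuousOn_const.div (c1.add c1') fun q hq => add_conj_ne_zero (hf.ext_re_pos (hm hq))
  refine continuousOn_pi.2 fun i => continuousOn_pi.2 fun j => ?_
  fin_cases i <;> fin_cases j
  · exact cd.mul ((ca.mul cc).continuousOn.mul c2')
  · exact cd.mul ((ca.continuousOn.mul c2').add
      (((continuous_const.mul ci).mul cs).continuousOn.mul c3'))
  · exact cd.mul ((ca.continuousOn.mul c2).add
      (((continuous_const.mul ci).mul cs).continuousOn.mul c3))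
  · exact cd.mul ((ca.mul cc).continuousOn.mul c2)

theorem exists_segmentLax_bound {ρ₀ : ℝ} {f : ℝ × ℝ → ℂ} (hf : IsErnstPotential ρ₀ f) {k : ℂ}
    (hk : k ∈ rightStrip ρ₀) : ∃ C, ∀ θ ∈ Set.Ioo 0 (Real.pi / 2), ‖segmentLax f k θ‖ ≤ C := by
  have hc : ContinuousOn (segmentLax f k) (Set.Icc 0 (Real.pi / 2)) :=
    (continuousOn_segmentLax hf).comp (f := fun θ : ℝ => (k, θ)) (by fun_prop) fun θ hθ => ⟨hk, hθ⟩
  obtain ⟨C, hC⟩ := isCompact_Icc.exists_bound_of_continuousOn hc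
  exact ⟨C, fun θ hθ => hC θ ⟨hθ.1.le, hθ.2.le⟩⟩

/-- Joint continuity together with compactness of the `θ`-interval. Points with `Re k = 0` are
included, so the limit may be the coefficient on the face of the disk. -/
theorem tendstoUniformlyOn_segmentLax {ρ₀ : ℝ} {f : ℝ × ℝ → ℂ} (hf : IsErnstPotential ρ₀ f)
    {k : ℂ} (hk : k ∈ rightStrip ρ₀) :
    TendstoUniformlyOn (segmentLax f) (segmentLax f k) (𝓝[rightStrip ρ₀] k)
      (Set.Ioo 0 (Real.pi / 2)) := by
  intro u hu
  obtain ⟨v, hv, h⟩ := isCompact_Icc.mem_uniformity_of_prod (continuousOn_segmentLax hf) hk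
    (symm_le_uniformity hu)
  filter_upwards [hv] with w hw θ hθ using h w hw θ ⟨hθ.1.le, hθ.2.le⟩

theorem rightHalf_le_rightStrip {ρ₀ : ℝ} {k : ℂ} (hk : |k.im| < ρ₀) :
    𝓝[{w : ℂ | 0 < w.re}] k ≤ 𝓝[rightStrip ρ₀] k := by
  refine nhdsWithin_le_iff.2 ?_
  have ho : {w : ℂ | |w.im| < ρ₀} ∈ 𝓝 k :=
    (isOpen_lt (Complex.continuous_im.abs) continuous_const).mem_nhds hk
  filter_upwards [self_mem_nhdsWithin, mem_nhdsWithin_of_mem_nhds ho] with w h1 h2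
  exact ⟨le_of_lt h1, h2⟩

namespace IsEigenfunction

variable {ρ₀ : ℝ} {f : ℝ × ℝ → ℂ} {Φ : Sheet → ℂ → ℝ × ℝ → Matrix (Fin 2) (Fin 2) ℂ} {F G : ℂ → ℂ}

/-- Along the segment from the axis to the branch point, `Φ(z, k^+)` starts with the value given
by the spectral functions and ends with a matrix `L` satisfying `L σ₁ = σ₃ L`. -/
theorem exists_segment_solution (hΦ : IsEigenfunction ρ₀ f Φ) (hf : IsErnstPotential ρ₀ f)
    (hFG : IsSpectralPair ρ₀ Φ F G) (hρ₀ : 0 < ρ₀) {k : ℂ} (hre : 0 < k.re) (him : |k.im| < ρ₀) :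
    ∃ Y : ℝ → Matrix (Fin 2) (Fin 2) ℂ, ContinuousOn Y (Set.Icc 0 (Real.pi / 2)) ∧
      (∀ θ ∈ Set.Ioo 0 (Real.pi / 2), HasDerivAt Y (segmentLax f k θ * Y θ) θ) ∧
      Y 0 = axisMatrix (upperExt f (0, k.re)) * spectralMatrix (F k) (G k) ∧
      Y (Real.pi / 2) * sigma1 = sigma3 * Y (Real.pi / 2) := by
  have hG := notMem_Gam (ρ₀ := ρ₀) hre
  obtain ⟨L, hL⟩ := hΦ.exists_segment_solution_sheet hf hre
  obtain ⟨P, Y, hP, hYc, hYd, hY0, hY1⟩ := hL .upper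
  obtain ⟨P', Z, hP', hZc, hZd, hZ0, hZ1⟩ := hL .lower
  have hsig : Sheet.upper.signMatrix = 1 := by
    ext i j; fin_cases i <;> fin_cases j <;> simp [Sheet.signMatrix, Sheet.sign]
  rw [hsig, one_mul] at hY0 hY1
  have tF : Tendsto (fun ζ : ℝ => upperExt f (0, ζ)) (𝓝[>] k.re) (𝓝 (upperExt f (0, k.re))) := by
    refine Tendsto.comp (hf.extends_self.continuousOn _
      (mem_upperBoundaryRegion_axis hρ₀ hre.le)) (tendsto_nhdsWithin_iff.2 ⟨?_, ?_⟩)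
    · exact ((by fun_prop : Continuous fun ζ : ℝ => ((0 : ℝ), ζ)).tendsto k.re).mono_left
        nhdsWithin_le_nhds
    · filter_upwards [self_mem_nhdsWithin] with ζ hζ
      exact mem_upperBoundaryRegion_axis hρ₀ (hre.trans hζ).le
  have tFc : Tendsto (fun ζ : ℝ => starRingEnd ℂ (upperExt f (0, ζ))) (𝓝[>] k.re)
      (𝓝 (starRingEnd ℂ (upperExt f (0, k.re)))) := (Complex.continuous_conj.tendsto _).comp tF
  have tP : ∀ i j, Tendsto (fun ζ : ℝ => Φ .upper k (0, ζ) i j) (𝓝[>] k.re) (𝓝 (P i j)) :=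
    fun i j => tendsto_pi_nhds.1 (tendsto_pi_nhds.1 hP i) j
  have tP' : ∀ i j, Tendsto (fun ζ : ℝ => Φ .lower k (0, ζ) i j) (𝓝[>] k.re) (𝓝 (P' i j)) :=
    fun i j => tendsto_pi_nhds.1 (tendsto_pi_nhds.1 hP' i) j
  have tinf : ∀ i j, Tendsto (fun ζ : ℝ => Φ .upper k (0, ζ) i j) atTop
      (𝓝 ((axisMatrix 1 * spectralMatrix (F k) (G k)) i j)) :=
    fun i j => tendsto_pi_nhds.1 (tendsto_pi_nhds.1 (hFG k hG) i) j
  have hcol : ∀ (s : Sheet) (j : Fin 2) (v₁ v₂ p₁ p₂ : ℂ),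
      Tendsto (fun ζ : ℝ => Φ s k (0, ζ) 0 j) atTop (𝓝 v₁) →
      Tendsto (fun ζ : ℝ => Φ s k (0, ζ) 1 j) atTop (𝓝 v₂) →
      Tendsto (fun ζ : ℝ => Φ s k (0, ζ) 0 j) (𝓝[>] k.re) (𝓝 p₁) →
      Tendsto (fun ζ : ℝ => Φ s k (0, ζ) 1 j) (𝓝[>] k.re) (𝓝 p₂) →
      p₁ = starRingEnd ℂ (upperExt f (0, k.re)) * ((v₁ + s.sign * v₂) / 2) +
        (v₁ - s.sign * v₂) / 2 ∧
      s.sign * p₂ = upperExt f (0, k.re) * ((v₁ + s.sign * v₂) / 2) -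
        (v₁ - s.sign * v₂) / 2 := by
    intro s j v₁ v₂ p₁ p₂ h1 h2 h3 h4
    constructor
    · refine tendsto_nhds_unique h3 (((tFc.mul_const _).add_const _).congr' ?_)
      filter_upwards [self_mem_nhdsWithin] with ζ hζ
      exact (hΦ.axis_values hf hρ₀ s hre j h1 h2 hζ).1.symm
    · refine tendsto_nhds_unique (h4.const_mul s.sign) (((tF.mul_const _).sub_const _).congr' ?_)
      filter_upwards [self_mem_nhdsWithin] with ζ hζ
      exact (hΦ.axis_values hf hρ₀ s hre j h1 h2 hζ).2.symm
  have u0 := hcol .upper 0 _ _ _ _ (tinf 0 0) (tinf 1 0) (tP 0 0) (tP 1 0)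
  have u1 := hcol .upper 1 _ _ _ _ (tinf 0 1) (tinf 1 1) (tP 0 1) (tP 1 1)
  have l0 := hcol .lower 0 _ _ _ _ (hΦ.initial_lower k hG).1 (hΦ.initial_lower k hG).2
    (tP' 0 0) (tP' 1 0)
  simp [axisMatrix, spectralMatrix, Sheet.sign, Matrix.mul_apply, Fin.sum_univ_two] at u0 u1 l0
  have hPE : P = axisMatrix (upperExt f (0, k.re)) * spectralMatrix (F k) (G k) := by
    ext i j
    fin_cases i <;> fin_cases j <;>
      simp [axisMatrix, spectralMatrix, Matrix.mul_apply, Fin.sum_univ_two]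
    · rw [u0.1]; ring
    · rw [u1.1]
    · rw [u0.2]; ring
    · rw [u1.2]
  refine ⟨Y, hYc, hYd, by rw [hY0, hPE], ?_⟩
  obtain ⟨C, hC⟩ := exists_segmentLax_bound hf (k := k) ⟨hre.le, him⟩
  -- The right factors place the second column of `Y` and the first column of `Z` in the same
  -- position. Both start from `(1, -1)ᵀ`: the sign matrix of the lower sheet turns `(1, 1)ᵀ` into
  -- it. At the end point the equality says that the second column of `L` is `σ₃` times the first.
  have heq := eq_of_linear_ode (y₁ := fun θ => Y θ * !![0, 0; 1, 0])
    (y₂ := fun θ => Z θ * !![1, 0; 0, 0]) (N := segmentLax f k) (C := C)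
    (hYc.mul continuousOn_const) (hZc.mul continuousOn_const)
    (fun t ht => by
      have := (hYd t ht).mul_const (!![0, 0; 1, 0] : Matrix (Fin 2) (Fin 2) ℂ)
      rwa [mul_assoc] at this)
    (fun t ht => by
      have := (hZd t ht).mul_const (!![1, 0; 0, 0] : Matrix (Fin 2) (Fin 2) ℂ)
      rwa [mul_assoc] at this) hC (by
      simp only [hY0, hZ0]
      ext i j
      fin_cases i <;> fin_cases j <;>
        simp only [Matrix.mul_apply, Fin.sum_univ_two, Sheet.signMatrix, Sheet.sign] <;>
        simp [u1, l0]) (Real.pi / 2) ⟨by positivity, le_rfl⟩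
  simp only [hY1, hZ1] at heq
  have q0 := congrFun (congrFun heq 0) 0
  have q1 := congrFun (congrFun heq 1) 0
  simp only [Matrix.mul_apply, Fin.sum_univ_two, Sheet.signMatrix, Sheet.sign] at q0 q1
  simp at q0 q1
  rw [hY1]
  ext i j
  fin_cases i <;> fin_cases j <;>
    simp [Matrix.mul_apply, Fin.sum_univ_two, sigma1, sigma3, q0, q1]

/-- The spectral functions have boundary values on `Γ` from the right. -/
theorem exists_spectral_limit (hΦ : IsEigenfunction ρ₀ f Φ) (hf : IsErnstPotential ρ₀ f)
    (hFG : IsSpectralPair ρ₀ Φ F G) (hρ₀ : 0 < ρ₀) {k : ℂ} (hre : k.re = 0) (him : |k.im| < ρ₀) :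
    ∃ Fp Gp : ℂ, Tendsto F (𝓝[{w : ℂ | 0 < w.re}] k) (𝓝 Fp) ∧
      Tendsto G (𝓝[{w : ℂ | 0 < w.re}] k) (𝓝 Gp) := by
  set l := 𝓝[{w : ℂ | 0 < w.re}] k with hl
  have hev : ∀ᶠ w in l, 0 < w.re ∧ |w.im| < ρ₀ := by
    have ho : {w : ℂ | |w.im| < ρ₀} ∈ 𝓝 k :=
      (isOpen_lt (Complex.continuous_im.abs) continuous_const).mem_nhds him
    filter_upwards [self_mem_nhdsWithin, mem_nhdsWithin_of_mem_nhds ho] with w h1 h2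
      using ⟨h1, h2⟩
  have hex : ∀ w : ℂ, ∃ Y : ℝ → Matrix (Fin 2) (Fin 2) ℂ, 0 < w.re ∧ |w.im| < ρ₀ →
      ContinuousOn Y (Set.Icc 0 (Real.pi / 2)) ∧
      (∀ θ ∈ Set.Ioo 0 (Real.pi / 2), HasDerivAt Y (segmentLax f w θ * Y θ) θ) ∧
      Y 0 = axisMatrix (upperExt f (0, w.re)) * spectralMatrix (F w) (G w) ∧
      Y (Real.pi / 2) * sigma1 = sigma3 * Y (Real.pi / 2) := by
    intro w
    by_cases h : 0 < w.re ∧ |w.im| < ρ₀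
    · obtain ⟨Y, hY⟩ := hΦ.exists_segment_solution hf hFG hρ₀ h.1 h.2
      exact ⟨Y, fun _ => hY⟩
    · exact ⟨0, fun h' => absurd h' h⟩
  choose Y hY using hex
  have hkS : k ∈ rightStrip ρ₀ := ⟨hre.ge, him⟩
  have hunif : TendstoUniformlyOn (segmentLax f) (segmentLax f k) l (Set.Ioo 0 (Real.pi / 2)) :=
    fun u hu => (rightHalf_le_rightStrip him) (tendstoUniformlyOn_segmentLax hf hkS u hu)
  obtain ⟨C, hC⟩ := exists_segmentLax_bound hf hkS
  have hpi : (0 : ℝ) ≤ Real.pi / 2 := by positivity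
  have side : ∀ M : Matrix (Fin 2) (Fin 2) ℂ,
      (∀ᶠ w in l, ContinuousOn (fun θ => Y w θ * M) (Set.Icc 0 (Real.pi / 2))) ∧
      (∀ᶠ w in l, ∀ θ ∈ Set.Ioo 0 (Real.pi / 2),
        HasDerivAt (fun θ => Y w θ * M) (segmentLax f w θ * (Y w θ * M)) θ) := fun M => by
    constructor
    · filter_upwards [hev] with w hw using (hY w hw).1.mul continuousOn_const
    · filter_upwards [hev] with w hw θ hθ
      have := ((hY w hw).2.1 θ hθ).mul_const M
      rwa [mul_assoc] at this
  -- the second column, up to the branch point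
  obtain ⟨Y₁, hY₁⟩ := exists_tendsto_of_linear_ode (l := l)
    (y := fun w θ => Y w θ * !![0, 0; 1, 0]) (side _).1 (side _).2 hunif hC
    (y₀ := !![1, 0; -1, 0]) (tendsto_const_nhds.congr' (by
      filter_upwards [hev] with w hw
      rw [(hY w hw).2.2.1]
      ext i j
      fin_cases i <;> fin_cases j <;>
        simp [axisMatrix, spectralMatrix, Matrix.mul_apply, Fin.sum_univ_two])) hpi
  -- the first column, back to the axis
  obtain ⟨Y₀, hY₀⟩ := exists_tendsto_of_linear_ode_reverse (l := l)
    (y := fun w θ => Y w θ * !![1, 0; 0, 0]) (side _).1 (side _).2 hunif hC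
    -- `L σ₁ = σ₃ L` expresses the first column at the branch point as `σ₃` times the second.
    (y₀ := sigma3 * Y₁) ((hY₁.const_mul sigma3).congr' (by
      filter_upwards [hev] with w hw
      rw [← mul_assoc, ← (hY w hw).2.2.2, mul_assoc]
      congr 1
      ext i j
      fin_cases i <;> fin_cases j <;> simp [sigma1, Matrix.mul_apply, Fin.sum_univ_two])) hpi
  have hent : ∀ i, Tendsto (fun w => (axisMatrix (upperExt f (0, w.re)) *
      spectralMatrix (F w) (G w)) i 0) l (𝓝 (Y₀ i 0)) := by
    intro i
    have h := tendsto_pi_nhds.1 (tendsto_pi_nhds.1 hY₀ i) 0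
    refine h.congr' ?_
    filter_upwards [hev] with w hw
    rw [(hY w hw).2.2.1]
    simp [Matrix.mul_apply, Fin.sum_univ_two]
  have h0 := hent 0
  have h1 := hent 1
  simp only [axisMatrix, spectralMatrix, Matrix.mul_apply, Fin.sum_univ_two] at h0 h1
  simp at h0 h1
  have hm0 := mem_upperBoundaryRegion_axis hρ₀ (le_refl (0 : ℝ))
  have tF : Tendsto (fun w : ℂ => upperExt f (0, w.re)) l (𝓝 (upperExt f (0, 0))) := by
    refine Tendsto.comp (hf.extends_self.continuousOn _ hm0) (tendsto_nhdsWithin_iff.2 ⟨?_, ?_⟩)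
    · have : Continuous fun w : ℂ => ((0 : ℝ), w.re) := by
        have := Complex.continuous_re
        fun_prop
      have := this.tendsto k
      rw [hre] at this
      exact this.mono_left nhdsWithin_le_nhds
    · filter_upwards [hev] with w hw
      exact mem_upperBoundaryRegion_axis hρ₀ hw.1.le
  have tFc : Tendsto (fun w : ℂ => starRingEnd ℂ (upperExt f (0, w.re))) l
      (𝓝 (starRingEnd ℂ (upperExt f (0, 0)))) := (Complex.continuous_conj.tendsto _).comp tF
  have hne : upperExt f (0, 0) + starRingEnd ℂ (upperExt f (0, 0)) ≠ 0 :=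
    add_conj_ne_zero (hf.ext_re_pos hm0)
  have hne' : ∀ᶠ w in l, upperExt f (0, w.re) + starRingEnd ℂ (upperExt f (0, w.re)) ≠ 0 := by
    filter_upwards [hev] with w hw
    exact add_conj_ne_zero (hf.ext_re_pos (mem_upperBoundaryRegion_axis hρ₀ hw.1.le))
  -- The entries `f̄F + G` and `fF - G` converge; their sum is `(f + f̄) F` with `f + f̄ = 2 Re f ≠
  -- 0`.
  have tFF : Tendsto F l (𝓝 _) := (((h0.add h1).div (tF.add tFc) hne).congr' (by
    filter_upwards [hne'] with w hw
    rw [Pi.div_apply, div_eq_iff hw]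
    ring))
  refine ⟨_, _, tFF, (h0.sub (tFc.mul tFF)).congr fun w => by ring⟩

end IsEigenfunction

/-! ### The corotating potential near the upper face of the disk -/

/-- `∂_ρ Re f'`, expressed through `f` and `m = 1 + Ω a`. -/
def corotDRhoRe (Ω m ρ u : ℝ) (fr fz : ℂ) : ℝ :=
  fr.re * (m ^ 2 + Ω ^ 2 * ρ ^ 2 / u ^ 2) + 2 * Ω * ρ * m * fz.im / u - 2 * Ω ^ 2 * ρ / u

/-- `∂_ρ Im f'`, expressed through `f` and `m = 1 + Ω a`. -/
def corotDRhoIm (Ω m ρ u : ℝ) (fr fz : ℂ) : ℝ :=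
  fr.im * (m ^ 2 + Ω ^ 2 * ρ ^ 2 / u ^ 2) - 2 * Ω * ρ * m * fz.re / u

theorem hasDerivAt_corotExp {ρ₀ Ω : ℝ} {f : ℝ × ℝ → ℂ} {a : ℝ × ℝ → ℝ}
    (hf : IsErnstPotential ρ₀ f) (ha : IsMetricFunction ρ₀ f a) {p : ℝ × ℝ}
    (hp : p ∈ exterior ρ₀) :
    HasDerivAt (fun r : ℝ => corotExp Ω f a (r, p.2))
      (corotDRhoRe Ω (1 + Ω * a p) p.1 (f p).re (dRho f p) (dZeta f p)) p.1 := by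
  have hu := (hasDerivAt_fst (hf.differentiableAt hp)).complex_re
  have hu0 : (f p).re ≠ 0 := (hf.re_pos p hp).ne'
  have ha' := ha.hasDerivAt_rho hf hp
  have h := hu.mul (((((ha'.const_mul Ω).const_add 1).pow 2)).sub
    ((((hasDerivAt_id p.1).pow 2).const_mul (Ω ^ 2)).div (hu.pow 2) (pow_ne_zero 2 hu0)))
  refine h.congr_deriv ?_
  simp only [corotDRhoRe, id, Pi.pow_apply, Pi.sub_apply, Pi.div_apply, Prod.mk.eta]
  field_simp
  ring

theorem hasDerivAt_corotExp_zeta {ρ₀ Ω : ℝ} {f : ℝ × ℝ → ℂ} {a : ℝ × ℝ → ℝ}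
    (hf : IsErnstPotential ρ₀ f) (ha : IsMetricFunction ρ₀ f a) {p : ℝ × ℝ}
    (hp : p ∈ exterior ρ₀) :
    HasDerivAt (fun t : ℝ => corotExp Ω f a (p.1, t))
      ((dZeta f p).re * ((1 + Ω * a p) ^ 2 + Ω ^ 2 * p.1 ^ 2 / (f p).re ^ 2) -
        2 * Ω * p.1 * (1 + Ω * a p) * (dRho f p).im / (f p).re) p.2 := by
  have hu := (hasDerivAt_snd (hf.differentiableAt hp)).complex_re
  have hu0 : (f p).re ≠ 0 := (hf.re_pos p hp).ne'
  have ha' := ha.hasDerivAt_zeta hf hp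
  have h := hu.mul (((((ha'.const_mul Ω).const_add 1).pow 2)).sub
    ((hasDerivAt_const p.2 (Ω ^ 2 * p.1 ^ 2)).div (hu.pow 2) (pow_ne_zero 2 hu0)))
  refine h.congr_deriv ?_
  simp only [Pi.pow_apply, Pi.sub_apply, Pi.div_apply, Prod.mk.eta]
  field_simp
  ring

namespace IsCorotatingPotential

variable {ρ₀ Ω : ℝ} {f f' : ℝ × ℝ → ℂ} {a : ℝ × ℝ → ℝ}

theorem dRho_re_eq (hf' : IsCorotatingPotential ρ₀ Ω f a f') (hf : IsErnstPotential ρ₀ f)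
    (ha : IsMetricFunction ρ₀ f a) {p : ℝ × ℝ} (hp : p ∈ exterior ρ₀) :
    (dRho f' p).re = corotDRhoRe Ω (1 + Ω * a p) p.1 (f p).re (dRho f p) (dZeta f p) := by
  have h1 := (hasDerivAt_fst (hf'.differentiableOn.differentiableAt
    ((isOpen_exterior ρ₀).mem_nhds hp))).complex_re
  refine h1.unique ((hasDerivAt_corotExp hf ha hp).congr_of_eventuallyEq ?_)
  have hc : Continuous fun r : ℝ => (r, p.2) := by fun_prop
  filter_upwards [hc.continuousAt.preimage_mem_nhds ((isOpen_exterior ρ₀).mem_nhds hp)]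
    with r hr using hf'.re_eq _ hr

/-- Differentiate the quotient defining `a'` in `ζ` and solve `a'_ζ = -ρ e^{-4U'} b'_ρ` for `b'_ρ`;
the square of `Re f'` in the denominator cancels. The equation for `a'_ζ` is at hand only where `Re
f' ≠ 0`. -/
theorem dRho_im_eq (hf' : IsCorotatingPotential ρ₀ Ω f a f') (hf : IsErnstPotential ρ₀ f)
    (ha : IsMetricFunction ρ₀ f a) {p : ℝ × ℝ} (hp : p ∈ exterior ρ₀)
    (hc : corotExp Ω f a p ≠ 0) :
    (dRho f' p).im = corotDRhoIm Ω (1 + Ω * a p) p.1 (f p).re (dRho f p) (dZeta f p) := by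
  have hre := hf'.re_eq p hp
  have h0 := hf'.dZeta_eq p hp (by rw [hre]; exact hc)
  rw [dRho_im (hf'.differentiableOn.differentiableAt ((isOpen_exterior ρ₀).mem_nhds hp)),
    hre] at h0
  have hu := (hasDerivAt_snd (hf.differentiableAt hp)).complex_re
  have hu0 : (f p).re ≠ 0 := (hf.re_pos p hp).ne'
  have ha' := ha.hasDerivAt_zeta hf hp
  have hd := (((hu.mul ha').mul ((ha'.const_mul Ω).const_add 1)).sub
    ((hasDerivAt_const p.2 (Ω * p.1 ^ 2)).div hu hu0)).div (hasDerivAt_corotExp_zeta hf ha hp) hc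
  have he := hd.deriv
  have hdef : deriv (fun t : ℝ => corotA Ω f a (p.1, t)) p.2 = _ := he
  change dZeta (corotA Ω f a) p = _ at hdef
  rw [hdef] at h0
  have hρ : p.1 ≠ 0 := hp.1.ne'
  have e : -(p.1 / corotExp Ω f a p ^ 2 * (dRho f' p).im) * corotExp Ω f a p ^ 2 =
      -(p.1 * (dRho f' p).im) := by field_simp
  simp only [Pi.mul_apply, Pi.sub_apply, Pi.div_apply, Prod.mk.eta] at h0
  rw [div_eq_iff (pow_ne_zero 2 hc), e] at h0
  have h3 : p.1 * (dRho f' p).im =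
      p.1 * corotDRhoIm Ω (1 + Ω * a p) p.1 (f p).re (dRho f p) (dZeta f p) := by
    rw [← neg_inj, ← h0]
    simp only [corotDRhoIm, corotExp]
    field_simp
    ring
  exact mul_left_cancel₀ hρ h3

end IsCorotatingPotential

/-! ### The condition `f'_ρ = 0` on the face, in terms of `f` and `a` -/

section Face

variable {ρ₀ Ω R : ℝ} {f f' : ℝ × ℝ → ℂ} {a α : ℝ × ℝ → ℝ}

theorem continuousOn_corotDRho (hf : IsErnstPotential ρ₀ f) (hα : Continuous α) (Ω : ℝ) :
    ContinuousOn (fun p : ℝ × ℝ => corotDRhoRe Ω (1 + Ω * α p) p.1 (upperExt f p).re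
      (upperExt (dRho f) p) (upperExt (dZeta f) p)) (upperBoundaryRegion ρ₀) ∧
    ContinuousOn (fun p : ℝ × ℝ => corotDRhoIm Ω (1 + Ω * α p) p.1 (upperExt f p).re
      (upperExt (dRho f) p) (upperExt (dZeta f) p)) (upperBoundaryRegion ρ₀) := by
  have c1 := Complex.continuous_re.comp_continuousOn hf.extends_self.continuousOn
  have r2 := Complex.continuous_re.comp_continuousOn hf.extends_dRho.continuousOn
  have i2 := Complex.continuous_im.comp_continuousOn hf.extends_dRho.continuousOn
  have r3 := Complex.continuous_re.comp_continuousOn hf.extends_dZeta.continuousOn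
  have i3 := Complex.continuous_im.comp_continuousOn hf.extends_dZeta.continuousOn
  have h0 : ∀ p ∈ upperBoundaryRegion ρ₀, (upperExt f p).re ≠ 0 := fun p hp =>
    (hf.ext_re_pos hp).ne'
  have cm : Continuous fun p : ℝ × ℝ => 1 + Ω * α p := by fun_prop
  have cq : ContinuousOn (fun p : ℝ × ℝ => (1 + Ω * α p) ^ 2 + Ω ^ 2 * p.1 ^ 2 /
      (upperExt f p).re ^ 2) (upperBoundaryRegion ρ₀) :=
    (cm.pow 2).continuousOn.add (ContinuousOn.div (by fun_prop) (c1.pow 2)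
      fun p hp => pow_ne_zero 2 (h0 p hp))
  have cl : Continuous fun p : ℝ × ℝ => 2 * Ω * p.1 * (1 + Ω * α p) := by fun_prop
  exact ⟨((r2.mul cq).add ((cl.continuousOn.mul i3).div c1 h0)).sub
    (ContinuousOn.div (by fun_prop) c1 h0), (i2.mul cq).sub ((cl.continuousOn.mul r3).div c1 h0)⟩

/-- A function on the closed upper region which vanishes on the open face vanishes on the closed
segment `[0, R]`. -/
theorem eq_zero_on_face {g : ℝ × ℝ → ℝ} (hg : ContinuousOn g (upperBoundaryRegion ρ₀))
    (hR₀ : 0 < R) (hR : R < ρ₀) (h : ∀ ρ ∈ Set.Ioo 0 R, g (ρ, 0) = 0) :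
    ∀ ρ ∈ Set.Icc 0 R, g (ρ, 0) = 0 := by
  have hc : ContinuousOn (fun ρ : ℝ => g (ρ, 0)) (Set.Icc 0 R) :=
    hg.comp (f := fun ρ : ℝ => (ρ, (0 : ℝ))) (by fun_prop) fun ρ hρ =>
      box_subset hR ⟨hρ, le_rfl, zero_le_one⟩
  intro ρ hρ
  have hcl : ρ ∈ closure (Set.Ioo 0 R) := by rw [closure_Ioo hR₀.ne]; exact hρ
  have : (𝓝[Set.Ioo 0 R] ρ).NeBot := mem_closure_iff_nhdsWithin_neBot.1 hcl
  exact tendsto_nhds_unique ((hc ρ hρ).mono Set.Ioo_subset_Icc_self)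
    (tendsto_const_nhds.congr' (eventually_nhdsWithin_of_forall fun x hx => (h x hx).symm))

theorem tendsto_vertical {ρ : ℝ} (hρ : ρ ∈ Set.Ioo 0 R) {g : ℝ × ℝ → ℝ} (hR : R < ρ₀)
    (hg : ContinuousOn g (upperBoundaryRegion ρ₀)) :
    Tendsto (fun ζ : ℝ => g (ρ, ζ)) (𝓝[>] 0) (𝓝 (g (ρ, 0))) := by
  have hsub := box_subset hR
  refine Tendsto.comp (hg (ρ, 0) (hsub ⟨⟨hρ.1.le, hρ.2.le⟩, le_rfl, zero_le_one⟩))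
    (tendsto_nhdsWithin_iff.2 ⟨?_, ?_⟩)
  · exact ((by fun_prop : Continuous fun ζ : ℝ => (ρ, ζ)).tendsto 0).mono_left nhdsWithin_le_nhds
  · filter_upwards [Ioo_mem_nhdsGT one_pos] with ζ hζ
    exact hsub ⟨⟨hρ.1.le, hρ.2.le⟩, hζ.1.le, hζ.2.le⟩

/-- On the face, `f'_ρ = 0` expressed through `f` and the boundary values of `a`. -/
theorem corotDRho_eq_zero_on_face (hf : IsErnstPotential ρ₀ f) (ha : IsMetricFunction ρ₀ f a)
    (hf' : IsCorotatingPotential ρ₀ Ω f a f')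
    (hdisk : ∀ ρ : ℝ, 0 < ρ → ρ < ρ₀ → Tendsto (fun ζ : ℝ => dRho f' (ρ, ζ)) (𝓝[>] 0) (𝓝 0))
    (hR₀ : 0 < R) (hR : R < ρ₀) (hα : Continuous α)
    (hαa : ∀ p ∈ Set.Ioo 0 R ×ˢ Set.Ioo (0 : ℝ) 1, α p = a p)
    (hα0 : α (0, 0) = 0) :
    ∀ ρ ∈ Set.Icc 0 R,
      corotDRhoRe Ω (1 + Ω * α (ρ, 0)) ρ (upperExt f (ρ, 0)).re
        (upperExt (dRho f) (ρ, 0)) (upperExt (dZeta f) (ρ, 0)) = 0 ∧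
      corotDRhoIm Ω (1 + Ω * α (ρ, 0)) ρ (upperExt f (ρ, 0)).re
        (upperExt (dRho f) (ρ, 0)) (upperExt (dZeta f) (ρ, 0)) = 0 := by
  obtain ⟨cP, cI⟩ := continuousOn_corotDRho hf hα Ω
  set P : ℝ × ℝ → ℝ := fun p => corotDRhoRe Ω (1 + Ω * α p) p.1 (upperExt f p).re
      (upperExt (dRho f) p) (upperExt (dZeta f) p) with hP
  set I : ℝ × ℝ → ℝ := fun p => corotDRhoIm Ω (1 + Ω * α p) p.1 (upperExt f p).re
      (upperExt (dRho f) p) (upperExt (dZeta f) p) with hI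
  have hquad : ∀ ρ ∈ Set.Ioo 0 R, ∀ ζ ∈ Set.Ioo (0 : ℝ) 1, ((ρ, ζ) : ℝ × ℝ) ∈ upperQuadrant :=
    fun ρ hρ ζ hζ => ⟨hρ.1, hζ.1⟩
  have hPeq : ∀ ρ ∈ Set.Ioo 0 R, ∀ ζ ∈ Set.Ioo (0 : ℝ) 1,
      P (ρ, ζ) = corotDRhoRe Ω (1 + Ω * a (ρ, ζ)) ρ (f (ρ, ζ)).re (dRho f (ρ, ζ))
        (dZeta f (ρ, ζ)) := by
    intro ρ hρ ζ hζ
    have hq := hquad ρ hρ ζ hζ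
    simp only [hP]
    rw [hαa (ρ, ζ) ⟨hρ, hζ⟩, hf.extends_self.eq hq, hf.extends_dRho.eq hq, hf.extends_dZeta.eq hq]
  have hre : ∀ ρ ∈ Set.Ioo 0 R, P (ρ, 0) = 0 := by
    intro ρ hρ
    refine tendsto_nhds_unique (tendsto_vertical hρ hR cP) ?_
    have h1 := (Complex.continuous_re.tendsto 0).comp (hdisk ρ hρ.1 (hρ.2.trans hR))
    refine h1.congr' ?_
    filter_upwards [Ioo_mem_nhdsGT one_pos] with ζ hζ
    rw [hPeq ρ hρ ζ hζ]
    exact hf'.dRho_re_eq hf ha (upperQuadrant_subset_exterior ρ₀ (hquad ρ hρ ζ hζ))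
  have hre' := eq_zero_on_face cP hR₀ hR hre
  -- the extension of `Re f'` is constant, hence positive, on the face
  set c : ℝ × ℝ → ℝ := fun p => (upperExt f p).re * ((1 + Ω * α p) ^ 2 -
    Ω ^ 2 * p.1 ^ 2 / (upperExt f p).re ^ 2) with hc
  have c1 := Complex.continuous_re.comp_continuousOn hf.extends_self.continuousOn
  have cc : ContinuousOn c (upperBoundaryRegion ρ₀) := by
    refine c1.mul (ContinuousOn.sub (by fun_prop) (ContinuousOn.div (by fun_prop) (c1.pow 2) ?_))
    exact fun p hp => pow_ne_zero 2 (hf.ext_re_pos hp).ne'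
  have hceq : ∀ ρ ∈ Set.Ioo 0 R, ∀ ζ ∈ Set.Ioo (0 : ℝ) 1,
      c (ρ, ζ) = corotExp Ω f a (ρ, ζ) := by
    intro ρ hρ ζ hζ
    simp only [hc, corotExp]
    rw [hαa (ρ, ζ) ⟨hρ, hζ⟩, hf.extends_self.eq (hquad ρ hρ ζ hζ)]
  have hcder : ∀ ζ ∈ Set.Ioo (0 : ℝ) 1, ∀ ρ ∈ Set.Ioo 0 R,
      HasDerivAt (fun r => c (r, ζ)) (P (ρ, ζ)) ρ := by
    intro ζ hζ ρ hρ
    rw [hPeq ρ hρ ζ hζ]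
    refine (hasDerivAt_corotExp hf ha (p := (ρ, ζ))
      (upperQuadrant_subset_exterior ρ₀ (hquad ρ hρ ζ hζ))).congr_of_eventuallyEq ?_
    filter_upwards [isOpen_Ioo.mem_nhds hρ] with r hr using hceq r hr ζ hζ
  have hunif : ∀ η > 0, ∀ᶠ ζ in 𝓝[>] (0 : ℝ), ∀ ρ ∈ Set.Icc 0 R, |P (ρ, ζ)| ≤ η := by
    intro η hη
    obtain ⟨v, hv, h⟩ := (isCompact_Icc (a := (0 : ℝ)) (b := R)).mem_uniformity_of_prod
      (f := fun ζ ρ => P (ρ, ζ)) (s := Set.Icc (0 : ℝ) 1) (q := 0)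
      (cP.comp (by fun_prop) fun x hx => box_subset hR ⟨hx.2, hx.1⟩)
      ⟨le_rfl, zero_le_one⟩ (Metric.dist_mem_uniformity hη)
    have hle : 𝓝[>] (0 : ℝ) ≤ 𝓝[Set.Icc 0 1] 0 := nhdsWithin_le_of_mem (by
      filter_upwards [Ioo_mem_nhdsGT one_pos] with x hx using ⟨hx.1.le, hx.2.le⟩)
    filter_upwards [hle hv] with ζ hζ ρ hρ
    have := h ζ hζ ρ hρ
    simp only [hre' ρ hρ] at this
    rw [Set.mem_ofPred_eq, Real.dist_eq, sub_zero] at this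
    exact this.le
  -- The mean value inequality is applied at height `ζ > 0`, where `c` is `Re f'` and its derivative
  -- `P` is uniformly small; then `ζ → 0`.
  have hconst : ∀ ρ₁ ∈ Set.Ioo 0 R, ∀ ρ₂ ∈ Set.Ioo 0 R, c (ρ₁, 0) = c (ρ₂, 0) := by
    intro ρ₁ h₁ ρ₂ h₂
    have ht := (tendsto_vertical h₁ hR cc).sub (tendsto_vertical h₂ hR cc)
    have h0 : Tendsto (fun ζ : ℝ => c (ρ₁, ζ) - c (ρ₂, ζ)) (𝓝[>] 0) (𝓝 0) := by
      rw [Metric.tendsto_nhds]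
      intro η hη
      filter_upwards [hunif (η / (2 * (R + 1))) (by positivity), Ioo_mem_nhdsGT one_pos]
        with ζ hζ hζ1
      have hb := Convex.norm_image_sub_le_of_norm_hasDerivWithin_le (f := fun r => c (r, ζ))
        (s := Set.Ioo 0 R)
        (fun x hx => (hcder ζ hζ1 x hx).hasDerivWithinAt)
        (fun x hx => hζ x ⟨hx.1.le, hx.2.le⟩) (convex_Ioo _ _) h₂ h₁
      have hd : ‖ρ₁ - ρ₂‖ ≤ R + 1 := by
        rw [Real.norm_eq_abs, abs_le]
        constructor <;> linarith [h₁.1, h₁.2, h₂.1, h₂.2]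
      rw [Real.dist_eq, sub_zero]
      calc |c (ρ₁, ζ) - c (ρ₂, ζ)| ≤ η / (2 * (R + 1)) * ‖ρ₁ - ρ₂‖ := hb
        _ ≤ η / (2 * (R + 1)) * (R + 1) := by gcongr
        _ = η / 2 := by field_simp
        _ < η := by linarith
    exact sub_eq_zero.1 (tendsto_nhds_unique ht h0)
  have hmem : ((0 : ℝ), (0 : ℝ)) ∈ upperBoundaryRegion ρ₀ :=
    box_subset hR ⟨⟨le_rfl, hR₀.le⟩, le_rfl, zero_le_one⟩
  -- At the centre `a` and `ρ` vanish, so `Re f'` equals `Re f > 0` there. Being constant on the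
  -- face, `Re f'` is positive near each of its interior points, and the formula for `b'_ρ` applies.
  have hc0 : 0 < c (0, 0) := by
    simp only [hc, hα0]
    simpa using hf.ext_re_pos hmem
  have hcpos : ∀ ρ ∈ Set.Ioo 0 R, c (ρ, 0) = c (0, 0) := by
    intro ρ hρ
    have := eq_zero_on_face (g := fun p => c p - c (ρ, 0)) (cc.sub continuousOn_const) hR₀ hR
      (fun x hx => sub_eq_zero.2 (hconst x hx ρ hρ)) 0 ⟨le_rfl, hR₀.le⟩
    exact (sub_eq_zero.1 this).symm
  have him : ∀ ρ ∈ Set.Ioo 0 R, I (ρ, 0) = 0 := by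
    intro ρ hρ
    refine tendsto_nhds_unique (tendsto_vertical hρ hR cI) ?_
    have h1 := (Complex.continuous_im.tendsto 0).comp (hdisk ρ hρ.1 (hρ.2.trans hR))
    refine h1.congr' ?_
    have hpos : ∀ᶠ ζ in 𝓝[>] (0 : ℝ), 0 < c (ρ, ζ) :=
      (tendsto_vertical hρ hR cc).eventually (lt_mem_nhds (by rw [hcpos ρ hρ]; exact hc0))
    filter_upwards [Ioo_mem_nhdsGT one_pos, hpos] with ζ hζ hcζ
    have hq := hquad ρ hρ ζ hζ
    rw [hceq ρ hρ ζ hζ] at hcζ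
    have := hf'.dRho_im_eq hf ha (upperQuadrant_subset_exterior ρ₀ hq) hcζ.ne'
    simp only [hI, Function.comp]
    rw [this, hαa (ρ, ζ) ⟨hρ, hζ⟩, hf.extends_self.eq hq, hf.extends_dRho.eq hq,
      hf.extends_dZeta.eq hq]
  exact fun ρ hρ => ⟨hre' ρ hρ, eq_zero_on_face cI hR₀ hR him ρ hρ⟩

end Face

/-! ### The conserved quantity on the face -/

/-- `adj(Λ) σ₁ σ₃ Λ̄` at the point with `cos θ = c` of the segment, where `m = 1 + Ω a` and
`v = e^{-2U}`. -/
def gaugeConj (Ω κ c m v : ℝ) : Matrix (Fin 2) (Fin 2) ℂ :=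
  !![((-2 * κ ^ 2 * Ω ^ 2 * (c * v ^ 2) : ℝ) : ℂ),
      ((-(m ^ 2 - 2 * κ * Ω * (m * v) + Ω ^ 2 * κ ^ 2 * ((1 + c ^ 2) * v ^ 2)) : ℝ) : ℂ);
    ((m ^ 2 + 2 * κ * Ω * (m * v) + Ω ^ 2 * κ ^ 2 * ((1 + c ^ 2) * v ^ 2) : ℝ) : ℂ),
      ((2 * κ ^ 2 * Ω ^ 2 * (c * v ^ 2) : ℝ) : ℂ)]

/-- The derivative of `gaugeConj` along the segment. -/
def gaugeConjDeriv (Ω κ c s m v m' v' : ℝ) : Matrix (Fin 2) (Fin 2) ℂ :=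
  !![((-2 * κ ^ 2 * Ω ^ 2 * (-s * v ^ 2 + c * (2 * v * v')) : ℝ) : ℂ),
      ((-(2 * m * m' - 2 * κ * Ω * (m' * v + m * v') +
        Ω ^ 2 * κ ^ 2 * (2 * c * -s * v ^ 2 + (1 + c ^ 2) * (2 * v * v'))) : ℝ) : ℂ);
    ((2 * m * m' + 2 * κ * Ω * (m' * v + m * v') +
        Ω ^ 2 * κ ^ 2 * (2 * c * -s * v ^ 2 + (1 + c ^ 2) * (2 * v * v')) : ℝ) : ℂ),
      ((2 * κ ^ 2 * Ω ^ 2 * (-s * v ^ 2 + c * (2 * v * v')) : ℝ) : ℂ)]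

theorem hasDerivAt_gaugeConj {Ω κ θ m' v' : ℝ} {m v : ℝ → ℝ} (hm : HasDerivAt m m' θ)
    (hv : HasDerivAt v v' θ) :
    HasDerivAt (fun t => gaugeConj Ω κ (Real.cos t) (m t) (v t))
      (gaugeConjDeriv Ω κ (Real.cos θ) (Real.sin θ) (m θ) (v θ) m' v') θ := by
  have hc := Real.hasDerivAt_cos θ
  have hm2 : HasDerivAt (fun t => m t ^ 2) (2 * m θ * m') θ :=
    (hm.pow 2).congr_deriv (by norm_num)
  have hv2 : HasDerivAt (fun t => v t ^ 2) (2 * v θ * v') θ :=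
    (hv.pow 2).congr_deriv (by norm_num)
  have hc2 : HasDerivAt (fun t => 1 + Real.cos t ^ 2) (2 * Real.cos θ * -Real.sin θ) θ := by
    simpa using (hc.pow 2).const_add 1
  have h1 : HasDerivAt (fun t => Real.cos t * v t ^ 2)
    (-Real.sin θ * v θ ^ 2 + Real.cos θ * (2 * v θ * v')) θ := hc.mul hv2
  have h2 := (hm.mul hv).const_mul (2 * κ * Ω)
  have h3 := (hc2.mul hv2).const_mul (Ω ^ 2 * κ ^ 2)
  refine hasDerivAt_pi.2 fun i => hasDerivAt_pi.2 fun j => ?_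
  fin_cases i <;> fin_cases j
  · exact (h1.const_mul (-2 * κ ^ 2 * Ω ^ 2)).ofReal_comp
  · exact ((hm2.sub h2).add h3).neg.ofReal_comp
  · exact ((hm2.add h2).add h3).ofReal_comp
  · exact (h1.const_mul (2 * κ ^ 2 * Ω ^ 2)).ofReal_comp

theorem continuous_gaugeConj (Ω κ : ℝ) :
    Continuous fun q : ℝ × ℝ × ℝ => gaugeConj Ω κ q.1 q.2.1 q.2.2 := by
  refine continuous_pi fun i => continuous_pi fun j => ?_
  fin_cases i <;> fin_cases j
  · exact Complex.continuous_ofReal.comp (by fun_prop :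
      Continuous fun q : ℝ × ℝ × ℝ => -2 * κ ^ 2 * Ω ^ 2 * (q.1 * q.2.2 ^ 2))
  · exact Complex.continuous_ofReal.comp (by fun_prop : Continuous fun q : ℝ × ℝ × ℝ =>
      -(q.2.1 ^ 2 - 2 * κ * Ω * (q.2.1 * q.2.2) + Ω ^ 2 * κ ^ 2 * ((1 + q.1 ^ 2) * q.2.2 ^ 2)))
  · exact Complex.continuous_ofReal.comp (by fun_prop : Continuous fun q : ℝ × ℝ × ℝ =>
      q.2.1 ^ 2 + 2 * κ * Ω * (q.2.1 * q.2.2) + Ω ^ 2 * κ ^ 2 * ((1 + q.1 ^ 2) * q.2.2 ^ 2))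
  · exact Complex.continuous_ofReal.comp (by fun_prop :
      Continuous fun q : ℝ × ℝ × ℝ => 2 * κ ^ 2 * Ω ^ 2 * (q.1 * q.2.2 ^ 2))

/-- The failure of `adj(Φ) adj(Λ) σ₁ σ₃ Λ̄ Φ̄` to be constant, in terms of `f'_ρ = P + i I`. -/
def corotDefect (κ c u P I : ℝ) : Matrix (Fin 2) (Fin 2) ℂ :=
  ((|κ| / u : ℝ) : ℂ) • !![-(P : ℂ) + Complex.I * I, -((c : ℂ) * P);
    (c : ℂ) * P, (P : ℂ) + Complex.I * I]

/-- The left side is the matrix between `adj(Y)` and `Ȳ` in the derivative of `adj(Y) T Ȳ` when `Y'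
= N Y`. The arguments for `m'` and `v'` are the `θ`-derivatives of `1 + Ωa` and `e^{-2U}`, with
`a_ρ` replaced by its expression in `f`. -/
theorem segment_identity (Ω κ θ m : ℝ) {f : ℂ} (fr fz : ℂ) (hf : f.re ≠ 0) :
    Matrix.adjugate (segmentCoeff f fr fz κ θ) * gaugeConj Ω κ (Real.cos θ) m (1 / f.re) +
        gaugeConjDeriv Ω κ (Real.cos θ) (Real.sin θ) m (1 / f.re)
          (Ω * (|κ| * Real.cos θ * (|κ| * Real.sin θ / f.re ^ 2 * fz.im)))
          (-(|κ| * Real.cos θ * fr.re) / f.re ^ 2) +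
        gaugeConj Ω κ (Real.cos θ) m (1 / f.re) * conjM (segmentCoeff f fr fz κ θ) =
      corotDefect κ (Real.cos θ) f.re
        (corotDRhoRe Ω m (|κ| * Real.sin θ) f.re fr fz)
        (corotDRhoIm Ω m (|κ| * Real.sin θ) f.re fr fz) := by
  have hconj : ∀ z : ℂ, starRingEnd ℂ z = (z.re : ℂ) - Complex.I * z.im := fun z => by
    apply Complex.ext <;> simp
  have hz : ∀ z : ℂ, z = (z.re : ℂ) + Complex.I * z.im := fun z => by
    apply Complex.ext <;> simp
  have hs : ((Real.sin θ : ℝ) : ℂ) ^ 2 + ((Real.cos θ : ℝ) : ℂ) ^ 2 = 1 := by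
    exact_mod_cast Real.sin_sq_add_cos_sq θ
  have hK : ((|κ| : ℝ) : ℂ) ^ 2 = (κ : ℂ) ^ 2 := by exact_mod_cast sq_abs κ
  have hJ : Complex.I ^ 2 = -1 := Complex.I_sq
  obtain ⟨v, hv⟩ : ∃ v : ℝ, v = 1 / f.re := ⟨_, rfl⟩
  have hN : (1 : ℂ) / (f + starRingEnd ℂ f) = v / 2 := by
    rw [Complex.add_conj, hv]
    push_cast
    field_simp
  have e1 : |κ| * Real.sin θ / f.re ^ 2 * fz.im = |κ| * Real.sin θ * v ^ 2 * fz.im := by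
    rw [hv]; field_simp
  have e2 : -(|κ| * Real.cos θ * fr.re) / f.re ^ 2 = -(|κ| * Real.cos θ * fr.re) * v ^ 2 := by
    rw [hv]; field_simp
  have e3 : corotDRhoRe Ω m (|κ| * Real.sin θ) f.re fr fz =
      fr.re * (m ^ 2 + Ω ^ 2 * (|κ| * Real.sin θ) ^ 2 * v ^ 2) +
        2 * Ω * (|κ| * Real.sin θ) * m * fz.im * v - 2 * Ω ^ 2 * (|κ| * Real.sin θ) * v := by
    rw [hv, corotDRhoRe]; field_simp
  have e4 : corotDRhoIm Ω m (|κ| * Real.sin θ) f.re fr fz =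
      fr.im * (m ^ 2 + Ω ^ 2 * (|κ| * Real.sin θ) ^ 2 * v ^ 2) -
        2 * Ω * (|κ| * Real.sin θ) * m * fz.re * v := by
    rw [hv, corotDRhoIm]; field_simp
  have e5 : |κ| / f.re = |κ| * v := by rw [hv]; ring
  have hN' : segmentCoeff f fr fz κ θ = ((v : ℂ) / 2) •
      !![((|κ| : ℝ) : ℂ) * Real.cos θ * (fr.re - Complex.I * fr.im),
          ((|κ| : ℝ) : ℂ) * (fr.re - Complex.I * fr.im) +
            Complex.I * κ * Real.sin θ * (fz.re - Complex.I * fz.im);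
        ((|κ| : ℝ) : ℂ) * (fr.re + Complex.I * fr.im) +
            Complex.I * κ * Real.sin θ * (fz.re + Complex.I * fz.im),
          ((|κ| : ℝ) : ℂ) * Real.cos θ * (fr.re + Complex.I * fr.im)] := by
    rw [segmentCoeff, hN, hconj fr, hconj fz, ← hz fr, ← hz fz]
  have hcN : conjM (segmentCoeff f fr fz κ θ) = ((v : ℂ) / 2) •
      !![((|κ| : ℝ) : ℂ) * Real.cos θ * (fr.re + Complex.I * fr.im),
          ((|κ| : ℝ) : ℂ) * (fr.re + Complex.I * fr.im) -
            Complex.I * κ * Real.sin θ * (fz.re + Complex.I * fz.im);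
        ((|κ| : ℝ) : ℂ) * (fr.re - Complex.I * fr.im) -
            Complex.I * κ * Real.sin θ * (fz.re - Complex.I * fz.im),
          ((|κ| : ℝ) : ℂ) * Real.cos θ * (fr.re - Complex.I * fr.im)] := by
    rw [hN']
    ext i j
    fin_cases i <;> fin_cases j <;>
      simp only [conjM, Matrix.map_apply, Matrix.smul_apply, smul_eq_mul, Fin.zero_eta, Fin.mk_one,
        Matrix.of_apply, Matrix.cons_val', Matrix.cons_val_zero, Matrix.cons_val_one,
        Matrix.cons_val_fin_one, map_mul, map_add, map_sub, map_div₀, Complex.conj_ofReal,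
        Complex.conj_I, map_ofNat] <;> ring
  rw [e1, e2, e3, e4, corotDefect, e5, ← hv, hcN, hN', Matrix.adjugate_fin_two]
  -- What remains is polynomial in independent symbols, modulo `sin² + cos² = 1`, `|κ|² = κ²` and
  -- `i² = -1`.
  clear e1 e2 e3 e4 e5 hcN hN' hN hconj hz hv hf
  generalize Real.sin θ = s at *
  generalize Real.cos θ = c at *
  generalize |κ| = K at *
  generalize fr.re = ur at *
  generalize fr.im = ui at *
  generalize fz.re = zr at *
  generalize fz.im = zi at *
  generalize Complex.I = J at *
  ext i j
  fin_cases i <;> fin_cases j <;>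
    simp only [gaugeConj, gaugeConjDeriv, Matrix.add_apply, Matrix.mul_apply, Fin.sum_univ_two,
      Matrix.smul_apply, smul_eq_mul, Matrix.of_apply, Matrix.cons_val', Matrix.cons_val_zero,
      Matrix.cons_val_one, Matrix.cons_val_fin_one, Fin.zero_eta, Fin.mk_one] <;>
    push_cast <;> grind

/-! ### The product `adj(Y) T Ȳ` and its symmetry at the branch point -/

theorem hasDerivAt_adjugate {Y : ℝ → Matrix (Fin 2) (Fin 2) ℂ} {Y' : Matrix (Fin 2) (Fin 2) ℂ}
    {t : ℝ} (h : HasDerivAt Y Y' t) :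
    HasDerivAt (fun s => (Y s).adjugate) Y'.adjugate t := by
  have he : ∀ i j, HasDerivAt (fun s => Y s i j) (Y' i j) t := fun i j =>
    hasDerivAt_pi.1 (hasDerivAt_pi.1 h i) j
  simp only [Matrix.adjugate_fin_two]
  refine hasDerivAt_pi.2 fun i => hasDerivAt_pi.2 fun j => ?_
  fin_cases i <;> fin_cases j
  · exact he 1 1
  · exact (he 0 1).neg
  · exact (he 1 0).neg
  · exact he 0 0

theorem hasDerivAt_conjM {Y : ℝ → Matrix (Fin 2) (Fin 2) ℂ} {Y' : Matrix (Fin 2) (Fin 2) ℂ}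
    {t : ℝ} (h : HasDerivAt Y Y' t) : HasDerivAt (fun s => conjM (Y s)) (conjM Y') t :=
  hasDerivAt_pi.2 fun i => hasDerivAt_pi.2 fun j =>
    Complex.conjCLE.toContinuousLinearMap.hasFDerivAt.comp_hasDerivAt t
      (hasDerivAt_pi.1 (hasDerivAt_pi.1 h i) j)

theorem conjM_mul (M N : Matrix (Fin 2) (Fin 2) ℂ) : conjM (M * N) = conjM M * conjM N :=
  Matrix.map_mul

theorem continuous_conjM : Continuous conjM := by
  refine continuous_pi fun i => continuous_pi fun j => ?_
  exact Complex.continuous_conj.comp (continuous_apply_apply i j)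

theorem continuous_adjugate :
    Continuous (Matrix.adjugate : Matrix (Fin 2) (Fin 2) ℂ → Matrix (Fin 2) (Fin 2) ℂ) :=
  continuous_id.matrix_adjugate

/-- For `2 × 2` matrices the adjugate is linear and reverses products, so `adj(Y)' = adj(Y) adj(N)`.
Using it in place of the inverse makes invertibility of `Y` irrelevant. -/
theorem hasDerivAt_adjugate_mul_mul_conjM {Y T : ℝ → Matrix (Fin 2) (Fin 2) ℂ}
    {N T' : Matrix (Fin 2) (Fin 2) ℂ} {t : ℝ} (hY : HasDerivAt Y (N * Y t) t)
    (hT : HasDerivAt T T' t) :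
    HasDerivAt (fun s => (Y s).adjugate * T s * conjM (Y s))
      ((Y t).adjugate * (N.adjugate * T t + T' + T t * conjM N) * conjM (Y t)) t := by
  have h := ((hasDerivAt_adjugate hY).mul hT).mul (hasDerivAt_conjM hY)
  refine h.congr_deriv ?_
  rw [Matrix.adjugate_mul_distrib, conjM_mul]
  simp only [Pi.mul_apply]
  noncomm_ring

theorem conjM_sigma1 : conjM sigma1 = sigma1 := by
  ext i j; fin_cases i <;> fin_cases j <;> simp [conjM, sigma1]

theorem conjM_sigma3 : conjM sigma3 = sigma3 := by
  ext i j; fin_cases i <;> fin_cases j <;> simp [conjM, sigma3]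

/-- Conjugating `L σ₁ = σ₃ L` moves `σ₁` through `L̄` as `σ₃`; taking adjugates, with `adj σᵢ =
-σᵢ`, does the same for `adj L`. The sign comes from moving `σ₃` through `T`. -/
theorem anticommute_of_branch {L T : Matrix (Fin 2) (Fin 2) ℂ} (hL : L * sigma1 = sigma3 * L)
    (hT : T * sigma3 = -(sigma3 * T)) :
    (L.adjugate * T * conjM L) * sigma1 = -(sigma1 * (L.adjugate * T * conjM L)) := by
  have h1 : conjM L * sigma1 = sigma3 * conjM L := by
    rw [← conjM_sigma1, ← conjM_mul, hL, conjM_mul, conjM_sigma3]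
  have h2 : sigma1 * L.adjugate = L.adjugate * sigma3 := by
    have h := congrArg Matrix.adjugate hL
    rw [Matrix.adjugate_mul_distrib, Matrix.adjugate_mul_distrib] at h
    have a1 : sigma1.adjugate = -sigma1 := by
      rw [Matrix.adjugate_fin_two]
      ext i j; fin_cases i <;> fin_cases j <;> simp [sigma1]
    have a3 : sigma3.adjugate = -sigma3 := by
      rw [Matrix.adjugate_fin_two]
      ext i j; fin_cases i <;> fin_cases j <;> simp [sigma3]
    rw [a1, a3, neg_mul, mul_neg, neg_inj] at h
    exact h
  calc (L.adjugate * T * conjM L) * sigma1 = L.adjugate * (T * sigma3) * conjM L := by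
        rw [mul_assoc, h1]; noncomm_ring
    _ = -((L.adjugate * sigma3) * T * conjM L) := by rw [hT]; noncomm_ring
    _ = _ := by rw [← h2]; noncomm_ring

/-- At the branch point `cos θ = 0`, and the diagonal entries carry the factor `cos θ`. -/
theorem gaugeConj_zero_mul_sigma3 (Ω κ m v : ℝ) :
    gaugeConj Ω κ 0 m v * sigma3 = -(sigma3 * gaugeConj Ω κ 0 m v) := by
  ext i j
  fin_cases i <;> fin_cases j <;>
    simp [gaugeConj, sigma3, Matrix.mul_apply, Fin.sum_univ_two]

theorem continuous_axisMatrix : Continuous axisMatrix := by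
  refine continuous_pi fun i => continuous_pi fun j => ?_
  fin_cases i <;> fin_cases j
  · exact Complex.continuous_conj
  · exact continuous_const
  · exact continuous_id
  · exact continuous_const

theorem continuous_spectralMatrix : Continuous fun q : ℂ × ℂ => spectralMatrix q.1 q.2 := by
  refine continuous_pi fun i => continuous_pi fun j => ?_
  fin_cases i <;> fin_cases j
  · exact continuous_fst
  · exact continuous_const
  · exact continuous_snd
  · exact continuous_const

/-! ### Letting the segment approach the face -/

section Face

variable {ρ₀ Ω κ : ℝ} {f f' : ℝ × ℝ → ℂ} {a α : ℝ × ℝ → ℝ}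

/-- `adj(Λ) σ₁ σ₃ Λ̄` along the segment at height `ε`. -/
def segmentGauge (Ω κ : ℝ) (f : ℝ × ℝ → ℂ) (α : ℝ × ℝ → ℝ) (ε θ : ℝ) :
    Matrix (Fin 2) (Fin 2) ℂ :=
  gaugeConj Ω κ (Real.cos θ) (1 + Ω * α (segmentPoint ⟨ε, κ⟩ θ))
    (1 / (upperExt f (segmentPoint ⟨ε, κ⟩ θ)).re)

/-- The defect along the segment at height `ε`. -/
def segmentDefect (Ω κ : ℝ) (f : ℝ × ℝ → ℂ) (α : ℝ × ℝ → ℝ) (ε θ : ℝ) :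
    Matrix (Fin 2) (Fin 2) ℂ :=
  corotDefect κ (Real.cos θ) (upperExt f (segmentPoint ⟨ε, κ⟩ θ)).re
    (corotDRhoRe Ω (1 + Ω * α (segmentPoint ⟨ε, κ⟩ θ)) (segmentPoint ⟨ε, κ⟩ θ).1
      (upperExt f (segmentPoint ⟨ε, κ⟩ θ)).re (upperExt (dRho f) (segmentPoint ⟨ε, κ⟩ θ))
      (upperExt (dZeta f) (segmentPoint ⟨ε, κ⟩ θ)))
    (corotDRhoIm Ω (1 + Ω * α (segmentPoint ⟨ε, κ⟩ θ)) (segmentPoint ⟨ε, κ⟩ θ).1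
      (upperExt f (segmentPoint ⟨ε, κ⟩ θ)).re (upperExt (dRho f) (segmentPoint ⟨ε, κ⟩ θ))
      (upperExt (dZeta f) (segmentPoint ⟨ε, κ⟩ θ)))

theorem continuous_segmentPoint_mk (κ : ℝ) :
    Continuous fun q : ℝ × ℝ => segmentPoint ⟨q.1, κ⟩ q.2 := by
  unfold segmentPoint
  fun_prop

theorem mapsTo_segmentPoint_mk (hκ : |κ| < ρ₀) :
    Set.MapsTo (fun q : ℝ × ℝ => segmentPoint ⟨q.1, κ⟩ q.2)
      (Set.Ici 0 ×ˢ Set.Icc 0 (Real.pi / 2)) (upperBoundaryRegion ρ₀) := fun q hq =>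
  segmentPoint_mem_upperBoundaryRegion (k := ⟨q.1, κ⟩) hq.1 hκ hq.2

theorem continuousOn_segmentGauge (hf : IsErnstPotential ρ₀ f) (hα : Continuous α)
    (hκ : |κ| < ρ₀) (Ω : ℝ) :
    ContinuousOn (Function.uncurry (segmentGauge Ω κ f α))
      (Set.Ici 0 ×ˢ Set.Icc 0 (Real.pi / 2)) := by
  have hp := continuous_segmentPoint_mk κ
  have hm := mapsTo_segmentPoint_mk hκ
  have cu := Complex.continuous_re.comp_continuousOn
    (hf.extends_self.continuousOn.comp hp.continuousOn hm)
  have cα : Continuous fun q : ℝ × ℝ => α (segmentPoint ⟨q.1, κ⟩ q.2) := hα.comp hp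
  have cv : ContinuousOn (fun q : ℝ × ℝ => 1 / (upperExt f (segmentPoint ⟨q.1, κ⟩ q.2)).re)
      (Set.Ici 0 ×ˢ Set.Icc 0 (Real.pi / 2)) :=
    continuousOn_const.div cu fun q hq => (hf.ext_re_pos (hm hq)).ne'
  have cc : Continuous fun q : ℝ × ℝ => Real.cos q.2 := by fun_prop
  have cm : Continuous fun q : ℝ × ℝ => 1 + Ω * α (segmentPoint ⟨q.1, κ⟩ q.2) := by fun_prop
  have h3 : ContinuousOn (fun q : ℝ × ℝ => (Real.cos q.2,
      1 + Ω * α (segmentPoint ⟨q.1, κ⟩ q.2), 1 / (upperExt f (segmentPoint ⟨q.1, κ⟩ q.2)).re))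
      (Set.Ici 0 ×ˢ Set.Icc 0 (Real.pi / 2)) :=
    cc.continuousOn.prodMk (cm.continuousOn.prodMk cv)
  have h4 := (continuous_gaugeConj Ω κ).comp_continuousOn h3
  refine h4.congr fun q _ => ?_
  simp only [Function.uncurry, segmentGauge, Function.comp]

theorem continuousOn_segmentDefect (hf : IsErnstPotential ρ₀ f) (hα : Continuous α)
    (hκ : |κ| < ρ₀) (Ω : ℝ) :
    ContinuousOn (Function.uncurry (segmentDefect Ω κ f α))
      (Set.Ici 0 ×ˢ Set.Icc 0 (Real.pi / 2)) := by
  have hp := continuous_segmentPoint_mk κ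
  have hm := mapsTo_segmentPoint_mk hκ
  have cu := Complex.continuous_re.comp_continuousOn
    (hf.extends_self.continuousOn.comp hp.continuousOn hm)
  have cv : ContinuousOn (fun q : ℝ × ℝ =>
      ((|κ| / (upperExt f (segmentPoint ⟨q.1, κ⟩ q.2)).re : ℝ) : ℂ))
      (Set.Ici 0 ×ˢ Set.Icc 0 (Real.pi / 2)) :=
    Complex.continuous_ofReal.comp_continuousOn
      (continuousOn_const.div cu fun q hq => (hf.ext_re_pos (hm hq)).ne')
  have cc : Continuous fun q : ℝ × ℝ => ((Real.cos q.2 : ℝ) : ℂ) := by fun_prop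
  obtain ⟨hP, hI⟩ := continuousOn_corotDRho hf hα Ω
  have cP := Complex.continuous_ofReal.comp_continuousOn (hP.comp hp.continuousOn hm)
  have cI := Complex.continuous_ofReal.comp_continuousOn (hI.comp hp.continuousOn hm)
  refine continuousOn_pi.2 fun i => continuousOn_pi.2 fun j => ?_
  fin_cases i <;> fin_cases j
  · exact cv.mul (cP.neg.add (continuousOn_const.mul cI))
  · exact cv.mul (cc.continuousOn.mul cP).neg
  · exact cv.mul (cc.continuousOn.mul cP)
  · exact cv.mul (cP.add (continuousOn_const.mul cI))

theorem adjugate_add_deriv_eq_segmentDefect (hf : IsErnstPotential ρ₀ f)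
    (ha : IsMetricFunction ρ₀ f a) {R : ℝ} (hR : |κ| < R) (hκ : κ ≠ 0)
    (hαa : ∀ p ∈ Set.Ioo 0 R ×ˢ Set.Ioo (0 : ℝ) 1, α p = a p)
    {ε : ℝ} (hε : ε ∈ Set.Ioo (0 : ℝ) 1) {θ : ℝ} (hθ : θ ∈ Set.Ioo 0 (Real.pi / 2)) :
    ∃ T', HasDerivAt (segmentGauge Ω κ f α ε) T' θ ∧
      (segmentLax f ⟨ε, κ⟩ θ).adjugate * segmentGauge Ω κ f α ε θ + T' +
        segmentGauge Ω κ f α ε θ * conjM (segmentLax f ⟨ε, κ⟩ θ) =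
          segmentDefect Ω κ f α ε θ := by
  have hmem : ∀ t ∈ Set.Ioo 0 (Real.pi / 2), segmentPoint ⟨ε, κ⟩ t ∈ upperQuadrant := fun t ht =>
    (segmentPoint_mem (k := ⟨ε, κ⟩) hε.1 hκ ht).1
  have hbox : ∀ t ∈ Set.Ioo 0 (Real.pi / 2),
      segmentPoint ⟨ε, κ⟩ t ∈ Set.Ioo 0 R ×ˢ Set.Ioo (0 : ℝ) 1 := fun t ht => by
    refine ⟨⟨(hmem t ht).1, lt_of_le_of_lt ?_ hR⟩, hε⟩
    exact mul_le_of_le_one_right (abs_nonneg κ) (Real.sin_le_one t)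
  have hq := hmem θ hθ
  have hext := upperQuadrant_subset_exterior ρ₀ hq
  set p := segmentPoint ⟨ε, κ⟩ θ with hp
  have hu0 : (f p).re ≠ 0 := (hf.re_pos p hext).ne'
  have hs : HasDerivAt (fun t => |κ| * Real.sin t) (|κ| * Real.cos θ) θ :=
    (Real.hasDerivAt_sin θ).const_mul _
  have hfd : HasDerivAt (fun t => (f (segmentPoint ⟨ε, κ⟩ t)).re)
      (|κ| * Real.cos θ * (dRho f p).re) θ :=
    HasDerivAt.scomp (h := fun t => |κ| * Real.sin t) (g₁ := fun r => (f (r, ε)).re) θ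
      (hasDerivAt_fst (hf.differentiableAt hext)).complex_re hs
  have had : HasDerivAt (fun t => a (segmentPoint ⟨ε, κ⟩ t))
      (|κ| * Real.cos θ * (p.1 / (f p).re ^ 2 * (dZeta f p).im)) θ :=
    HasDerivAt.scomp (h := fun t => |κ| * Real.sin t) (g₁ := fun r => a (r, ε)) θ
      (ha.hasDerivAt_rho hf hext) hs
  have hm := (had.const_mul Ω).const_add 1
  have hv : HasDerivAt (fun t => 1 / (f (segmentPoint ⟨ε, κ⟩ t)).re)
      (-(|κ| * Real.cos θ * (dRho f p).re) / (f p).re ^ 2) θ := by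
    simp only [one_div]
    exact hfd.fun_inv hu0
  have hT := hasDerivAt_gaugeConj (Ω := Ω) (κ := κ) hm hv
  refine ⟨_, hT.congr_of_eventuallyEq ?_, ?_⟩
  · filter_upwards [isOpen_Ioo.mem_nhds hθ] with t ht
    rw [segmentGauge, hαa _ (hbox t ht), hf.extends_self.eq (hmem t ht)]
  · have hid := segment_identity Ω κ θ (1 + Ω * a p) (dRho f p) (dZeta f p) hu0
    rw [segmentGauge, segmentDefect, segmentLax, ← hp, hαa _ (hbox θ hθ), hf.extends_self.eq hq,
      hf.extends_dRho.eq hq, hf.extends_dZeta.eq hq]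
    exact hid

theorem tendsto_mk_rightHalf (κ : ℝ) :
    Tendsto (fun ε : ℝ => (⟨ε, κ⟩ : ℂ)) (𝓝[>] 0) (𝓝[{w : ℂ | 0 < w.re}] ⟨0, κ⟩) := by
  refine tendsto_nhdsWithin_iff.2 ⟨?_, ?_⟩
  · have h : Continuous fun ε : ℝ => (⟨ε, κ⟩ : ℂ) := by
      have : (fun ε : ℝ => (⟨ε, κ⟩ : ℂ)) = fun ε : ℝ => (ε : ℂ) + κ * Complex.I := by
        funext ε; apply Complex.ext <;> simp
      rw [this]; fun_prop
    exact (h.tendsto 0).mono_left nhdsWithin_le_nhds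
  · filter_upwards [self_mem_nhdsWithin] with ε hε using hε

/-- The relation at interior points `k = iκ ≠ 0` of `Γ`, before division by determinants. -/
theorem anticommute_of_tendsto (hf : IsErnstPotential ρ₀ f) (ha : IsMetricFunction ρ₀ f a)
    (hf' : IsCorotatingPotential ρ₀ Ω f a f')
    (hdisk : ∀ ρ : ℝ, 0 < ρ → ρ < ρ₀ → Tendsto (fun ζ : ℝ => dRho f' (ρ, ζ)) (𝓝[>] 0) (𝓝 0))
    {Φ : Sheet → ℂ → ℝ × ℝ → Matrix (Fin 2) (Fin 2) ℂ} {F G : ℂ → ℂ}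
    (hΦ : IsEigenfunction ρ₀ f Φ) (hFG : IsSpectralPair ρ₀ Φ F G) (hκ0 : κ ≠ 0) (hκ : |κ| < ρ₀)
    {Fp Gp : ℂ} (hF : Tendsto F (𝓝[{w : ℂ | 0 < w.re}] ⟨0, κ⟩) (𝓝 Fp))
    (hG : Tendsto G (𝓝[{w : ℂ | 0 < w.re}] ⟨0, κ⟩) (𝓝 Gp))
    {M T₀ Z : Matrix (Fin 2) (Fin 2) ℂ}
    (hM : M = axisMatrix (upperExt f (0, 0)) * spectralMatrix Fp Gp)
    (hT₀ : T₀ = gaugeConj Ω κ 1 1 (1 / (upperExt f (0, 0)).re))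
    (hZ : Z = M.adjugate * T₀ * conjM M) :
    Z * sigma1 = -(sigma1 * Z) := by
  have habs : 0 < |κ| := abs_pos.2 hκ0
  have hρ₀ : 0 < ρ₀ := habs.trans hκ
  have hpi : (0 : ℝ) < Real.pi / 2 := by positivity
  -- Any `R` strictly between `|κ|` and `ρ₀` serves: the segments stay in the box, and the box
  -- avoids the rim.
  set R := (|κ| + ρ₀) / 2 with hRdef
  have hκR : |κ| < R := by rw [hRdef]; linarith
  have hRρ : R < ρ₀ := by rw [hRdef]; linarith
  obtain ⟨α, hα, hαa, hα0⟩ := ha.exists_continuous_ext hf (habs.trans hκR) hRρ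
  have hface := corotDRho_eq_zero_on_face hf ha hf' hdisk (habs.trans hκR) hRρ hα hαa
    (hα0 0 ⟨le_rfl, zero_le_one⟩)
  have hl := tendsto_mk_rightHalf κ
  have hex : ∀ ε : ℝ, ∃ Y : ℝ → Matrix (Fin 2) (Fin 2) ℂ, 0 < ε →
      ContinuousOn Y (Set.Icc 0 (Real.pi / 2)) ∧
      (∀ θ ∈ Set.Ioo 0 (Real.pi / 2), HasDerivAt Y (segmentLax f ⟨ε, κ⟩ θ * Y θ) θ) ∧
      Y 0 = axisMatrix (upperExt f (0, ε)) * spectralMatrix (F ⟨ε, κ⟩) (G ⟨ε, κ⟩) ∧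
      Y (Real.pi / 2) * sigma1 = sigma3 * Y (Real.pi / 2) := by
    intro ε
    by_cases h : 0 < ε
    · obtain ⟨Y, hY⟩ := hΦ.exists_segment_solution hf hFG hρ₀ (k := ⟨ε, κ⟩) h hκ
      exact ⟨Y, fun _ => hY⟩
    · exact ⟨0, fun h' => absurd h' h⟩
  choose Y hY using hex
  have hev : ∀ᶠ ε in 𝓝[>] (0 : ℝ), ε ∈ Set.Ioo (0 : ℝ) 1 := Ioo_mem_nhdsGT one_pos
  have hkS : (⟨0, κ⟩ : ℂ) ∈ rightStrip ρ₀ := ⟨le_rfl, hκ⟩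
  have hunif : TendstoUniformlyOn (fun ε : ℝ => segmentLax f ⟨ε, κ⟩) (segmentLax f ⟨0, κ⟩)
      (𝓝[>] (0 : ℝ)) (Set.Ioo 0 (Real.pi / 2)) := fun u hu =>
    (hl.mono_right (rightHalf_le_rightStrip hκ)).eventually
      (tendstoUniformlyOn_segmentLax hf hkS u hu)
  obtain ⟨C, hC⟩ := exists_segmentLax_bound hf hkS
  -- the initial values
  have hm0 := mem_upperBoundaryRegion_axis hρ₀ (le_refl (0 : ℝ))
  have haxis : Tendsto (fun ε : ℝ => ((0 : ℝ), ε)) (𝓝[>] 0) (𝓝[upperBoundaryRegion ρ₀] (0, 0)) := by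
    refine tendsto_nhdsWithin_iff.2 ⟨?_, ?_⟩
    · exact ((by fun_prop : Continuous fun ε : ℝ => ((0 : ℝ), ε)).tendsto 0).mono_left
        nhdsWithin_le_nhds
    · filter_upwards [hev] with ε hε using mem_upperBoundaryRegion_axis hρ₀ hε.1.le
  have tf : Tendsto (fun ε : ℝ => upperExt f (0, ε)) (𝓝[>] 0) (𝓝 (upperExt f (0, 0))) :=
    Tendsto.comp (hf.extends_self.continuousOn _ hm0) haxis
  have tY0 : Tendsto (fun ε => Y ε 0) (𝓝[>] 0) (𝓝 M) := by
    rw [hM]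
    refine (((continuous_axisMatrix.tendsto _).comp tf).mul
      ((continuous_spectralMatrix.tendsto (Fp, Gp)).comp
        ((hF.comp hl).prodMk_nhds (hG.comp hl)))).congr' ?_
    filter_upwards [hev] with ε hε using (hY ε hε.1).2.2.1.symm
  obtain ⟨K, hK⟩ := eventually_norm_le_of_linear_ode (l := 𝓝[>] (0 : ℝ)) (y := Y)
    (N := fun ε => segmentLax f ⟨ε, κ⟩)
    (by filter_upwards [hev] with ε hε using (hY ε hε.1).1)
    (by filter_upwards [hev] with ε hε using (hY ε hε.1).2.1) hunif hC tY0
  have : ProperSpace (Matrix (Fin 2) (Fin 2) ℂ) := FiniteDimensional.proper ℂ _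
  -- All the solutions take values in one compact ball, so `adj(Y)` and `Ȳ` are bounded uniformly in
  -- `ε` and `θ`.
  have hcomp : IsCompact (Metric.closedBall (0 : Matrix (Fin 2) (Fin 2) ℂ) K) :=
    isCompact_closedBall 0 K
  obtain ⟨K₁, hK₁⟩ := hcomp.exists_bound_of_continuousOn continuous_adjugate.continuousOn
  obtain ⟨K₂, hK₂⟩ := hcomp.exists_bound_of_continuousOn continuous_conjM.continuousOn
  set T := segmentGauge Ω κ f α with hTdef
  have cT := continuousOn_segmentGauge hf hα hκ Ω
  set D : ℝ → ℝ → Matrix (Fin 2) (Fin 2) ℂ := fun ε θ =>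
    (Y ε θ).adjugate * T ε θ * conjM (Y ε θ) with hD
  have tT0 : Tendsto (fun ε => T ε 0) (𝓝[>] 0) (𝓝 T₀) := by
    have h1 : T₀ = Function.uncurry T (0, 0) := by
      simp [hT₀, hTdef, Function.uncurry, segmentGauge, segmentPoint, hα0]
    rw [h1]
    refine Tendsto.comp (cT (0, 0) ⟨Set.self_mem_Ici, le_rfl, hpi.le⟩) (tendsto_nhdsWithin_iff.2 ⟨?_, ?_⟩)
      (f := fun ε : ℝ => (ε, (0 : ℝ)))
    · exact ((by fun_prop : Continuous fun ε : ℝ => (ε, (0 : ℝ))).tendsto 0).mono_left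
        nhdsWithin_le_nhds
    · filter_upwards [hev] with ε hε using ⟨hε.1.le, le_rfl, hpi.le⟩
  have tD0 : Tendsto (fun ε => D ε 0) (𝓝[>] 0) (𝓝 Z) := by
    rw [hZ]
    exact (((continuous_adjugate.tendsto _).comp tY0).mul tT0).mul
      ((continuous_conjM.tendsto _).comp tY0)
  -- the defect tends to zero
  have hdef0 : ∀ θ ∈ Set.Icc 0 (Real.pi / 2), segmentDefect Ω κ f α 0 θ = 0 := by
    intro θ hθ
    have hs : 0 ≤ Real.sin θ := Real.sin_nonneg_of_nonneg_of_le_pi hθ.1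
      (by linarith [hθ.2, Real.pi_pos])
    have hmem : |κ| * Real.sin θ ∈ Set.Icc 0 R := ⟨by positivity,
      (mul_le_of_le_one_right habs.le (Real.sin_le_one θ)).trans hκR.le⟩
    obtain ⟨z1, z2⟩ := hface _ hmem
    have hsp : segmentPoint ⟨0, κ⟩ θ = (|κ| * Real.sin θ, 0) := rfl
    rw [segmentDefect, hsp]
    simp only [z1, z2, corotDefect]
    ext i j
    fin_cases i <;> fin_cases j <;> simp
  have hdef : ∀ η > 0, ∀ᶠ ε in 𝓝[>] (0 : ℝ), ∀ θ ∈ Set.Icc 0 (Real.pi / 2),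
      ‖segmentDefect Ω κ f α ε θ‖ ≤ η := by
    intro η hη
    obtain ⟨v, hv, h⟩ := (isCompact_Icc (a := (0 : ℝ)) (b := Real.pi / 2)).mem_uniformity_of_prod
      (f := segmentDefect Ω κ f α) (s := Set.Ici (0 : ℝ)) (q := 0)
      (continuousOn_segmentDefect hf hα hκ Ω) Set.self_mem_Ici (Metric.dist_mem_uniformity hη)
    have hle : 𝓝[>] (0 : ℝ) ≤ 𝓝[≥] 0 := nhdsWithin_mono _ Set.Ioi_subset_Ici_self
    filter_upwards [hle hv] with ε hε θ hθ
    have := h ε hε θ hθ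
    rw [hdef0 θ hθ] at this
    rw [Set.mem_ofPred_eq, dist_zero_right] at this
    exact this.le
  have tdiff : Tendsto (fun ε => D ε (Real.pi / 2) - D ε 0) (𝓝[>] 0) (𝓝 0) := by
    refine Metric.tendsto_nhds.2 fun η hη => ?_
    set E := Real.exp (1 * (Real.pi / 2)) with hE
    have hEpos : 0 < E := Real.exp_pos _
    -- A defect below `δ` moves `D ε` by at most `|K₁| δ |K₂| E`, which is below `η`.
    set δ := η / (2 * E * (|K₁| * |K₂| + 1)) with hδ
    have hδpos : 0 < δ := by positivity
    filter_upwards [hev, hK, hdef δ hδpos] with ε hε hKε hdε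
    obtain ⟨y1, y2, -, -⟩ := hY ε hε.1
    have hball : ∀ t ∈ Set.Icc 0 (Real.pi / 2), Y ε t ∈ Metric.closedBall 0 K := fun t ht => by
      rw [mem_closedBall_zero_iff]; exact hKε t ht
    have hcD : ContinuousOn (D ε) (Set.Icc 0 (Real.pi / 2)) := by
      have c1 := continuous_adjugate.comp_continuousOn y1
      have c2 : ContinuousOn (T ε) (Set.Icc 0 (Real.pi / 2)) :=
        cT.comp (f := fun θ : ℝ => (ε, θ)) (by fun_prop) fun θ hθ => ⟨hε.1.le, hθ⟩
      have c3 := continuous_conjM.comp_continuousOn y1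
      exact (c1.mul c2).mul c3
    have hb := norm_le_of_deriv_le (h := fun t => D ε t - D ε 0)
      (h' := fun t => (Y ε t).adjugate * segmentDefect Ω κ f α ε t * conjM (Y ε t))
      (C := 1) (η := |K₁| * δ * |K₂|) one_pos (by positivity) (hcD.sub continuousOn_const)
      (fun t ht => by
        obtain ⟨T', hT', he⟩ := adjugate_add_deriv_eq_segmentDefect (Ω := Ω) hf ha hκR hκ0 hαa hε ht
        have := hasDerivAt_adjugate_mul_mul_conjM (y2 t ht) hT'
        rw [he] at this
        exact this.sub_const _)
      (fun t ht => by
        have ht' : t ∈ Set.Icc 0 (Real.pi / 2) := ⟨ht.1.le, ht.2.le⟩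
        have n1 := (hK₁ _ (hball t ht')).trans (le_abs_self _)
        have n2 := (hK₂ _ (hball t ht')).trans (le_abs_self _)
        have n3 := hdε t ht'
        have n4 : ‖(Y ε t).adjugate * segmentDefect Ω κ f α ε t * conjM (Y ε t)‖ ≤
            |K₁| * δ * |K₂| :=
          (norm_mul_le _ _).trans (mul_le_mul ((norm_mul_le _ _).trans
            (mul_le_mul n1 n3 (norm_nonneg _) (abs_nonneg _))) n2 (norm_nonneg _) (by positivity))
        have := norm_nonneg (D ε t - D ε 0)
        linarith) (Real.pi / 2) ⟨hpi.le, le_rfl⟩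
    simp only [sub_self, norm_zero, zero_add, div_one] at hb
    rw [dist_zero_right]
    calc ‖D ε (Real.pi / 2) - D ε 0‖ ≤ |K₁| * δ * |K₂| * E := hb
      _ = (|K₁| * |K₂|) * (δ * E) := by ring
      _ ≤ (|K₁| * |K₂| + 1) * (δ * E) := by gcongr; linarith
      _ = η / 2 := by rw [hδ]; field_simp
      _ < η := by linarith
  have tD1 : Tendsto (fun ε => D ε (Real.pi / 2)) (𝓝[>] 0) (𝓝 Z) := by
    have := tdiff.add tD0
    simpa using this
  -- Anticommutation holds exactly at the branch point for every small `ε > 0`; conservation is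
  -- needed only in the limit.
  refine tendsto_nhds_unique (tD1.mul_const sigma1) ((tD1.const_mul sigma1).neg.congr' ?_)
  filter_upwards [hev] with ε hε
  refine (anticommute_of_branch (hY ε hε.1).2.2.2 ?_).symm
  rw [hTdef, segmentGauge, Real.cos_pi_div_two]
  exact gaugeConj_zero_mul_sigma3 _ _ _ _

end Face

/-! ### The gauge matrix at the centre of the disk -/

/-- For `κ ≠ 0` the root `λ` tends to `1` at the centre. For `κ = 0` it depends on the direction of
approach, but it has modulus one while `k + iz → 0`; only the product occurs in `Λ`. -/
theorem tendsto_mul_lam_center (κ : ℝ) :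
    Tendsto (fun p : ℝ × ℝ => ((⟨0, κ⟩ : ℂ) + Complex.I * ((p.1 : ℂ) + Complex.I * (p.2 : ℂ))) *
      lam .upper ⟨0, κ⟩ p) (𝓝[upperQuadrant] (0, 0)) (𝓝 ⟨0, κ⟩) := by
  have hlin : Continuous fun p : ℝ × ℝ =>
      (⟨0, κ⟩ : ℂ) + Complex.I * ((p.1 : ℂ) + Complex.I * (p.2 : ℂ)) := by fun_prop
  have h0 := hlin.tendsto (0, 0)
  simp only [Complex.ofReal_zero, mul_zero, add_zero] at h0
  rcases eq_or_ne κ 0 with rfl | hκ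
  · have hz : (⟨0, 0⟩ : ℂ) = 0 := rfl
    rw [hz] at h0 ⊢
    have hn := h0.norm.mono_left (nhdsWithin_le_nhds (s := upperQuadrant))
    rw [norm_zero] at hn
    refine squeeze_zero_norm' ?_ hn
    filter_upwards [self_mem_nhdsWithin] with p hp
    rw [norm_mul]
    have hne : Complex.I * ((p.1 : ℂ) + Complex.I * (p.2 : ℂ)) ≠ 0 := fun e => by
      have := congrArg Complex.im e
      simp at this
      exact hp.1.ne' this
    have hnorm : ‖(0 - Complex.I * ((p.1 : ℂ) - Complex.I * (p.2 : ℂ))) /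
        (0 + Complex.I * ((p.1 : ℂ) + Complex.I * (p.2 : ℂ)))‖ = 1 := by
      have hc : (p.1 : ℂ) - Complex.I * (p.2 : ℂ) =
          starRingEnd ℂ ((p.1 : ℂ) + Complex.I * (p.2 : ℂ)) := by
        apply Complex.ext <;> simp
      rw [zero_sub, zero_add, hc, norm_div, norm_neg, norm_mul, Complex.norm_conj, ← norm_mul,
        div_self (norm_ne_zero_iff.2 hne)]
    have hl : ‖lam .upper 0 p‖ = 1 := by
      have e : (1 / 2 : ℂ) = ((1 / 2 : ℝ) : ℂ) := by push_cast; rfl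
      simp only [lam, Sheet.sign, one_mul]
      rw [e, Complex.norm_cpow_real, hnorm, Real.one_rpow]
    rw [hl, mul_one]
  · have hk : (⟨0, κ⟩ : ℂ) ≠ 0 := fun e => hκ (congrArg Complex.im e)
    have hl : Tendsto (lam .upper ⟨0, κ⟩) (𝓝 (0, 0)) (𝓝 1) := by
      have hc : ContinuousAt (lam .upper ⟨0, κ⟩) (0, 0) := by
        unfold lam
        refine continuousAt_const.mul (ContinuousAt.cpow ?_ continuousAt_const ?_)
        · exact ContinuousAt.div (by fun_prop) (by fun_prop) (by simpa using hk)
        · simp [hk]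
      have hv : lam .upper ⟨0, κ⟩ (0, 0) = 1 := by simp [lam, Sheet.sign, hk]
      rw [← hv]
      exact hc.tendsto
    have := h0.mul hl
    rw [mul_one] at this
    exact this.mono_left nhdsWithin_le_nhds

/-- The value `Λ(+i0, k^+)` with `t = κ Ω e^{-2U}`, `k = iκ`. -/
def centerGauge (t : ℝ) : Matrix (Fin 2) (Fin 2) ℂ := !![1 + (t : ℂ), t; -t, 1 - t]

theorem tendsto_gaugeMatrix {ρ₀ Ω : ℝ} {f : ℝ × ℝ → ℂ} {a : ℝ × ℝ → ℝ} (hρ₀ : 0 < ρ₀)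
    (hf : IsErnstPotential ρ₀ f) (ha : IsMetricFunction ρ₀ f a) (κ : ℝ) :
    Tendsto (gaugeMatrix Ω f a ⟨0, κ⟩) (𝓝[upperQuadrant] (0, 0))
      (𝓝 (centerGauge (κ * Ω / (upperExt f (0, 0)).re))) := by
  have hm0 := mem_upperBoundaryRegion_axis hρ₀ (le_refl (0 : ℝ))
  have hu0 := (hf.ext_re_pos hm0).ne'
  set u₀ := (upperExt f (0, 0)).re with hu₀
  have hu0' : (u₀ : ℂ) ≠ 0 := by exact_mod_cast hu0
  have tu : Tendsto (fun p => (((f p).re : ℝ) : ℂ)) (𝓝[upperQuadrant] (0, 0)) (𝓝 (u₀ : ℂ)) :=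
    ((Complex.continuous_ofReal.comp Complex.continuous_re).tendsto _).comp
      (hf.extends_self.tendsto hm0)
  have ta : Tendsto (fun p => ((a p : ℝ) : ℂ)) (𝓝[upperQuadrant] (0, 0)) (𝓝 ((0 : ℝ) : ℂ)) :=
    (Complex.continuous_ofReal.tendsto 0).comp (ha.tendsto_zero hf hρ₀)
  have tρ : Tendsto (fun p : ℝ × ℝ => (p.1 : ℂ)) (𝓝[upperQuadrant] (0, 0)) (𝓝 ((0 : ℝ) : ℂ)) :=
    ((Complex.continuous_ofReal.comp continuous_fst).tendsto (0, 0)).mono_left nhdsWithin_le_nhds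
  have hlin : Continuous fun p : ℝ × ℝ =>
      (⟨0, κ⟩ : ℂ) + Complex.I * ((p.1 : ℂ) + Complex.I * (p.2 : ℂ)) := by fun_prop
  have tk := (hlin.tendsto (0, 0)).mono_left (nhdsWithin_le_nhds (s := upperQuadrant))
  simp only [Complex.ofReal_zero, mul_zero, add_zero] at tk
  have tl := tendsto_mul_lam_center κ
  have t1 := (ta.const_mul (Ω : ℂ)).const_add 1
  have t2 := (tρ.const_mul (Ω : ℂ)).div tu hu0'
  have t3 := ((tk.const_mul Complex.I).mul_const (Ω : ℂ)).div tu hu0'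
  have t4 := ((tl.const_mul Complex.I).mul_const (Ω : ℂ)).div tu hu0'
  have h := (((t1.smul_const (1 : Matrix (Fin 2) (Fin 2) ℂ)).sub (t2.smul_const sigma3)).sub
    (t3.smul_const sigma3)).add (t4.smul_const (sigma1 * sigma3))
  have hI : Complex.I * (⟨0, κ⟩ : ℂ) = -(κ : ℂ) := by apply Complex.ext <;> simp
  refine (h.congr fun p => ?_).trans (le_of_eq (congrArg 𝓝 ?_))
  · simp only [gaugeMatrix, Pi.div_apply]
    rw [smul_add, smul_neg, smul_smul]
    have e : Complex.I * (((⟨0, κ⟩ : ℂ) + Complex.I * ((p.1 : ℂ) + Complex.I * (p.2 : ℂ))) *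
        lam .upper ⟨0, κ⟩ p) * (Ω : ℂ) / ((f p).re : ℂ) =
      Complex.I * ((⟨0, κ⟩ : ℂ) + Complex.I * ((p.1 : ℂ) + Complex.I * (p.2 : ℂ))) * (Ω : ℂ) /
        ((f p).re : ℂ) * lam .upper ⟨0, κ⟩ p := by ring
    rw [e]
    abel
  · rw [hI]
    ext i j
    fin_cases i <;> fin_cases j <;>
      simp [centerGauge, sigma1, sigma3] <;> ring

/-- With `t = κΩ/u`, the central value of `Λ` is real with determinant `(1 + t)(1 - t) + t² = 1`, so
its inverse is its adjugate. This identifies the start value of the conserved quantity, at `cos θ =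
1` and `a = 0`. -/
theorem centerGauge_conj (Ω κ u : ℝ) :
    (centerGauge (κ * Ω / u))⁻¹ * sigma1 * sigma3 * conjM (centerGauge (κ * Ω / u)) =
      gaugeConj Ω κ 1 1 (1 / u) := by
  have hdet : (centerGauge (κ * Ω / u)).det = 1 := by
    rw [centerGauge, Matrix.det_fin_two_of]; ring
  have hconj : conjM (centerGauge (κ * Ω / u)) = centerGauge (κ * Ω / u) := by
    ext i j
    fin_cases i <;> fin_cases j <;>
      simp only [conjM, centerGauge, Matrix.map_apply, Matrix.of_apply, Matrix.cons_val',
        Matrix.cons_val_zero, Matrix.cons_val_one, Matrix.cons_val_fin_one, Fin.zero_eta,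
        Fin.mk_one, map_add, map_sub, map_neg, map_one, Complex.conj_ofReal]
  rw [hconj, Matrix.inv_def, hdet, Ring.inverse_one, one_smul, centerGauge,
    Matrix.adjugate_fin_two]
  ext i j
  fin_cases i <;> fin_cases j <;>
    simp [gaugeConj, sigma1, sigma3, Matrix.mul_apply, Fin.sum_univ_two] <;> ring

/-- For invertible `A` one has `Z = det A det B · A⁻¹ X Ā` with `X = B⁻¹ T B̄`; cancel the scalar
and multiply by `A` on the left and `Ā⁻¹` on the right. -/
theorem relation_of_anticommute {B Λ A T Z : Matrix (Fin 2) (Fin 2) ℂ} (hB : B.det ≠ 0)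
    (hT : Λ⁻¹ * sigma1 * sigma3 * conjM Λ = T)
    (hZ : Z = (B * A).adjugate * T * conjM (B * A)) (h : Z * sigma1 = -(sigma1 * Z)) :
    AlgebraicRelation B (conjM B) Λ A := by
  have hX : B⁻¹ * Λ⁻¹ * sigma1 * sigma3 * conjM Λ * conjM B = B⁻¹ * T * conjM B := by
    rw [← hT]; simp only [mul_assoc]
  rw [AlgebraicRelation, hX]
  -- For singular `A` the inverses of `A` and `Ā` are `0` by convention, and both sides vanish.
  by_cases hA : A.det = 0
  · have h1 : A⁻¹ = 0 := Matrix.nonsing_inv_apply_not_isUnit _ (by simp [hA])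
    have h2 : (conjM A).det = 0 := by
      have : (conjM A).det = starRingEnd ℂ A.det := (RingHom.map_det _ _).symm
      rw [this, hA, map_zero]
    have h3 : (conjM A)⁻¹ = 0 := Matrix.nonsing_inv_apply_not_isUnit _ (by simp [h2])
    simp [h1, h3]
  · have hAu : IsUnit A.det := isUnit_iff_ne_zero.2 hA
    have hcu : IsUnit (conjM A).det := by
      have : (conjM A).det = starRingEnd ℂ A.det := (RingHom.map_det _ _).symm
      rw [this]; exact hAu.map _
    have hBu : IsUnit B.det := isUnit_iff_ne_zero.2 hB
    have hadj : ∀ M : Matrix (Fin 2) (Fin 2) ℂ, IsUnit M.det → M.adjugate = M.det • M⁻¹ :=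
      fun M hM => by
        rw [Matrix.inv_def, smul_smul, Ring.mul_inverse_cancel _ hM, one_smul]
    set X := B⁻¹ * T * conjM B with hXdef
    have hZX : Z = (A.det * B.det) • (A⁻¹ * X * conjM A) := by
      rw [hZ, Matrix.adjugate_mul_distrib, conjM_mul, hadj A hAu, hadj B hBu, hXdef]
      simp only [Matrix.smul_mul, Matrix.mul_smul, smul_smul, mul_assoc]
      rw [mul_comm B.det A.det]
    rw [hZX, Matrix.smul_mul, Matrix.mul_smul, ← smul_neg] at h
    have h' : A⁻¹ * X * conjM A * sigma1 = -(sigma1 * (A⁻¹ * X * conjM A)) :=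
      smul_right_injective _ (mul_ne_zero hA hB) h
    calc X * (conjM A * sigma1 * (conjM A)⁻¹)
        = A * (A⁻¹ * X * conjM A * sigma1) * (conjM A)⁻¹ := by
          simp only [mul_assoc]
          rw [Matrix.mul_nonsing_inv_cancel_left _ _ hAu]
      _ = -(A * sigma1 * A⁻¹ * X * (conjM A * (conjM A)⁻¹)) := by
          rw [h']; noncomm_ring
      _ = -(A * sigma1 * A⁻¹ * X) := by rw [Matrix.mul_nonsing_inv _ hcu, mul_one]

/-! ### The relation on all of `Γ` -/

theorem neBot_punctured_interval {ρ₀ κ : ℝ} (hρ₀ : 0 < ρ₀) (hκ : |κ| ≤ ρ₀) :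
    (𝓝[{x : ℝ | x ≠ 0 ∧ |x| < ρ₀}] κ).NeBot := by
  rw [← mem_closure_iff_nhdsWithin_neBot]
  rcases le_total 0 κ with h | h
  · have hs : Set.Ioo 0 ρ₀ ⊆ {x : ℝ | x ≠ 0 ∧ |x| < ρ₀} := fun x hx =>
      ⟨hx.1.ne', by rw [abs_of_pos hx.1]; exact hx.2⟩
    refine closure_mono hs ?_
    rw [closure_Ioo hρ₀.ne]
    exact ⟨h, (le_abs_self κ).trans hκ⟩
  · have hs : Set.Ioo (-ρ₀) 0 ⊆ {x : ℝ | x ≠ 0 ∧ |x| < ρ₀} := fun x hx =>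
      ⟨hx.2.ne, by rw [abs_of_neg hx.2]; linarith [hx.1]⟩
    refine closure_mono hs ?_
    rw [closure_Ioo (by linarith)]
    exact ⟨by linarith [neg_abs_le κ], h⟩

theorem algebraicRelation_of_tendsto {ρ₀ Ω κ : ℝ} {f f' : ℝ × ℝ → ℂ} {a : ℝ × ℝ → ℝ}
    (hρ₀ : 0 < ρ₀) (hf : IsErnstPotential ρ₀ f) (ha : IsMetricFunction ρ₀ f a)
    (hf' : IsCorotatingPotential ρ₀ Ω f a f')
    (hdisk : ∀ ρ : ℝ, 0 < ρ → ρ < ρ₀ → Tendsto (fun ζ : ℝ => dRho f' (ρ, ζ)) (𝓝[>] 0) (𝓝 0))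
    {Φ : Sheet → ℂ → ℝ × ℝ → Matrix (Fin 2) (Fin 2) ℂ} {F G : ℂ → ℂ}
    (hΦ : IsEigenfunction ρ₀ f Φ) (hFG : IsSpectralPair ρ₀ Φ F G) (hκ : |κ| ≤ ρ₀)
    {Fp Gp : ℂ} (hF : Tendsto F (𝓝[{w : ℂ | 0 < w.re}] ⟨0, κ⟩) (𝓝 Fp))
    (hG : Tendsto G (𝓝[{w : ℂ | 0 < w.re}] ⟨0, κ⟩) (𝓝 Gp)) :
    AlgebraicRelation (axisMatrix (upperExt f (0, 0))) (conjM (axisMatrix (upperExt f (0, 0))))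
      (centerGauge (κ * Ω / (upperExt f (0, 0)).re)) (spectralMatrix Fp Gp) := by
  have hm0 := mem_upperBoundaryRegion_axis hρ₀ (le_refl (0 : ℝ))
  set b := upperExt f (0, 0) with hb
  have hdet : (axisMatrix b).det ≠ 0 := by
    have := add_conj_ne_zero (hf.ext_re_pos hm0)
    rw [axisMatrix, Matrix.det_fin_two_of]
    intro e
    apply this
    linear_combination -e
  refine relation_of_anticommute hdet (centerGauge_conj Ω κ b.re) rfl ?_
  set S : Set ℂ := {w : ℂ | 0 < w.re} with hS
  have hcl : ∀ w : ℂ, w.re = 0 → w ∈ closure S := fun w hw => by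
    rw [hS, Complex.closure_setOfPred_lt_re]; exact hw.ge
  -- The given point is adjoined to the open segment because at `±iρ₀` the limits exist only by
  -- assumption. Where limits from the half-plane exist, they depend continuously on the boundary
  -- point, so `0` and `±iρ₀` are limits of points at which the relation is established.
  set V : Set ℂ := {w : ℂ | w = ⟨0, κ⟩ ∨ (w.re = 0 ∧ |w.im| < ρ₀)} with hV
  have hVre : ∀ w ∈ V, w.re = 0 := by
    rintro w (rfl | h)
    · rfl
    · exact h.1
  have hlim : ∀ w ∈ V, (∃ y, Tendsto F (𝓝[S] w) (𝓝 y)) ∧ ∃ y, Tendsto G (𝓝[S] w) (𝓝 y) := by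
    rintro w (rfl | h)
    · exact ⟨⟨_, hF⟩, ⟨_, hG⟩⟩
    · obtain ⟨x, y, h1, h2⟩ := hΦ.exists_spectral_limit hf hFG hρ₀ h.1 h.2
      exact ⟨⟨_, h1⟩, ⟨_, h2⟩⟩
  have hkV : (⟨0, κ⟩ : ℂ) ∈ V := Or.inl rfl
  have cF := continuousOn_extendFrom (fun w hw => hcl w (hVre w hw)) (fun w hw => (hlim w hw).1)
    _ hkV
  have cG := continuousOn_extendFrom (fun w hw => hcl w (hVre w hw)) (fun w hw => (hlim w hw).2)
    _ hkV
  have eF : extendFrom S F ⟨0, κ⟩ = Fp := extendFrom_eq (hcl _ rfl) hF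
  have eG : extendFrom S G ⟨0, κ⟩ = Gp := extendFrom_eq (hcl _ rfl) hG
  have hne := neBot_punctured_interval hρ₀ hκ
  set l := 𝓝[{x : ℝ | x ≠ 0 ∧ |x| < ρ₀}] κ with hl
  have hpath : Tendsto (fun x : ℝ => (⟨0, x⟩ : ℂ)) l (𝓝[V] ⟨0, κ⟩) := by
    refine tendsto_nhdsWithin_iff.2 ⟨?_, ?_⟩
    · have : Continuous fun x : ℝ => (⟨0, x⟩ : ℂ) := by
        have : (fun x : ℝ => (⟨0, x⟩ : ℂ)) = fun x : ℝ => x * Complex.I := by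
          funext x; apply Complex.ext <;> simp
        rw [this]; fun_prop
      exact (this.tendsto κ).mono_left nhdsWithin_le_nhds
    · filter_upwards [self_mem_nhdsWithin] with x hx using Or.inr ⟨rfl, hx.2⟩
  have tF : Tendsto (fun x : ℝ => extendFrom S F ⟨0, x⟩) l (𝓝 Fp) := by
    have := Tendsto.comp cF hpath
    rwa [eF] at this
  have tG : Tendsto (fun x : ℝ => extendFrom S G ⟨0, x⟩) l (𝓝 Gp) := by
    have := Tendsto.comp cG hpath
    rwa [eG] at this
  have tA := (continuous_spectralMatrix.tendsto (Fp, Gp)).comp (tF.prodMk_nhds tG)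
  have tM := tA.const_mul (axisMatrix b)
  have cT : Continuous fun x : ℝ => gaugeConj Ω x 1 1 (1 / b.re) := by
    refine continuous_pi fun i => continuous_pi fun j => ?_
    fin_cases i <;> fin_cases j <;> exact Complex.continuous_ofReal.comp (by fun_prop)
  have tT := (cT.tendsto κ).mono_left (nhdsWithin_le_nhds (s := {x : ℝ | x ≠ 0 ∧ |x| < ρ₀}))
  have tZ := (((continuous_adjugate.tendsto _).comp tM).mul tT).mul
    ((continuous_conjM.tendsto _).comp tM)
  refine tendsto_nhds_unique (tZ.mul_const sigma1) ((tZ.const_mul sigma1).neg.congr' ?_)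
  filter_upwards [self_mem_nhdsWithin] with x hx
  have hxV : (⟨0, x⟩ : ℂ) ∈ V := Or.inr ⟨rfl, hx.2⟩
  exact (anticommute_of_tendsto hf ha hf' hdisk hΦ hFG hx.1 hx.2
    (tendsto_extendFrom (hlim _ hxV).1) (tendsto_extendFrom (hlim _ hxV).2) rfl rfl rfl).symm

theorem bottom_eq_conj_top {ρ₀ : ℝ} {f : ℝ × ℝ → ℂ} {fTop fBot : ℂ}
    (hTop : Tendsto f (𝓝[upperQuadrant] (0, 0)) (𝓝 fTop))
    (hBot : Tendsto f (𝓝[lowerQuadrant] (0, 0)) (𝓝 fBot))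
    (hsymm : ∀ p ∈ exterior ρ₀, f (p.1, -p.2) = starRingEnd ℂ (f p)) :
    fBot = starRingEnd ℂ fTop := by
  have hcl : ((0 : ℝ), (0 : ℝ)) ∈ closure upperQuadrant := by
    rw [upperQuadrant_eq_prod, closure_prod_eq, closure_Ioi]
    exact ⟨Set.self_mem_Ici, Set.self_mem_Ici⟩
  have := mem_closure_iff_nhdsWithin_neBot.1 hcl
  have hrefl : Tendsto (fun p : ℝ × ℝ => (p.1, -p.2)) (𝓝[upperQuadrant] (0, 0))
      (𝓝[lowerQuadrant] (0, 0)) := by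
    refine tendsto_nhdsWithin_iff.2 ⟨?_, ?_⟩
    · have h : Continuous fun p : ℝ × ℝ => (p.1, -p.2) := by fun_prop
      have := h.tendsto (0, 0)
      simp only [neg_zero] at this
      exact this.mono_left nhdsWithin_le_nhds
    · filter_upwards [self_mem_nhdsWithin] with p hp using ⟨hp.1, neg_neg_of_pos hp.2⟩
  refine tendsto_nhds_unique (hBot.comp hrefl)
    (((Complex.continuous_conj.tendsto _).comp hTop).congr' ?_)
  filter_upwards [self_mem_nhdsWithin] with p hp
  exact (hsymm p (upperQuadrant_subset_exterior ρ₀ hp)).symm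

end Ernst

end

theorem mainTheorem5 (ρ₀ Ω : ℝ) (hρ₀ : 0 < ρ₀)
    (f f' : ℝ × ℝ → ℂ) (a : ℝ × ℝ → ℝ)
    (hf : Ernst.IsErnstPotential ρ₀ f) (ha : Ernst.IsMetricFunction ρ₀ f a)
    (hf' : Ernst.IsCorotatingPotential ρ₀ Ω f a f')
    -- `f'_ρ (ρ, ±0) = 0` on the disk
    (hdisk : ∀ ρ : ℝ, 0 < ρ → ρ < ρ₀ →
      Tendsto (fun ζ : ℝ => Ernst.dRho f' (ρ, ζ)) (𝓝[>] 0) (𝓝 0) ∧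
        Tendsto (fun ζ : ℝ => Ernst.dRho f' (ρ, ζ)) (𝓝[<] 0) (𝓝 0))
    (Φ : Ernst.Sheet → ℂ → ℝ × ℝ → Matrix (Fin 2) (Fin 2) ℂ)
    (hΦ : Ernst.IsEigenfunction ρ₀ f Φ)
    (F G : ℂ → ℂ) (hFG : Ernst.IsSpectralPair ρ₀ Φ F G)
    -- `fTop = f(+i0)` and `fBot = f(-i0)`
    (fTop fBot : ℂ)
    (hTop : Tendsto f (𝓝[Ernst.upperQuadrant] (0, 0)) (𝓝 fTop))
    (hBot : Tendsto f (𝓝[Ernst.lowerQuadrant] (0, 0)) (𝓝 fBot)) :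
    -- the boundary values `F₊`, `G₊` exist in the interior of `Γ`
    (∀ k ∈ Ernst.Gam ρ₀, |k.im| < ρ₀ → ∃ Fp Gp : ℂ,
      Tendsto F (𝓝[{w : ℂ | 0 < w.re}] k) (𝓝 Fp) ∧
        Tendsto G (𝓝[{w : ℂ | 0 < w.re}] k) (𝓝 Gp)) ∧
    -- the value `Λ(k) = Λ(+i0, k^+)` exists
    (∀ k ∈ Ernst.Gam ρ₀, ∃ Λ : Matrix (Fin 2) (Fin 2) ℂ,
      Tendsto (Ernst.gaugeMatrix Ω f a k) (𝓝[Ernst.upperQuadrant] (0, 0)) (𝓝 Λ)) ∧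
    -- the relation
    (∀ k ∈ Ernst.Gam ρ₀, ∀ (Fp Gp : ℂ) (Λ : Matrix (Fin 2) (Fin 2) ℂ),
      Tendsto F (𝓝[{w : ℂ | 0 < w.re}] k) (𝓝 Fp) →
      Tendsto G (𝓝[{w : ℂ | 0 < w.re}] k) (𝓝 Gp) →
      Tendsto (Ernst.gaugeMatrix Ω f a k) (𝓝[Ernst.upperQuadrant] (0, 0)) (𝓝 Λ) →
      Ernst.AlgebraicRelation (Ernst.axisMatrix fTop) (Ernst.conjM (Ernst.axisMatrix fTop)) Λ
          (Ernst.spectralMatrix Fp Gp) ∧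
        ((∀ p ∈ Ernst.exterior ρ₀, f (p.1, -p.2) = starRingEnd ℂ (f p)) →
          Ernst.AlgebraicRelation (Ernst.axisMatrix fTop) (Ernst.axisMatrix fBot) Λ
            (Ernst.spectralMatrix Fp Gp))) := by
  have hm0 := Ernst.mem_upperBoundaryRegion_axis hρ₀ (le_refl (0 : ℝ))
  have := Ernst.neBot_upperQuadrant hm0
  have hT : fTop = Ernst.upperExt f (0, 0) :=
    tendsto_nhds_unique hTop (hf.extends_self.tendsto hm0)
  refine ⟨fun k hk him => hΦ.exists_spectral_limit hf hFG hρ₀ hk.1 him, ?_, ?_⟩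
  · rintro ⟨x, κ⟩ ⟨hx, -⟩
    obtain rfl : x = 0 := hx
    exact ⟨_, Ernst.tendsto_gaugeMatrix hρ₀ hf ha κ⟩
  · rintro ⟨x, κ⟩ ⟨hx, hκ⟩ Fp Gp Λ hF hG hΛ
    obtain rfl : x = 0 := hx
    obtain rfl := tendsto_nhds_unique hΛ (Ernst.tendsto_gaugeMatrix hρ₀ hf ha κ)
    have hrel := Ernst.algebraicRelation_of_tendsto hρ₀ hf ha hf'
      (fun ρ h1 h2 => (hdisk ρ h1 h2).1) hΦ hFG hκ hF hG
    rw [hT]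
    refine ⟨hrel, fun hsymm => ?_⟩
    -- Equatorial symmetry gives `f(-i0)` as the conjugate of `f(+i0)`, so the two versions of `B̄`
    -- are the same matrix.
    have hB : Ernst.axisMatrix fBot = Ernst.conjM (Ernst.axisMatrix (Ernst.upperExt f (0, 0))) := by
      rw [Ernst.bottom_eq_conj_top hTop hBot hsymm, hT]
      ext i j
      fin_cases i <;> fin_cases j <;> simp [Ernst.axisMatrix, Ernst.conjM]
    rw [hB]
    exact hrel
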